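/- **Setting.** Let $(X_t,\xi_t)_{t\ge1}$ be iid couples with values in $\mathcal X\times\mathbb R$, where $\mathcal X$ is a measurable space, with $\xi_1$ independent of $X_1$, and let $$Y_t=\mu(X_t)+\sigma(X_t)\,\xi_t,\qquad t\ge 1,$$ with $\mu:\mathcal X\to\mathbb R$ and $\sigma:\mathcal X\to(0,\infty)$ measurable. Assume that $\sup_{x\in\mathcal X}1/\sigma(x)<\infty$, that $\mathbb E\,\xi_1^2=1$, and that $\xi_1$ has a symmetric continuous density $f$ with respect to Lebesgue measure, positive on an interval and zero outside it, with $\sup_x f(x)<\infty$ and $\sup_x|x|f(x)<\infty$. Let $\mathcal D_0$ be a finite holdout sample with values in $\mathcal X\times\mathbb R$, independent of $(X_t,\xi_t)_{t\ge1}$, and let $\mathcal F_t=\sigma(\mathcal D_0,(X_k,Y_k)_{1\le k\le t})$. Let $\hat\mu_t,\hat\sigma_t$ be real-valued $\mathcal F_{t-1}$-measurable estimators, i.e. random functions on $\mathcal X$ that are jointly measurable in (outcome, $x$) with respect to $\mathcal F_{t-1}$ and the $\sigma$-field of $\mathcal X$. Let $S:\mathcal X\to\{0,1\}$ be a measurable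 selection rule with $\mathbb P(S(X_1)=1)\in(0,1]$. Let $\Phi$ be the standard normal distribution function, $\bar\Phi=1-\Phi$, $\bar F(x)=\mathbb P(\xi_1>x)$, and fix $\alpha\in(0,1)$. Put $$\mathcal C_t(x,q)=\Big[\hat\mu_t(x)\pm\hat\sigma_t(x)\,\Phi^{-1}\Big(\frac{q+1}{2}\Big)\Big]\ \text{ for } 0<q<1,$$ $\mathcal C_t(x,q)=\{\hat\mu_t(x)\}$ for $q\le0$ and $\mathcal C_t(x,q)=\mathbb R$ for $q\ge1$ (with $[a\pm b]=[a-b,a+b]$). **OnlineSCI.** Let $\gamma_j=c\,j^{-\beta}$ with $c>0$ and $\beta\in(0,1)$, and let $q_1\in[0,1]$. For $t\ge1$ put $J(t)=1+\sum_{i=1}^{t-1}S(X_i)$ and $$q_{t+1}=q_t+\gamma_{J(t)}\big(\mathbf 1\{Y_t\notin\mathcal C_t(X_t,q_t)\}\mathbf 1\{q_t\ge0\}+\mathbf 1\{q_t<0\}-\alpha\big)\,S(X_t).$$ The instantaneous error rate is $\mathrm{IER}_t=\mathbb P\big(Y_t\notin\mathcal C_t(X_t,q_t)\mid S(X_t)=1,\mathcal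 F_{t-1}\big)$, and the target threshold is $q^0_\alpha=1-2\bar\Phi(\bar F^{-1}(\alpha/2))$. Let $$\rho(t)=\begin{cases}(\log t)^{1/2}\,t^{-\beta/3}&\text{if }\beta\in(1/2,3/4),\\ (\log t)^{1/2}\,t^{1/2-\beta}+t^{\beta-1}&\text{if }\beta\in[3/4,1).\end{cases}$$ **Result.** Let $\nu_0,\tau_0>0$ and $\nu,\tau\in(0,1/2]$. There exist $T_0\ge1$ and $C_0>0$, which may depend on everything but $t$, such that for all $t\ge T_0$: * *In-probability rate.* If $\beta\in(1/2,1)$ and, for some $C_1>0$ and all $s$ large enough, $$\mathbb P\Big(\mathbb E\big[|\hat\mu_s(X_s)-\mu(X_s)|+|\hat\sigma_s(X_s)-\sigma(X_s)|\,\big|\,\mathcal F_{s-1}\big]\ge C_1(\log s)^{\nu_0}s^{-\nu}\Big)\le\frac{3}{\pi^2s^3},$$ then $$\mathbb P\Big(|\mathrm{IER}_t-\alpha|+|q_t-q^0_\alpha|\le C_0\big(\rho(t)+(\log t)^{\nu_0}t^{-\nu}\big)\Big)\ge1-\frac1t.$$ * *In-expectation rate.* If $\beta>1-\tau$ and, for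 some $C_1>0$ and all $s$ large enough, $$\mathbb E\big[(\hat\mu_s(X_s)-\mu(X_s))^2\big]+\mathbb E\big[(\hat\sigma_s(X_s)-\sigma(X_s))^2\big]\le C_1(\log s)^{2\tau_0}s^{-2\tau},$$ then $$\Big(\mathbb E\big[|\mathrm{IER}_t-\alpha|\,\mathbf 1\{q_t\in[0,1]\}\big]\Big)^2+\mathbb E\big[(q_t-q^0_\alpha)^2\big]\le C_0(\log t)^{\tau_0}\,t^{1-\tau-\beta}.$$ -/

import Mathlib

open MeasureTheory ProbabilityTheory Filter

namespace OnlineSCI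

noncomputable section

/-! ### Quantiles, the prediction interval and the error function -/

/-- Upper tail `x ↦ ν (x, ∞)` of a distribution `ν` on the real line. -/
def upperTail (ν : Measure ℝ) (x : ℝ) : ℝ := ν.real (Set.Ioi x)

/-- Inverse of the upper tail (generalized inverse, for levels in `(0, 1)`). -/
def upperTailInv (ν : Measure ℝ) (u : ℝ) : ℝ := sInf {x : ℝ | upperTail ν x ≤ u}

/-- Standard normal distribution. -/
def stdNormal : Measure ℝ := gaussianReal 0 1

/-- Standard normal quantile function `Φ⁻¹`, for levels in `(0, 1)`. -/
def normalQuantile (p : ℝ) : ℝ := sInf {x : ℝ | p ≤ cdf stdNormal x}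

/-- The prediction set attached to the threshold `q` (scores are scaled to `[0, 1]`), around the
point prediction `m` with scale `s`: the interval `[m ± s Φ⁻¹((q + 1) / 2)]` for `0 < q < 1`, the
point prediction for `q ≤ 0` and the whole line for `q ≥ 1`. -/
def predInterval (m s q : ℝ) : Set ℝ :=
  if q ≤ 0 then {m}
  else if 1 ≤ q then Set.univ
  else Set.Icc (m - s * normalQuantile ((q + 1) / 2)) (m + s * normalQuantile ((q + 1) / 2))

open Classical in
/-- Coverage error `1{y ∉ C}`. -/
def covErr (y : ℝ) (C : Set ℝ) : ℝ := if y ∈ C then 0 else 1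

/-- Reaction function: the error when `q ≥ 0`, and `1` when `q < 0`. -/
def react (y : ℝ) (C : Set ℝ) (q : ℝ) : ℝ := if 0 ≤ q then covErr y C else 1

/-! ### The OnlineSCI recursion (along one realization of the data)

Time starts at `1`; the values at time `0` are not used. -/

/-- The pair `(q_t, J(t))`: threshold, and one plus the number of selections before time `t`. -/
def sciState {𝒳 : Type*} (α : ℝ) (γ : ℕ → ℝ) (q₁ : ℝ) (S : ℕ → 𝒳 → ℝ → Bool)
    (C : ℕ → 𝒳 → ℝ → Set ℝ) (x : ℕ → 𝒳) (y : ℕ → ℝ) : ℕ → ℝ × ℕ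
  | 0 => (q₁, 1)
  | 1 => (q₁, 1)
  | t + 2 =>
    let q := (sciState α γ q₁ S C x y (t + 1)).1
    let J := (sciState α γ q₁ S C x y (t + 1)).2
    let s := (S (t + 1) (x (t + 1)) q).toNat
    (q + γ J * (react (y (t + 1)) (C (t + 1) (x (t + 1)) q) q - α) * (s : ℝ), J + s)

/-- The OnlineSCI threshold sequence `q_t`. -/
def sciThreshold {𝒳 : Type*} (α : ℝ) (γ : ℕ → ℝ) (q₁ : ℝ) (S : ℕ → 𝒳 → ℝ → Bool)
    (C : ℕ → 𝒳 → ℝ → Set ℝ) (x : ℕ → 𝒳) (y : ℕ → ℝ) (t : ℕ) : ℝ :=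
  (sciState α γ q₁ S C x y t).1

/-! ### Probabilistic setting -/

/-- The information `ℱ_t` generated by the holdout sample `D₀` and by `(X_k, Y_k)`, `1 ≤ k ≤ t`. -/
abbrev past {Ω 𝒳 : Type*} [MeasurableSpace 𝒳] {n : ℕ} (D₀ : Fin n → Ω → 𝒳 × ℝ) (X : ℕ → Ω → 𝒳) (Y : ℕ → Ω → ℝ) (t : ℕ) :
    MeasurableSpace Ω :=
  (⨆ i : Fin n, MeasurableSpace.comap (D₀ i) inferInstance) ⊔
    ⨆ k ∈ Set.Icc 1 t, MeasurableSpace.comap (fun ω => (X k ω, Y k ω)) inferInstance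

/-- `μ̂_t` is a function of the covariate and of the past: `(ω, x) ↦ μ̂_t(ω, x)` is
`ℱ_{t-1} ⊗ 𝒳`-measurable for each `t ≥ 1`. -/
def IsPastMeasurable {Ω 𝒳 : Type*} [MeasurableSpace 𝒳] (ℱ : ℕ → MeasurableSpace Ω)
    (est : ℕ → Ω → 𝒳 → ℝ) : Prop :=
  ∀ t, 1 ≤ t →
    @Measurable (Ω × 𝒳) ℝ (@Prod.instMeasurableSpace Ω 𝒳 (ℱ (t - 1)) inferInstance) inferInstance
      (fun p => est t p.1 p.2)

section Setting

variable {Ω 𝒳 : Type*} [MeasurableSpace Ω] [MeasurableSpace 𝒳]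

/-- `E[err | s = 1, ℱ] = E[err 1{s = 1} | ℱ] / P(s = 1 | ℱ)`, with value `0` where the denominator
vanishes. -/
def instErrorRate (P : Measure Ω) (ℱ : MeasurableSpace Ω) (s : Ω → Bool) (err : Ω → ℝ) (ω : Ω) :
    ℝ :=
  (P[fun ω' => err ω' * ((s ω').toNat : ℝ) | ℱ]) ω / (P[fun ω' => ((s ω').toNat : ℝ) | ℱ]) ω

/-- The online iid regression model `Y_t = μ(X_t) + σ(X_t) ξ_t`, `t ≥ 1`: the couples `(X_t, ξ_t)`
are iid and independent of the holdout sample, and the noise is independent of the covariate. -/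
structure IsIIDRegression (P : Measure Ω) {n : ℕ} (D₀ : Fin n → Ω → 𝒳 × ℝ) (X : ℕ → Ω → 𝒳)
    (ξ Y : ℕ → Ω → ℝ) (μ σ : 𝒳 → ℝ) : Prop where
  measurable_holdout : ∀ i, Measurable (D₀ i)
  measurable_X : ∀ t, 1 ≤ t → Measurable (X t)
  measurable_noise : ∀ t, 1 ≤ t → Measurable (ξ t)
  measurable_mean : Measurable μ
  measurable_scale : Measurable σ
  scale_pos : ∀ x, 0 < σ x
  model : ∀ t, 1 ≤ t → ∀ ω, Y t ω = μ (X t ω) + σ (X t ω) * ξ t ω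
  indep : iIndepFun (fun (t : ℕ) ω => (X (t + 1) ω, ξ (t + 1) ω)) P
  identDistrib : ∀ t : ℕ,
    IdentDistrib (fun ω => (X (t + 1) ω, ξ (t + 1) ω)) (fun ω => (X 1 ω, ξ 1 ω)) P P
  indep_holdout :
    IndepFun (fun ω i => D₀ i ω) (fun ω (t : ℕ) => (X (t + 1) ω, ξ (t + 1) ω)) P
  indep_noise : IndepFun (X 1) (ξ 1) P

/-- Assumptions on the noise distribution, with Lebesgue density `f`, and on the scale `σ`. -/
structure IsRegularNoise (P : Measure Ω) (ξ₁ : Ω → ℝ) (f : ℝ → ℝ) (σ : 𝒳 → ℝ) : Prop where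
  density_nonneg : ∀ x, 0 ≤ f x
  density : P.map ξ₁ = volume.withDensity (fun x => ENNReal.ofReal (f x))
  symmetric : ∀ x, f (-x) = f x
  continuous : Continuous f
  /-- the density is positive on an interval and zero outside it -/
  support_interval : {x | 0 < f x}.OrdConnected
  bounded : BddAbove (Set.range f)
  bounded_mul : BddAbove (Set.range fun x => |x| * f x)
  bounded_inv_scale : BddAbove (Set.range fun x => 1 / σ x)
  second_moment : ∫ ω, ξ₁ ω ^ 2 ∂P = 1

/-- For `t` large enough,
`P(E[|μ̂_t(X_t) - μ(X_t)| + |σ̂_t(X_t) - σ(X_t)| | ℱ_{t-1}] ≥ C₁ (log t)^ν₀ t^(-ν)) ≤ 3 / (π² t³)`;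
the conditional expectation is the `[0, ∞]`-valued one. -/
def RateInProbability (P : Measure Ω) (ℱ : ℕ → MeasurableSpace Ω) (X : ℕ → Ω → 𝒳) (μ σ : 𝒳 → ℝ)
    (μhat σhat : ℕ → Ω → 𝒳 → ℝ) (ν₀ ν : ℝ) : Prop :=
  ∃ C₁ : ℝ, 0 < C₁ ∧ ∀ᶠ t : ℕ in atTop,
    P {ω | ENNReal.ofReal (C₁ * Real.log t ^ ν₀ * (t : ℝ) ^ (-ν)) ≤
        condLExp (ℱ (t - 1)) P (fun ω' => ENNReal.ofReal
          (|μhat t ω' (X t ω') - μ (X t ω')| + |σhat t ω' (X t ω') - σ (X t ω')|)) ω}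
      ≤ ENNReal.ofReal (3 / (Real.pi ^ 2 * (t : ℝ) ^ 3))

/-- For `t` large enough,
`E[(μ̂_t(X_t) - μ(X_t))²] + E[(σ̂_t(X_t) - σ(X_t))²] ≤ C₁ (log t)^(2 τ₀) t^(-2 τ)`. -/
def RateInMean (P : Measure Ω) (X : ℕ → Ω → 𝒳) (μ σ : 𝒳 → ℝ)
    (μhat σhat : ℕ → Ω → 𝒳 → ℝ) (τ₀ τ : ℝ) : Prop :=
  ∃ C₁ : ℝ, 0 < C₁ ∧ ∀ᶠ t : ℕ in atTop,
    ∫⁻ ω, ENNReal.ofReal ((μhat t ω (X t ω) - μ (X t ω)) ^ 2) ∂P +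
        ∫⁻ ω, ENNReal.ofReal ((σhat t ω (X t ω) - σ (X t ω)) ^ 2) ∂P
      ≤ ENNReal.ofReal (C₁ * Real.log t ^ (2 * τ₀) * (t : ℝ) ^ (-(2 * τ)))

end Setting

/-! ### Target threshold and rate -/

/-- `q⁰_α = 1 - 2 Φ̄(F̄⁻¹(α / 2))`, where `F̄` is the upper tail of the noise distribution. -/
def targetThreshold (noise : Measure ℝ) (α : ℝ) : ℝ :=
  1 - 2 * upperTail stdNormal (upperTailInv noise (α / 2))

/-- The rate `ρ(t)`, for `1 / 2 < β < 1`. -/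
def rho (β : ℝ) (t : ℕ) : ℝ :=
  if β < 3 / 4 then Real.log t ^ (1 / 2 : ℝ) * (t : ℝ) ^ (-β / 3)
  else Real.log t ^ (1 / 2 : ℝ) * (t : ℝ) ^ (1 / 2 - β) + (t : ℝ) ^ (β - 1)

end

end OnlineSCI

namespace OnlineSCI

/-! ### Distributions with a bounded density -/

section Density

variable {ν : Measure ℝ} {f : ℝ → ℝ}

/-! Let `G` be `idealError`, the error probability at threshold `q` when mean and scale are known.
It does not depend on the covariate, decreases from 1 to 0, and takes the value `α` at the target
`q⁰`. Given the past, the mean increment of the threshold, before the step size, is `d = r (G(q) - α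
+ b)`. Here `r` is the selection probability and `b` is a bias caused only by the estimation of mean
and scale. Moreover the instantaneous error rate minus `α` equals `d / r` almost surely. The
threshold therefore follows a noisy, biased Robbins–Monro recursion for the root of `G = α`, and one
bound on `D = q - q⁰` and on `b` controls both quantities in the theorem.

Three facts put the recursion in this form. On a bounded range, `G(q) - α = -h (q - q⁰)` with `h`
between two positive constants (`exists_slope_idealError`): near the target the two densities are
comparable, and farther away monotonicity suffices. The bias is at most a constant times the
conditional mean estimation error (`abs_integral_covErr_sub_idealError_le`, `enorm_drift_sub_le`);
boundedness of `f` handles the shift and boundedness of `|x| f(x)` the change of scale. The number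
of selections concentrates around its mean, so the random step has exact order `t ^ (-β)` outside an
event of probability `O(t ^ (-3))`. These are assembled in `exists_isRobbinsMonro`.

For the rate in probability, the recursion is observed on the window from `k / 2` to `k`. It is
compared pathwise with a linear recursion that has deterministic contraction factors and the same
martingale noise (`abs_sub_le_of_contraction`). The initial value is forgotten at speed `exp (-c k ^
(1 - β))`, the bias enters through its supremum on the window, and the linear noise is sub-Gaussian
with variance proxy of order `k ^ (-β)` (`hasSubgaussianMGF_linearNoise`). A union bound over the
window gives `√(log t) t ^ (-β / 2)` plus the estimation rate; the first term is at most `ρ(t)`.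

For the rate in mean, expanding `D (k + 1) ^ 2` gives a contracting scalar recursion for its
expectation (`integral_sq_succ_le`), forced by `u E|b|`, `u ^ 2` and the probability of a large
step, with `u = (k + 1) ^ (-β)`. Its solution is of order `(log t) ^ τ₀ t ^ (-τ)`, which is below
the stated rate because `β < 1`. -/

theorem real_Ioc_le_of_density_le (hν : ν = volume.withDensity fun x => ENNReal.ofReal (f x))
    {a b M : ℝ} (hab : a ≤ b) (hM : 0 ≤ M) (h : ∀ x ∈ Set.Ioc a b, f x ≤ M) :
    ν.real (Set.Ioc a b) ≤ M * (b - a) := by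
  have h1 : ν (Set.Ioc a b) ≤ ENNReal.ofReal (M * (b - a)) := by
    rw [hν, withDensity_apply _ measurableSet_Ioc]
    calc ∫⁻ x in Set.Ioc a b, ENNReal.ofReal (f x)
        ≤ ∫⁻ _ in Set.Ioc a b, ENNReal.ofReal M :=
          setLIntegral_mono measurable_const fun x hx => ENNReal.ofReal_le_ofReal (h x hx)
      _ = ENNReal.ofReal (M * (b - a)) := by
          rw [setLIntegral_const, Real.volume_Ioc, ENNReal.ofReal_mul hM]
  exact ENNReal.toReal_le_of_le_ofReal (mul_nonneg hM (sub_nonneg.2 hab)) h1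

theorem le_real_Ioc_of_le_density [IsFiniteMeasure ν] (hf : Measurable f)
    (hν : ν = volume.withDensity fun x => ENNReal.ofReal (f x))
    {a b M : ℝ} (hM : 0 ≤ M) (h : ∀ x ∈ Set.Ioc a b, M ≤ f x) :
    M * (b - a) ≤ ν.real (Set.Ioc a b) := by
  have h1 : ENNReal.ofReal (M * (b - a)) ≤ ν (Set.Ioc a b) := by
    conv_rhs => rw [hν, withDensity_apply _ measurableSet_Ioc]
    calc ENNReal.ofReal (M * (b - a)) = ∫⁻ _ in Set.Ioc a b, ENNReal.ofReal M := by
          rw [setLIntegral_const, Real.volume_Ioc, ENNReal.ofReal_mul hM]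
      _ ≤ ∫⁻ x in Set.Ioc a b, ENNReal.ofReal (f x) :=
          setLIntegral_mono (by fun_prop) fun x hx => ENNReal.ofReal_le_ofReal (h x hx)
  exact (ENNReal.ofReal_le_iff_le_toReal (measure_ne_top _ _)).1 h1

theorem cdf_sub_cdf [IsProbabilityMeasure ν] {a b : ℝ} (hab : a ≤ b) :
    cdf ν b - cdf ν a = ν.real (Set.Ioc a b) := by
  rw [cdf_eq_real, cdf_eq_real, ← Set.Iic_union_Ioc_eq_Iic hab,
    measureReal_union (Set.Iic_disjoint_Ioc le_rfl) measurableSet_Ioc]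
  ring

theorem upperTail_eq_one_sub_cdf [IsProbabilityMeasure ν] (x : ℝ) :
    upperTail ν x = 1 - cdf ν x := by
  rw [cdf_eq_real, upperTail, ← Set.compl_Iic, probReal_compl_eq_one_sub measurableSet_Iic]

theorem abs_cdf_sub_cdf_le [IsProbabilityMeasure ν]
    (hν : ν = volume.withDensity fun x => ENNReal.ofReal (f x))
    {M : ℝ} (hM : 0 ≤ M) (h : ∀ x, f x ≤ M) (a b : ℝ) :
    |cdf ν a - cdf ν b| ≤ M * |a - b| := by
  wlog hab : a ≤ b generalizing a b
  · rw [abs_sub_comm, abs_sub_comm a]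
    exact this b a (le_of_not_ge hab)
  · rw [abs_sub_comm, abs_sub_comm a, cdf_sub_cdf hab, abs_of_nonneg measureReal_nonneg,
      abs_of_nonneg (sub_nonneg.2 hab)]
    exact real_Ioc_le_of_density_le hν hab hM fun x _ => h x

theorem continuous_cdf_of_density_le [IsProbabilityMeasure ν]
    (hν : ν = volume.withDensity fun x => ENNReal.ofReal (f x))
    {M : ℝ} (hM : 0 ≤ M) (h : ∀ x, f x ≤ M) : Continuous (cdf ν) := by
  refine (LipschitzWith.of_dist_le_mul (K := M.toNNReal) fun a b => ?_).continuous
  rw [Real.dist_eq, Real.dist_eq, Real.coe_toNNReal _ hM]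
  exact abs_cdf_sub_cdf_le hν hM h a b

/-- Reflection preserves Lebesgue measure, and the absence of atoms makes open and closed half-lines
equally likely. -/
theorem cdf_neg_of_symmetric [IsProbabilityMeasure ν]
    (hν : ν = volume.withDensity fun x => ENNReal.ofReal (f x)) (hsymm : ∀ x, f (-x) = f x)
    (x : ℝ) : cdf ν (-x) = 1 - cdf ν x := by
  have hat : ν {x} = 0 := by rw [hν]; exact (withDensity_absolutelyContinuous _ _) (by simp)
  have h1 : ν (Set.Iic (-x)) = ν (Set.Ici x) := by
    have h := (Measure.measurePreserving_neg (volume : Measure ℝ)).setLIntegral_comp_preimage_emb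
      (MeasurableEquiv.neg ℝ).measurableEmbedding (fun y => ENNReal.ofReal (f y)) (Set.Iic (-x))
    rw [hν, withDensity_apply _ measurableSet_Iic, withDensity_apply _ measurableSet_Ici, ← h]
    have h2 : (Neg.neg ⁻¹' Set.Iic (-x) : Set ℝ) = Set.Ici x := by ext y; simp
    rw [h2]
    simp [hsymm]
  have h2 : ν (Set.Ici x) = ν (Set.Ioi x) := by
    rw [← Set.Ioi_union_left]
    refine le_antisymm ((measure_union_le _ _).trans (by simp [hat])) (measure_mono (by simp))
  rw [← upperTail_eq_one_sub_cdf, cdf_eq_real, upperTail, measureReal_def, h1, h2, measureReal_def]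

end Density

/-! ### The standard normal quantile function -/

instance : IsProbabilityMeasure stdNormal := by unfold stdNormal; infer_instance

theorem stdNormal_eq_withDensity :
    stdNormal = volume.withDensity fun x => ENNReal.ofReal (gaussianPDFReal 0 1 x) := by
  rw [stdNormal, gaussianReal_of_var_ne_zero _ one_ne_zero]
  rfl

theorem gaussianPDFReal_le_one (x : ℝ) : gaussianPDFReal 0 1 x ≤ 1 := by
  rw [gaussianPDFReal]
  have h1 : 1 ≤ √(2 * Real.pi * (1 : NNReal)) := by
    rw [Real.one_le_sqrt]
    have := Real.pi_gt_three
    simp only [NNReal.coe_one]; linarith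
  have h2 : Real.exp (-(x - 0) ^ 2 / (2 * (1 : NNReal))) ≤ 1 := by
    rw [Real.exp_le_one_iff, neg_div]
    exact neg_nonpos.2 (by positivity)
  exact mul_le_one₀ (inv_le_one_of_one_le₀ h1) (Real.exp_nonneg _) h2

theorem continuous_gaussianPDFReal : Continuous (gaussianPDFReal 0 1) := by
  unfold gaussianPDFReal; fun_prop

theorem continuous_cdf_stdNormal : Continuous (cdf stdNormal) :=
  continuous_cdf_of_density_le stdNormal_eq_withDensity zero_le_one gaussianPDFReal_le_one

theorem strictMono_cdf_stdNormal : StrictMono (cdf stdNormal) := by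
  intro a b hab
  obtain ⟨y, _, hy⟩ := isCompact_Icc.exists_isMinOn (Set.nonempty_Icc.2 hab.le)
    continuous_gaussianPDFReal.continuousOn
  have h := le_real_Ioc_of_le_density (measurable_gaussianPDFReal 0 1) stdNormal_eq_withDensity
    (gaussianPDFReal_nonneg 0 1 y) (fun x hx => hy (Set.Ioc_subset_Icc_self hx))
  rw [← cdf_sub_cdf hab.le] at h
  have := mul_pos (gaussianPDFReal_pos 0 1 y one_ne_zero) (sub_pos.2 hab)
  linarith

theorem cdf_stdNormal_neg (x : ℝ) : cdf stdNormal (-x) = 1 - cdf stdNormal x :=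
  cdf_neg_of_symmetric stdNormal_eq_withDensity (fun x => by simp [gaussianPDFReal]) x

/-- Continuity of the normal cdf closes the superlevel set, so its infimum is attained. This Galois
connection yields positivity, monotonicity and measurability of the quantile without inverting the
cdf explicitly. -/
theorem normalQuantile_le_iff {p : ℝ} (hp : p ∈ Set.Ioo (0 : ℝ) 1) (x : ℝ) :
    normalQuantile p ≤ x ↔ p ≤ cdf stdNormal x := by
  have hne : {x : ℝ | p ≤ cdf stdNormal x}.Nonempty :=
    ((tendsto_cdf_atTop stdNormal).eventually_const_le hp.2).exists
  have hbdd : BddBelow {x : ℝ | p ≤ cdf stdNormal x} := by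
    obtain ⟨y, hy⟩ := ((tendsto_cdf_atBot stdNormal).eventually_lt_const hp.1).exists
    refine ⟨y, fun x hx => ?_⟩
    by_contra hlt
    exact absurd (hx.trans (monotone_cdf _ (le_of_not_ge hlt))) (not_le.2 hy)
  have hcl : IsClosed {x : ℝ | p ≤ cdf stdNormal x} :=
    isClosed_le continuous_const continuous_cdf_stdNormal
  exact ⟨fun h => (hcl.csInf_mem hne hbdd).trans (monotone_cdf _ h), fun h => csInf_le hbdd h⟩

theorem cdf_normalQuantile {p : ℝ} (hp : p ∈ Set.Ioo (0 : ℝ) 1) :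
    cdf stdNormal (normalQuantile p) = p := by
  refine le_antisymm ?_ ((normalQuantile_le_iff hp _).1 le_rfl)
  refine le_of_forall_lt_imp_le_of_dense fun a ha => ?_
  by_contra! hcon
  obtain ⟨y, hy, hyw⟩ : ∃ y, a < cdf stdNormal y ∧ y < normalQuantile p := by
    have h1 : ∀ᶠ y in nhds (normalQuantile p), a < cdf stdNormal y :=
      continuous_cdf_stdNormal.continuousAt.eventually_const_lt ha
    have h2 := (h1.filter_mono (nhdsWithin_le_nhds (s := Set.Iio (normalQuantile p)))).and
      self_mem_nhdsWithin
    exact h2.exists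
  exact absurd ((normalQuantile_le_iff hp y).2 (hcon.le.trans hy.le)) (not_le.2 hyw)

theorem half_mem_Ioo {q : ℝ} (h0 : 0 < q) (h1 : q < 1) : (q + 1) / 2 ∈ Set.Ioo (0 : ℝ) 1 :=
  ⟨by linarith, by linarith⟩

theorem normalQuantile_pos {q : ℝ} (h0 : 0 < q) (h1 : q < 1) : 0 < normalQuantile ((q + 1) / 2) := by
  by_contra! h
  rw [normalQuantile_le_iff (half_mem_Ioo h0 h1)] at h
  have := cdf_stdNormal_neg 0
  rw [neg_zero] at this
  linarith

theorem normalQuantile_mono {q q' : ℝ} (h0 : 0 < q) (hq : q ≤ q') (h1 : q' < 1) :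
    normalQuantile ((q + 1) / 2) ≤ normalQuantile ((q' + 1) / 2) := by
  rw [normalQuantile_le_iff (half_mem_Ioo h0 (hq.trans_lt h1)),
    cdf_normalQuantile (half_mem_Ioo (h0.trans_le hq) h1)]
  linarith

/-- The quantile appearing in the prediction interval, extended by `0` outside `(0, 1)`. -/
noncomputable def halfWidth (q : ℝ) : ℝ := if 0 < q ∧ q < 1 then normalQuantile ((q + 1) / 2) else 0

theorem measurable_halfWidth : Measurable halfWidth := by
  refine measurable_of_Iic fun x => ?_
  have : halfWidth ⁻¹' Set.Iic x = (Set.Ioo 0 1 ∩ {q | (q + 1) / 2 ≤ cdf stdNormal x}) ∪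
      ((Set.Ioo 0 1)ᶜ ∩ {_q | 0 ≤ x}) := by
    ext q
    simp only [halfWidth, Set.mem_preimage, Set.mem_Iic, Set.mem_union, Set.mem_inter_iff,
      Set.mem_Ioo, Set.mem_ofPred_eq, Set.mem_compl_iff]
    split_ifs with h
    · simp [h, normalQuantile_le_iff (half_mem_Ioo h.1 h.2)]
    · simp [h]
  rw [this]
  refine (measurableSet_Ioo.inter (measurableSet_le (by fun_prop) measurable_const)).union
    (measurableSet_Ioo.compl.inter (MeasurableSet.const _))

/-! ### The error function of the ideal predictor -/

/-- Error probability of the prediction set at threshold `q` when mean and scale are known. -/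
noncomputable def idealError (ν : Measure ℝ) (q : ℝ) : ℝ :=
  if q ≤ 0 then 1 else if 1 ≤ q then 0 else 2 * upperTail ν (normalQuantile ((q + 1) / 2))

section Noise

variable {ν : Measure ℝ} [IsProbabilityMeasure ν] {f : ℝ → ℝ}

theorem cdf_zero_of_symmetric (hν : ν = volume.withDensity fun x => ENNReal.ofReal (f x))
    (hsymm : ∀ x, f (-x) = f x) : cdf ν 0 = 1 / 2 := by
  have := cdf_neg_of_symmetric hν hsymm 0
  rw [neg_zero] at this
  linarith

theorem idealError_mem_Icc (hν : ν = volume.withDensity fun x => ENNReal.ofReal (f x))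
    (hsymm : ∀ x, f (-x) = f x) (q : ℝ) : idealError ν q ∈ Set.Icc (0 : ℝ) 1 := by
  unfold idealError
  split_ifs with h0 h1
  · simp
  · simp
  · rw [upperTail_eq_one_sub_cdf]
    push Not at h0 h1
    have h2 := monotone_cdf ν (normalQuantile_pos h0 h1).le
    rw [cdf_zero_of_symmetric hν hsymm] at h2
    have := cdf_le_one ν (normalQuantile ((q + 1) / 2))
    constructor <;> linarith

theorem antitone_idealError (hν : ν = volume.withDensity fun x => ENNReal.ofReal (f x))
    (hsymm : ∀ x, f (-x) = f x) : Antitone (idealError ν) := by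
  intro q q' hqq
  have hb := idealError_mem_Icc hν hsymm q
  have hb' := idealError_mem_Icc hν hsymm q'
  by_cases h0 : q ≤ 0
  · have : idealError ν q = 1 := by simp [idealError, h0]
    rw [this]; exact hb'.2
  by_cases h1 : 1 ≤ q'
  · have : idealError ν q' = 0 := by
      simp [idealError, h1, not_le.2 (zero_lt_one.trans_le h1)]
    rw [this]; exact hb.1
  push Not at h0 h1
  have e : idealError ν q = 2 * (1 - cdf ν (normalQuantile ((q + 1) / 2))) := by
    rw [idealError, if_neg (not_le.2 h0), if_neg (by linarith), upperTail_eq_one_sub_cdf]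
  have e' : idealError ν q' = 2 * (1 - cdf ν (normalQuantile ((q' + 1) / 2))) := by
    rw [idealError, if_neg (by linarith), if_neg (not_le.2 h1), upperTail_eq_one_sub_cdf]
  rw [e, e']
  have := monotone_cdf ν (normalQuantile_mono h0 hqq h1)
  linarith

theorem upperTail_upperTailInv {M : ℝ} (hM : 0 ≤ M)
    (hν : ν = volume.withDensity fun x => ENNReal.ofReal (f x)) (hb : ∀ x, f x ≤ M)
    {u : ℝ} (hu : u ∈ Set.Ioo (0 : ℝ) 1) : upperTail ν (upperTailInv ν u) = u := by
  have hcont : Continuous (upperTail ν) := by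
    have : upperTail ν = fun x => 1 - cdf ν x := funext upperTail_eq_one_sub_cdf
    rw [this]
    exact continuous_const.sub (continuous_cdf_of_density_le hν hM hb)
  have hanti : Antitone (upperTail ν) := fun a b hab => by
    rw [upperTail_eq_one_sub_cdf, upperTail_eq_one_sub_cdf]
    have := monotone_cdf ν hab
    linarith
  have hne : {x : ℝ | upperTail ν x ≤ u}.Nonempty := by
    obtain ⟨y, hy⟩ := ((tendsto_cdf_atTop ν).eventually_const_le
      (by linarith [hu.1] : 1 - u < 1)).exists
    refine ⟨y, ?_⟩
    rw [Set.mem_ofPred_eq, upperTail_eq_one_sub_cdf]; linarith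
  have hbdd : BddBelow {x : ℝ | upperTail ν x ≤ u} := by
    obtain ⟨y, hy⟩ := ((tendsto_cdf_atBot ν).eventually_lt_const
      (by linarith [hu.2] : 0 < 1 - u)).exists
    refine ⟨y, fun x hx => ?_⟩
    by_contra! hlt
    have h1 := hanti hlt.le
    rw [Set.mem_ofPred_eq] at hx
    rw [upperTail_eq_one_sub_cdf y] at h1
    linarith
  have hcl : IsClosed {x : ℝ | upperTail ν x ≤ u} := isClosed_le hcont continuous_const
  refine le_antisymm (hcl.csInf_mem hne hbdd) ?_
  by_contra! hlt
  have h1 : ∀ᶠ y in nhds (upperTailInv ν u), upperTail ν y < u :=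
    hcont.continuousAt.eventually_lt_const hlt
  obtain ⟨y, hy, hyw⟩ := ((h1.filter_mono
    (nhdsWithin_le_nhds (s := Set.Iio (upperTailInv ν u)))).and self_mem_nhdsWithin).exists
  exact absurd (csInf_le hbdd hy.le) (not_le.2 hyw)

theorem upperTailInv_pos {M : ℝ} (hM : 0 ≤ M)
    (hν : ν = volume.withDensity fun x => ENNReal.ofReal (f x)) (hb : ∀ x, f x ≤ M)
    (hsymm : ∀ x, f (-x) = f x) {u : ℝ} (hu : u ∈ Set.Ioo (0 : ℝ) (1 / 2)) :
    0 < upperTailInv ν u := by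
  by_contra! h
  have h1 := upperTail_upperTailInv hM hν hb ⟨hu.1, by linarith [hu.2]⟩
  have h2 := monotone_cdf ν h
  rw [upperTail_eq_one_sub_cdf] at h1
  rw [cdf_zero_of_symmetric hν hsymm] at h2
  linarith [hu.2]

/-- If `f` vanished at the positive quantile `z`, it would vanish at every `y > z`: otherwise `f` is
positive at `y` and, by symmetry, at `-y`, hence at `z` in between. The tail beyond `z` would then
be zero instead of `u`. -/
theorem density_upperTailInv_pos {M : ℝ} (hM : 0 ≤ M)
    (hν : ν = volume.withDensity fun x => ENNReal.ofReal (f x)) (hb : ∀ x, f x ≤ M)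
    (hsymm : ∀ x, f (-x) = f x) (hord : {x | 0 < f x}.OrdConnected)
    {u : ℝ} (hu : u ∈ Set.Ioo (0 : ℝ) (1 / 2)) : 0 < f (upperTailInv ν u) := by
  have hz := upperTailInv_pos hM hν hb hsymm hu
  have h1 := upperTail_upperTailInv hM hν hb ⟨hu.1, by linarith [hu.2]⟩
  set z := upperTailInv ν u
  by_contra hcon
  have h0 : ∀ y ∈ Set.Ioi z, f y ≤ 0 := by
    intro y hy
    by_contra! hfy
    have hfy' : 0 < f (-y) := by rwa [hsymm]
    rw [Set.mem_Ioi] at hy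
    exact hcon (hord.out hfy' hfy ⟨by linarith, hy.le⟩)
  have : upperTail ν z = 0 := by
    rw [upperTail, measureReal_def]
    conv_lhs => rw [hν]
    rw [withDensity_apply _ measurableSet_Ioi,
      setLIntegral_congr_fun measurableSet_Ioi (g := fun _ => 0)
        (fun y hy => ENNReal.ofReal_of_nonpos (h0 y hy))]
    simp
  linarith [hu.1]

/-- The substitution `q = 2 Φ(w) - 1` identifies `w > 0` with `0 < q < 1` and removes the normal
quantile, so increments of the error function become increments of two cdfs. -/
theorem idealError_two_mul_cdf_sub_one {w : ℝ} (hw : 0 < w) :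
    idealError ν (2 * cdf stdNormal w - 1) = 2 * (1 - cdf ν w) := by
  have h2 : cdf stdNormal 0 = 1 / 2 := by
    have := cdf_stdNormal_neg 0
    rw [neg_zero] at this; linarith
  have h1 := strictMono_cdf_stdNormal hw
  have h3 : cdf stdNormal w < 1 :=
    (strictMono_cdf_stdNormal (lt_add_one w)).trans_le (cdf_le_one _ _)
  have e : (2 * cdf stdNormal w - 1 + 1) / 2 = cdf stdNormal w := by ring
  have h4 : cdf stdNormal w ∈ Set.Ioo (0 : ℝ) 1 := ⟨by linarith, h3⟩
  have h5 : normalQuantile (cdf stdNormal w) = w :=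
    strictMono_cdf_stdNormal.injective (cdf_normalQuantile h4)
  rw [idealError, if_neg (by linarith), if_neg (by linarith), e, h5, upperTail_eq_one_sub_cdf]

theorem exists_cdf_stdNormal_eq {q : ℝ} (h0 : 0 < q) (h1 : q < 1) :
    ∃ w, q = 2 * cdf stdNormal w - 1 :=
  ⟨normalQuantile ((q + 1) / 2), by rw [cdf_normalQuantile (half_mem_Ioo h0 h1)]; ring⟩

/-- Two-sided linear control of `idealError - α` around the target threshold. -/
theorem exists_slope_idealError {M : ℝ} (hM : 0 ≤ M)
    (hν : ν = volume.withDensity fun x => ENNReal.ofReal (f x)) (hb : ∀ x, f x ≤ M)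
    (hcont : Continuous f)
    (hsymm : ∀ x, f (-x) = f x) (hord : {x | 0 < f x}.OrdConnected)
    {α : ℝ} (hα : α ∈ Set.Ioo (0 : ℝ) 1) {B : ℝ} (hB : 0 < B) :
    ∃ κ K : ℝ, 0 < κ ∧ κ ≤ K ∧ ∀ q, |q - targetThreshold ν α| ≤ B →
      ∃ h ∈ Set.Icc κ K, idealError ν q - α = -h * (q - targetThreshold ν α) := by
  have hu : α / 2 ∈ Set.Ioo (0 : ℝ) (1 / 2) := ⟨by linarith [hα.1], by linarith [hα.2]⟩
  have hz := upperTailInv_pos hM hν hb hsymm hu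
  have hfz := density_upperTailInv_pos hM hν hb hsymm hord hu
  have hFz := upperTail_upperTailInv hM hν hb (u := α / 2) ⟨hu.1, by linarith [hu.2]⟩
  rw [targetThreshold]
  set z := upperTailInv ν (α / 2)
  rw [upperTail_eq_one_sub_cdf] at hFz
  have hq0 : 1 - 2 * upperTail stdNormal z = 2 * cdf stdNormal z - 1 := by
    rw [upperTail_eq_one_sub_cdf]; ring
  rw [hq0]
  set q0 := 2 * cdf stdNormal z - 1 with hq0def
  have hGq0 : idealError ν q0 = α := by
    rw [idealError_two_mul_cdf_sub_one hz]; linarith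
  -- a neighbourhood of `z` on which the densities are comparable to constants
  obtain ⟨η, hη, hηz, hηf⟩ : ∃ η > 0, η < z ∧ ∀ x, |x - z| ≤ η → f z / 2 ≤ f x := by
    have h1 : ∀ᶠ x in nhds z, f z / 2 < f x :=
      hcont.continuousAt.eventually_const_lt (by linarith)
    obtain ⟨ε, hε, h⟩ := Metric.eventually_nhds_iff.1 h1
    refine ⟨min (ε / 2) (z / 2), by positivity, (min_le_right _ _).trans_lt (by linarith),
      fun x hx => (h ?_).le⟩
    rw [Real.dist_eq]
    exact (hx.trans (min_le_left _ _)).trans_lt (by linarith)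
  obtain ⟨p, hp, hpx⟩ : ∃ p > 0, ∀ x, |x - z| ≤ η → p ≤ gaussianPDFReal 0 1 x := by
    obtain ⟨y, _, hy⟩ := (isCompact_closedBall z η).exists_isMinOn
      ⟨z, Metric.mem_closedBall_self hη.le⟩ continuous_gaussianPDFReal.continuousOn
    exact ⟨_, gaussianPDFReal_pos 0 1 y one_ne_zero, fun x hx => hy (by
      rwa [Metric.mem_closedBall, Real.dist_eq])⟩
  -- Near `z` the increments of the two cdfs are comparable: the noise density is at least `f z / 2`
  -- and the Gaussian one at most 1; conversely the noise density is at most `M` and the Gaussian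
  -- one at least `p`. Using `M + 1` makes the upper constant visibly positive.
  have hloc : ∀ a b, |a - z| ≤ η → |b - z| ≤ η → a ≤ b →
      f z / 2 * (cdf stdNormal b - cdf stdNormal a) ≤ cdf ν b - cdf ν a ∧
      cdf ν b - cdf ν a ≤ (M + 1) / p * (cdf stdNormal b - cdf stdNormal a) := by
    intro a b ha hb' hab
    have hin : ∀ x ∈ Set.Ioc a b, |x - z| ≤ η := by
      intro x hx
      rw [abs_le] at ha hb' ⊢
      exact ⟨by linarith [hx.1, ha.1], by linarith [hx.2, hb'.2]⟩
    rw [cdf_sub_cdf hab, cdf_sub_cdf hab]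
    have g1 := real_Ioc_le_of_density_le stdNormal_eq_withDensity hab zero_le_one
      (fun x _ => gaussianPDFReal_le_one x)
    have g2 := le_real_Ioc_of_le_density (measurable_gaussianPDFReal 0 1)
      stdNormal_eq_withDensity hp.le (fun x hx => hpx x (hin x hx))
    have g3 := le_real_Ioc_of_le_density hcont.measurable hν (half_pos hfz).le
      (fun x hx => hηf x (hin x hx))
    have g4 := real_Ioc_le_of_density_le hν hab hM (fun x _ => hb x)
    constructor
    · refine le_trans ?_ g3
      gcongr
      linarith
    · refine g4.trans ?_
      rw [div_mul_eq_mul_div, le_div_iff₀ hp]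
      nlinarith [mul_nonneg hM (sub_nonneg.2 hab), sub_nonneg.2 hab]
  set κ₁ := f z / 2 with hκ₁
  set K₁ := (M + 1) / p with hK₁
  have hκ₁pos : 0 < κ₁ := half_pos hfz
  have hK₁pos : 0 < K₁ := by positivity
  have habs_add : |z + η - z| ≤ η := by rw [add_sub_cancel_left, abs_of_pos hη]
  have habs_sub : |z - η - z| ≤ η := by
    rw [show z - η - z = -η by ring, abs_neg, abs_of_pos hη]
  have habs0 : |z - z| ≤ η := by simpa using hη.le
  set qr := 2 * cdf stdNormal (z + η) - 1 with hqr
  set ql := 2 * cdf stdNormal (z - η) - 1 with hql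
  have hqr0 : q0 < qr := by
    have := strictMono_cdf_stdNormal (lt_add_of_pos_right z hη); linarith
  have hql0 : ql < q0 := by
    have := strictMono_cdf_stdNormal (sub_lt_self z hη); linarith
  have hGr : κ₁ * (qr - q0) ≤ α - idealError ν qr := by
    rw [← hGq0, idealError_two_mul_cdf_sub_one hz, idealError_two_mul_cdf_sub_one (by linarith)]
    have := (hloc z (z + η) habs0 habs_add (by linarith)).1
    linarith
  have hGl : κ₁ * (q0 - ql) ≤ idealError ν ql - α := by
    rw [← hGq0, idealError_two_mul_cdf_sub_one hz, idealError_two_mul_cdf_sub_one (by linarith)]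
    have := (hloc (z - η) z habs_sub habs0 (by linarith)).1
    linarith
  set dl := min (qr - q0) (q0 - ql) with hdl
  have hdlpos : 0 < dl := lt_min (by linarith) (by linarith)
  have hanti := antitone_idealError hν hsymm
  -- Inside `[ql, qr]` the slope lies between `κ₁` and `K₁`. Outside, monotonicity keeps the gap to
  -- `α` at least `κ₁ * dl` over a distance at most `B`, while this gap is at most 1 over a distance
  -- at least `dl`.
  refine ⟨min κ₁ (κ₁ * dl / B), max (max K₁ (1 / dl)) κ₁, by positivity,
    (min_le_left _ _).trans (le_max_right _ _), fun q hq => ?_⟩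
  rcases eq_or_ne q q0 with rfl | hne
  · exact ⟨κ₁, ⟨min_le_left _ _, le_max_right _ _⟩, by rw [hGq0]; ring⟩
  have hD : q - q0 ≠ 0 := sub_ne_zero.2 hne
  refine ⟨(α - idealError ν q) / (q - q0), ?_, by field_simp; ring⟩
  have hmem := idealError_mem_Icc hν hsymm q
  rcases lt_or_gt_of_ne hne with hlt | hgt
  · have hDpos : 0 < q0 - q := by linarith
    rw [abs_of_neg (by linarith)] at hq
    rw [← neg_div_neg_eq (α - idealError ν q), neg_sub, neg_sub]
    by_cases hcase : ql ≤ q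
    -- The choice `η < z` keeps the left end of the local window inside `(0, 1)`, where the
    -- substitution is valid.
    · have hql1 : 0 < ql := by
        have h1 := strictMono_cdf_stdNormal (sub_pos.2 hηz)
        have := cdf_stdNormal_neg 0
        rw [neg_zero] at this; linarith
      have hq01 : q0 ≤ 1 := by have := cdf_le_one stdNormal z; linarith
      obtain ⟨w, hw⟩ := exists_cdf_stdNormal_eq (hql1.trans_le hcase) (hlt.trans_le hq01)
      have hw1 : z - η ≤ w := by
        rw [← strictMono_cdf_stdNormal.le_iff_le]; linarith
      have hw2 : w < z := by
        rw [← strictMono_cdf_stdNormal.lt_iff_lt]; linarith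
      have hwz : |w - z| ≤ η := abs_le.2 ⟨by linarith, by linarith⟩
      have hl := hloc w z hwz habs0 hw2.le
      have e : idealError ν q - α = 2 * (cdf ν z - cdf ν w) := by
        rw [hw, idealError_two_mul_cdf_sub_one (by linarith)]; linarith
      have e2 : q0 - q = 2 * (cdf stdNormal z - cdf stdNormal w) := by rw [hw]; ring
      constructor
      · refine (min_le_left _ _).trans ?_
        rw [le_div_iff₀ hDpos, e, e2]; linarith [hl.1]
      · refine le_trans ?_ ((le_max_left _ _).trans (le_max_left _ _))
        rw [div_le_iff₀ hDpos, e, e2]; linarith [hl.2]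
    · push Not at hcase
      have h1 := hanti hcase.le
      constructor
      · refine (min_le_right _ _).trans ?_
        rw [div_le_div_iff₀ hB hDpos]
        have h2 : κ₁ * dl ≤ idealError ν q - α := by
          have := mul_le_mul_of_nonneg_left (min_le_right (qr - q0) (q0 - ql)) hκ₁pos.le
          linarith
        exact mul_le_mul h2 (by linarith) hDpos.le (by nlinarith)
      · refine le_trans ?_ ((le_max_right _ _).trans (le_max_left _ _))
        have : dl ≤ q0 - q := (min_le_right _ _).trans (by linarith)
        exact div_le_div₀ zero_le_one (by linarith [hmem.2, hα.1]) hdlpos this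
  · have hDpos : 0 < q - q0 := by linarith
    rw [abs_of_pos (by linarith)] at hq
    by_cases hcase : q ≤ qr
    · have hq01 : 0 < q0 := by
        have h1 := strictMono_cdf_stdNormal hz
        have := cdf_stdNormal_neg 0
        rw [neg_zero] at this; linarith
      have hqr1 : qr < 1 := by
        have : cdf stdNormal (z + η) < 1 :=
          (strictMono_cdf_stdNormal (lt_add_one _)).trans_le (cdf_le_one _ _)
        linarith
      obtain ⟨w, hw⟩ := exists_cdf_stdNormal_eq (hq01.trans hgt) (hcase.trans_lt hqr1)
      have hw1 : w ≤ z + η := by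
        rw [← strictMono_cdf_stdNormal.le_iff_le]; linarith
      have hw2 : z < w := by
        rw [← strictMono_cdf_stdNormal.lt_iff_lt]; linarith
      have hwz : |w - z| ≤ η := abs_le.2 ⟨by linarith, by linarith⟩
      have hl := hloc z w habs0 hwz hw2.le
      have e : α - idealError ν q = 2 * (cdf ν w - cdf ν z) := by
        rw [hw, idealError_two_mul_cdf_sub_one (by linarith)]; linarith
      have e2 : q - q0 = 2 * (cdf stdNormal w - cdf stdNormal z) := by rw [hw]; ring
      constructor
      · refine (min_le_left _ _).trans ?_
        rw [le_div_iff₀ hDpos, e, e2]; linarith [hl.1]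
      · refine le_trans ?_ ((le_max_left _ _).trans (le_max_left _ _))
        rw [div_le_iff₀ hDpos, e, e2]; linarith [hl.2]
    · push Not at hcase
      have h1 := hanti hcase.le
      constructor
      · refine (min_le_right _ _).trans ?_
        rw [div_le_div_iff₀ hB hDpos]
        have h2 : κ₁ * dl ≤ α - idealError ν q := by
          have := mul_le_mul_of_nonneg_left (min_le_left (qr - q0) (q0 - ql)) hκ₁pos.le
          linarith
        exact mul_le_mul h2 (by linarith) hDpos.le (by nlinarith)
      · refine le_trans ?_ ((le_max_right _ _).trans (le_max_left _ _))
        have : dl ≤ q - q0 := (min_le_left _ _).trans (by linarith)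
        exact div_le_div₀ zero_le_one (by linarith [hmem.1, hα.2]) hdlpos this

/-! ### Effect of estimating the mean and the scale -/

/-- The constant must not depend on `w`, which is unbounded as the threshold approaches 1. The shift
costs the Lipschitz constant `M`. For `|ε| ≤ 1 / 2` the scaling moves inside `[w / 2, ∞)`, where the
density is at most `2 M' / w`, over a length `w |ε|`, so `w` cancels. For larger `ε` the trivial
bound 1 is below `2 |ε|`. -/
theorem abs_cdf_perturb_le {M M' : ℝ} (hM : 0 ≤ M) (hM' : 0 ≤ M')
    (hν : ν = volume.withDensity fun x => ENNReal.ofReal (f x)) (hb : ∀ x, f x ≤ M)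
    (hb' : ∀ x, |x| * f x ≤ M') {w : ℝ} (hw : 0 < w) (δ ε : ℝ) :
    |cdf ν (w + δ + w * ε) - cdf ν w| ≤ M * |δ| + (2 * M' + 2) * |ε| := by
  have h1 : |cdf ν (w + δ + w * ε) - cdf ν (w + w * ε)| ≤ M * |δ| := by
    have := abs_cdf_sub_cdf_le hν hM hb (w + δ + w * ε) (w + w * ε)
    rwa [show w + δ + w * ε - (w + w * ε) = δ by ring] at this
  have h2 : |cdf ν (w + w * ε) - cdf ν w| ≤ (2 * M' + 2) * |ε| := by
    by_cases hε : |ε| ≤ 1 / 2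
    · have hd : ∀ x, w / 2 ≤ x → f x ≤ M' / (w / 2) := fun x hx => by
        have hx0 : 0 < x := by linarith
        have := hb' x
        rw [abs_of_pos hx0] at this
        rw [le_div_iff₀ (by positivity)]
        by_cases hfx : 0 ≤ f x
        · nlinarith
        · nlinarith
      have hMw : 0 ≤ M' / (w / 2) := by positivity
      have hpos : w / 2 ≤ w + w * ε := by nlinarith [(abs_le.1 hε).1]
      have key : |cdf ν (w + w * ε) - cdf ν w| ≤ M' / (w / 2) * (w * |ε|) := by
        rcases le_total 0 ε with h | h
        · have hle : w ≤ w + w * ε := by nlinarith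
          rw [cdf_sub_cdf hle, abs_of_nonneg measureReal_nonneg, abs_of_nonneg h]
          have := real_Ioc_le_of_density_le hν hle hMw
            (fun x hx => hd x (by linarith [hx.1]))
          rwa [add_sub_cancel_left] at this
        · have hle : w + w * ε ≤ w := by nlinarith
          rw [abs_sub_comm, cdf_sub_cdf hle, abs_of_nonneg measureReal_nonneg, abs_of_nonpos h]
          have := real_Ioc_le_of_density_le hν hle hMw
            (fun x hx => hd x (by linarith [hx.1]))
          rwa [show w - (w + w * ε) = w * -ε by ring] at this
      have e : M' / (w / 2) * (w * |ε|) = 2 * M' * |ε| := by field_simp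
      rw [e] at key
      nlinarith [abs_nonneg ε]
    · push Not at hε
      have h3 : |cdf ν (w + w * ε) - cdf ν w| ≤ 1 := by
        rw [abs_le]
        constructor <;> linarith [cdf_nonneg ν w, cdf_le_one ν w, cdf_nonneg ν (w + w * ε),
          cdf_le_one ν (w + w * ε)]
      nlinarith [mul_nonneg hM' (abs_nonneg ε)]
  calc _ ≤ |cdf ν (w + δ + w * ε) - cdf ν (w + w * ε)| + |cdf ν (w + w * ε) - cdf ν w| :=
        abs_sub_le _ _ _
    _ ≤ _ := add_le_add h1 h2

/-- Rescaled to the noise, the estimated interval has ends `w + δ + w ε` and `-(w - δ + w ε)`, with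
relative errors `δ` and `ε`. By symmetry its error is a sum of two upper tails, each compared with
the tail at `w` by `abs_cdf_perturb_le`. Outside `(0, 1)` nothing depends on the estimates, up to a
null set. -/
theorem abs_integral_covErr_sub_idealError_le {M M' L : ℝ} (hM : 0 ≤ M) (hM' : 0 ≤ M')
    (hν : ν = volume.withDensity fun x => ENNReal.ofReal (f x)) (hb : ∀ x, f x ≤ M)
    (hb' : ∀ x, |x| * f x ≤ M') (hsymm : ∀ x, f (-x) = f x)
    (m₀ s₀ m s q : ℝ) (hs₀ : 0 < s₀) (hL : 1 / s₀ ≤ L) :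
    |∫ e, covErr (m₀ + s₀ * e) (predInterval m s q) ∂ν - idealError ν q| ≤
      L * (2 * M + 4 * M' + 4) * (|m - m₀| + |s - s₀|) := by
  have hLpos : 0 < L := lt_of_lt_of_le (by positivity) hL
  have hK : 0 ≤ L * (2 * M + 4 * M' + 4) * (|m - m₀| + |s - s₀|) := by positivity
  have hat : ∀ x, ν {x} = 0 := fun x => by
    rw [hν]; exact (withDensity_absolutelyContinuous _ _) (by simp)
  by_cases h0 : q ≤ 0
  · have hI : ∫ e, covErr (m₀ + s₀ * e) (predInterval m s q) ∂ν = 1 := by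
      have : (fun e => covErr (m₀ + s₀ * e) (predInterval m s q)) =ᵐ[ν] fun _ => 1 := by
        have h1 : ∀ᵐ e ∂ν, e ≠ (m - m₀) / s₀ := by
          rw [ae_iff]; simp [hat]
        filter_upwards [h1] with e he
        rw [covErr, predInterval, if_pos h0, if_neg]
        rw [Set.mem_singleton_iff]
        intro h
        apply he
        rw [eq_div_iff hs₀.ne']; linarith
      rw [integral_congr_ae this]; simp
    rw [hI, idealError, if_pos h0, sub_self, abs_zero]
    exact hK
  by_cases h1 : 1 ≤ q
  · have hI : ∀ e, covErr (m₀ + s₀ * e) (predInterval m s q) = 0 := fun e => by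
      simp [covErr, predInterval, h0, h1]
    simp only [hI, integral_zero]
    rw [idealError, if_neg h0, if_pos h1, sub_self, abs_zero]
    exact hK
  have hid := idealError_mem_Icc hν hsymm q
  push Not at h0 h1
  have hw := normalQuantile_pos h0 h1
  have hidq : idealError ν q = 2 * (1 - cdf ν (normalQuantile ((q + 1) / 2))) := by
    rw [idealError, if_neg (not_le.2 h0), if_neg (not_le.2 h1), upperTail_eq_one_sub_cdf]
  have hpi : predInterval m s q = Set.Icc (m - s * normalQuantile ((q + 1) / 2))
      (m + s * normalQuantile ((q + 1) / 2)) := by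
    rw [predInterval, if_neg (not_le.2 h0), if_neg (not_le.2 h1)]
  rw [hpi]
  set w := normalQuantile ((q + 1) / 2)
  have habs : (1 / s₀) * (|m - m₀| + |s - s₀|) ≤ L * (|m - m₀| + |s - s₀|) := by gcongr
  have hsum : 0 ≤ |m - m₀| + |s - s₀| := by positivity
  -- A negative scale estimate gives an empty interval and error 1, but then `|s - s₀| / s₀` already
  -- exceeds 1, so the bound holds trivially.
  by_cases hs : s < 0
  · have hempty : Set.Icc (m - s * w) (m + s * w) = ∅ := Set.Icc_eq_empty (by nlinarith)
    have hI : ∀ e, covErr (m₀ + s₀ * e) (Set.Icc (m - s * w) (m + s * w)) = 1 := fun e => by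
      simp [covErr, hempty]
    simp only [hI, integral_const, probReal_univ, one_smul]
    rw [abs_of_nonneg (by linarith [hid.2])]
    have h3 : 1 ≤ (1 / s₀) * |s - s₀| := by
      rw [one_div_mul_eq_div, le_div_iff₀ hs₀, abs_of_neg (by linarith)]; linarith
    have h4 : 1 ≤ L * (|m - m₀| + |s - s₀|) := by
      refine h3.trans (le_trans ?_ habs)
      gcongr
      linarith [abs_nonneg (m - m₀)]
    nlinarith [hid.1]
  push Not at hs
  set δ := (m - m₀) / s₀ with hδ
  set ε := (s - s₀) / s₀ with hε
  have hA : m - s * w = m₀ + s₀ * (-(w + -δ + w * ε)) := by rw [hδ, hε]; field_simp; ring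
  have hBe : m + s * w = m₀ + s₀ * (w + δ + w * ε) := by rw [hδ, hε]; field_simp; ring
  have hI : ∫ e, covErr (m₀ + s₀ * e) (Set.Icc (m - s * w) (m + s * w)) ∂ν =
      1 - (cdf ν (w + δ + w * ε) - cdf ν (-(w + -δ + w * ε))) := by
    have hle : -(w + -δ + w * ε) ≤ w + δ + w * ε := by
      have h1e : 0 ≤ 1 + ε := by
        have : 1 + ε = s / s₀ := by rw [hε]; field_simp; ring
        rw [this]; positivity
      nlinarith
    have h2 : (fun e => covErr (m₀ + s₀ * e) (Set.Icc (m - s * w) (m + s * w))) =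
        (Set.Icc (-(w + -δ + w * ε)) (w + δ + w * ε))ᶜ.indicator 1 := by
      funext e
      rw [covErr, hA, hBe]
      by_cases he : e ∈ Set.Icc (-(w + -δ + w * ε)) (w + δ + w * ε)
      · rw [if_pos, Set.indicator_of_notMem (by simpa using he)]
        exact ⟨by have := he.1; gcongr, by have := he.2; gcongr⟩
      · rw [if_neg, Set.indicator_of_mem (by exact he)]
        · rfl
        · rintro ⟨h5, h6⟩
          exact he ⟨le_of_mul_le_mul_left (by linarith) hs₀,
            le_of_mul_le_mul_left (by linarith) hs₀⟩
    rw [h2, integral_indicator_one measurableSet_Icc.compl,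
      probReal_compl_eq_one_sub measurableSet_Icc, cdf_sub_cdf hle]
    congr 1
    rw [measureReal_def, measureReal_def, ← Set.Ioc_union_left hle]
    congr 1
    refine le_antisymm ((measure_union_le _ _).trans (by simp [hat]))
      (measure_mono Set.subset_union_left)
  rw [hI, cdf_neg_of_symmetric hν hsymm, hidq]
  have g1 := abs_cdf_perturb_le hM hM' hν hb hb' hw δ ε
  have g2 := abs_cdf_perturb_le hM hM' hν hb hb' hw (-δ) ε
  rw [abs_neg] at g2
  have hδε : |δ| + |ε| ≤ L * (|m - m₀| + |s - s₀|) := by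
    refine le_trans (le_of_eq ?_) habs
    rw [hδ, hε, abs_div, abs_div, abs_of_pos hs₀]; ring
  rw [abs_le] at g1 g2
  have hfin : 2 * (M * |δ| + (2 * M' + 2) * |ε|) ≤ (2 * M + 4 * M' + 4) * (|δ| + |ε|) := by
    nlinarith [mul_nonneg hM (abs_nonneg ε), mul_nonneg hM' (abs_nonneg δ), abs_nonneg δ]
  have hfin2 := mul_le_mul_of_nonneg_left hδε (by positivity : 0 ≤ 2 * M + 4 * M' + 4)
  rw [abs_le]
  constructor <;> nlinarith [g1.1, g1.2, g2.1, g2.2]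

end Noise

/-! ### Integration against an independent variable -/

section Freezing

variable {Ω Ω' E : Type*} {m m₀ : MeasurableSpace Ω} [MeasurableSpace Ω'] [mE : MeasurableSpace E]
  {P : Measure Ω}

/-- The past is encoded as the identity map from `Ω` to `Ω` equipped with the smaller σ-algebra.
Conditioning on it then becomes Fubini for a product law, and a function of past and new data is
integrated with the past frozen. -/
theorem indepFun_id_of_indep {Z : Ω → E} (h : Indep m (mE.comap Z) P) :
    @IndepFun Ω Ω E m₀ m mE id Z P := by
  rw [@IndepFun_iff_Indep Ω Ω E m₀ m mE, @MeasurableSpace.comap_id Ω m]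
  exact h

variable [IsProbabilityMeasure P]

theorem lintegral_comp_prodMk_of_indepFun {A : Ω → Ω'} {Z : Ω → E} (hA : Measurable A)
    (hZ : Measurable Z) (h : IndepFun A Z P) {ψ : Ω' × E → ENNReal} (hψ : Measurable ψ) :
    ∫⁻ ω, ψ (A ω, Z ω) ∂P = ∫⁻ ω, ∫⁻ z, ψ (A ω, z) ∂(P.map Z) ∂P := by
  have := Measure.isProbabilityMeasure_map hZ.aemeasurable (μ := P)
  rw [← lintegral_map hψ (hA.prodMk hZ),
    (indepFun_iff_map_prod_eq_prod_map_map hA.aemeasurable hZ.aemeasurable).1 h,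
    lintegral_prod _ hψ.aemeasurable, lintegral_map hψ.lintegral_prod_right' hA]

theorem integral_comp_prodMk_of_indepFun {A : Ω → Ω'} {Z : Ω → E} (hA : Measurable A)
    (hZ : Measurable Z) (h : IndepFun A Z P) {ψ : Ω' × E → ℝ} (hψ : Measurable ψ) {C : ℝ}
    (hb : ∀ p, |ψ p| ≤ C) :
    ∫ ω, ψ (A ω, Z ω) ∂P = ∫ ω, ∫ z, ψ (A ω, z) ∂(P.map Z) ∂P := by
  have := Measure.isProbabilityMeasure_map hZ.aemeasurable (μ := P)
  have := Measure.isProbabilityMeasure_map hA.aemeasurable (μ := P)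
  have hInt : Integrable ψ ((P.map A).prod (P.map Z)) :=
    Integrable.of_bound hψ.aestronglyMeasurable C (ae_of_all _ hb)
  rw [← integral_map (hA.prodMk hZ).aemeasurable hψ.aestronglyMeasurable,
    (indepFun_iff_map_prod_eq_prod_map_map hA.aemeasurable hZ.aemeasurable).1 h,
    integral_prod _ hInt, integral_map hA.aemeasurable]
  exact hψ.stronglyMeasurable.integral_prod_right'.aestronglyMeasurable

theorem lintegral_frozen (hm : m ≤ m₀) {Z : Ω → E} (hZ : Measurable Z)
    (h : Indep m (mE.comap Z) P) {ψ : Ω → E → ENNReal}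
    (hψ : @Measurable (Ω × E) ENNReal (@Prod.instMeasurableSpace Ω E m mE) inferInstance
      (fun p => ψ p.1 p.2)) :
    ∫⁻ ω, ψ ω (Z ω) ∂P = ∫⁻ ω, ∫⁻ z, ψ ω z ∂(P.map Z) ∂P :=
  @lintegral_comp_prodMk_of_indepFun Ω Ω E m₀ m mE P _ id Z (measurable_id'' hm) hZ
    (indepFun_id_of_indep h) (fun p => ψ p.1 p.2) hψ

theorem integral_frozen (hm : m ≤ m₀) {Z : Ω → E} (hZ : Measurable Z)
    (h : Indep m (mE.comap Z) P) {ψ : Ω → E → ℝ}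
    (hψ : @Measurable (Ω × E) ℝ (@Prod.instMeasurableSpace Ω E m mE) inferInstance
      (fun p => ψ p.1 p.2)) {C : ℝ} (hb : ∀ ω z, |ψ ω z| ≤ C) :
    ∫ ω, ψ ω (Z ω) ∂P = ∫ ω, ∫ z, ψ ω z ∂(P.map Z) ∂P :=
  @integral_comp_prodMk_of_indepFun Ω Ω E m₀ m mE P _ id Z (measurable_id'' hm) hZ
    (indepFun_id_of_indep h) (fun p => ψ p.1 p.2) hψ C (fun p => hb p.1 p.2)

theorem measurable_comp_frozen {m' : MeasurableSpace Ω} (hm : m ≤ m') {Z : Ω → E}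
    (hZ : Measurable[m'] Z) {β : Type*} [MeasurableSpace β] {ψ : Ω → E → β}
    (hψ : @Measurable (Ω × E) β (@Prod.instMeasurableSpace Ω E m mE) inferInstance
      (fun p => ψ p.1 p.2)) :
    Measurable[m'] fun ω => ψ ω (Z ω) :=
  @Measurable.comp Ω (Ω × E) β m' (@Prod.instMeasurableSpace Ω E m mE) _ _ (fun ω => (ω, Z ω)) hψ
    (@Measurable.prodMk Ω m' Ω E m mE id Z (measurable_id'' hm) hZ)

theorem measurable_integral_frozen {ν : Measure E} [SFinite ν] {ψ : Ω → E → ℝ}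
    (hψ : @Measurable (Ω × E) ℝ (@Prod.instMeasurableSpace Ω E m mE) inferInstance
      (fun p => ψ p.1 p.2)) :
    Measurable[m] fun ω => ∫ z, ψ ω z ∂ν :=
  (@StronglyMeasurable.integral_prod_right' Ω E ℝ m mE ν _ _ _ (fun p => ψ p.1 p.2)
    hψ.stronglyMeasurable).measurable

theorem measurable_lintegral_frozen {ν : Measure E} [SFinite ν] {ψ : Ω → E → ENNReal}
    (hψ : @Measurable (Ω × E) ENNReal (@Prod.instMeasurableSpace Ω E m mE) inferInstance
      (fun p => ψ p.1 p.2)) :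
    Measurable[m] fun ω => ∫⁻ z, ψ ω z ∂ν :=
  @Measurable.lintegral_prod_right' Ω E m mE ν _ (fun p => ψ p.1 p.2) hψ

theorem integral_mul_frozen (hm : m ≤ m₀) {Z : Ω → E} (hZ : Measurable Z)
    (h : Indep m (mE.comap Z) P) {ψ : Ω → E → ℝ}
    (hψ : @Measurable (Ω × E) ℝ (@Prod.instMeasurableSpace Ω E m mE) inferInstance
      (fun p => ψ p.1 p.2)) {C : ℝ} (hb : ∀ ω z, |ψ ω z| ≤ C) {W : Ω → ℝ}
    (hW : Measurable[m] W) {B : ℝ} (hB : ∀ ω, |W ω| ≤ B) :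
    ∫ ω, W ω * ψ ω (Z ω) ∂P = ∫ ω, W ω * ∫ z, ψ ω z ∂(P.map Z) ∂P := by
  have hψ' : @Measurable (Ω × E) ℝ (@Prod.instMeasurableSpace Ω E m mE) inferInstance
      (fun p => W p.1 * ψ p.1 p.2) :=
    (hW.comp (@measurable_fst Ω E m mE)).mul hψ
  rw [integral_frozen hm hZ h (ψ := fun ω z => W ω * ψ ω z) (C := B * C) hψ' (fun ω z => by
    rw [abs_mul]
    exact mul_le_mul (hB ω) (hb ω z) (abs_nonneg _) ((abs_nonneg _).trans (hB ω)))]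
  simp_rw [integral_const_mul]

theorem condExp_frozen (hm : m ≤ m₀) {Z : Ω → E} (hZ : Measurable Z)
    (h : Indep m (mE.comap Z) P) {ψ : Ω → E → ℝ}
    (hψ : @Measurable (Ω × E) ℝ (@Prod.instMeasurableSpace Ω E m mE) inferInstance
      (fun p => ψ p.1 p.2)) {C : ℝ} (hb : ∀ ω z, |ψ ω z| ≤ C) :
    P[fun ω => ψ ω (Z ω) | m] =ᵐ[P] fun ω => ∫ z, ψ ω z ∂(P.map Z) := by
  have := Measure.isProbabilityMeasure_map hZ.aemeasurable (μ := P)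
  have hmeas := measurable_integral_frozen (ν := P.map Z) hψ
  have hbound : ∀ ω, |∫ z, ψ ω z ∂(P.map Z)| ≤ C := fun ω => by
    have := norm_integral_le_of_norm_le_const (μ := P.map Z) (f := ψ ω) (C := C)
      (ae_of_all _ (hb ω))
    simpa using this
  have hInt : Integrable (fun ω => ∫ z, ψ ω z ∂(P.map Z)) P :=
    Integrable.of_bound (hmeas.mono hm le_rfl).aestronglyMeasurable C (ae_of_all _ hbound)
  have hInt' : Integrable (fun ω => ψ ω (Z ω)) P :=
    Integrable.of_bound (measurable_comp_frozen hm hZ hψ).aestronglyMeasurable C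
      (ae_of_all _ fun ω => hb ω _)
  symm
  refine ae_eq_condExp_of_forall_setIntegral_eq hm hInt' (fun s _ _ => hInt.integrableOn) ?_
    hmeas.stronglyMeasurable.aestronglyMeasurable
  intro s hs _
  have h1 := integral_mul_frozen hm hZ h hψ hb (W := s.indicator 1)
    ((measurable_indicator_const_iff (1 : ℝ)).2 hs) (B := 1) (fun ω => by
      by_cases hω : ω ∈ s <;> simp [hω])
  rw [← integral_indicator (hm s hs), ← integral_indicator (hm s hs)]
  have e : ∀ g : Ω → ℝ, s.indicator g = fun ω => s.indicator 1 ω * g ω := fun g => by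
    funext ω
    by_cases hω : ω ∈ s <;> simp [hω]
  rw [e fun ω => ψ ω (Z ω), e fun ω => ∫ z, ψ ω z ∂(P.map Z)]
  exact h1.symm

/-- The `[0, ∞]`-valued version is needed because no integrability of the estimation error is
assumed in `RateInProbability`. -/
theorem condLExp_frozen (hm : m ≤ m₀) {Z : Ω → E} (hZ : Measurable Z)
    (h : Indep m (mE.comap Z) P) {ψ : Ω → E → ENNReal}
    (hψ : @Measurable (Ω × E) ENNReal (@Prod.instMeasurableSpace Ω E m mE) inferInstance
      (fun p => ψ p.1 p.2)) :
    condLExp m P (fun ω => ψ ω (Z ω)) =ᵐ[P] fun ω => ∫⁻ z, ψ ω z ∂(P.map Z) := by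
  have := Measure.isProbabilityMeasure_map hZ.aemeasurable (μ := P)
  have hmeas := measurable_lintegral_frozen (ν := P.map Z) hψ
  refine (ae_eq_condLExp hm P _ hmeas fun s hs => ?_).symm
  have hs' : Measurable[m] (s.indicator (1 : Ω → ENNReal)) :=
    (measurable_indicator_const_iff (1 : ENNReal)).2 hs
  have hψ' : @Measurable (Ω × E) ENNReal (@Prod.instMeasurableSpace Ω E m mE) inferInstance
      (fun p => s.indicator 1 p.1 * ψ p.1 p.2) :=
    (hs'.comp (@measurable_fst Ω E m mE)).mul hψ
  have h1 := lintegral_frozen hm hZ h (ψ := fun ω z => s.indicator 1 ω * ψ ω z) hψ'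
  have e : ∀ g : Ω → ENNReal, s.indicator g = fun ω => s.indicator 1 ω * g ω := fun g => by
    funext ω
    by_cases hω : ω ∈ s <;> simp [hω]
  rw [← lintegral_indicator (hm s hs), ← lintegral_indicator (hm s hs),
    e fun ω => ψ ω (Z ω), e fun ω => ∫⁻ z, ψ ω z ∂(P.map Z), h1]
  refine lintegral_congr fun ω => ?_
  by_cases hω : ω ∈ s <;> simp [hω]

end Freezing

/-! ### Sub-Gaussian bounds for bounded martingale increments -/

/-- On `[-L, L]` the convex function `y ↦ exp (θ y)` lies below its chord. -/
theorem exp_mul_le_cosh_add {L y : ℝ} (hL : 0 < L) (hy : |y| ≤ L) (θ : ℝ) :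
    Real.exp (θ * y) ≤ Real.cosh (θ * L) + y / L * Real.sinh (θ * L) := by
  rw [abs_le] at hy
  have h := convexOn_exp.2 (Set.mem_univ (θ * L)) (Set.mem_univ (-(θ * L)))
    (show 0 ≤ (L + y) / (2 * L) from div_nonneg (by linarith) (by positivity))
    (show 0 ≤ (L - y) / (2 * L) from div_nonneg (by linarith) (by positivity)) (by field_simp; ring)
  simp only [smul_eq_mul] at h
  have e : (L + y) / (2 * L) * (θ * L) + (L - y) / (2 * L) * -(θ * L) = θ * y := by
    field_simp; ring
  rw [e] at h
  refine h.trans (le_of_eq ?_)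
  rw [Real.cosh_eq, Real.sinh_eq]
  field_simp
  ring

/-- A conditional Hoeffding step. The chord bound replaces the exponential of the new increment by
an affine function of it; the linear term integrates to zero, and `cosh x ≤ exp (x ^ 2 / 2)` adds
`(u z) ^ 2` to the proxy. The martingale property is needed only tested against bounded
past-measurable weights. -/
theorem hasSubgaussianMGF_step {Ω : Type*} {m m₀ : MeasurableSpace Ω} {P : Measure Ω}
    [IsProbabilityMeasure P] (hm : m ≤ m₀) {N U ζ : Ω → ℝ} {v : NNReal} {C u z : ℝ}
    (hN : Measurable[m] N) (hNC : ∀ ω, |N ω| ≤ C) (hv : HasSubgaussianMGF N v P)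
    (hU : Measurable[m] U) (hUu : ∀ ω, |U ω| ≤ u) (hζ : Measurable ζ) (hζz : ∀ ω, |ζ ω| ≤ z)
    (hu : 0 < u) (hz : 0 < z)
    (hmart : ∀ W : Ω → ℝ, Measurable[m] W → (∃ C', ∀ ω, |W ω| ≤ C') → ∫ ω, W ω * ζ ω ∂P = 0)
    (a : ℝ) {v' : NNReal} (hv' : a ^ 2 * v + (u * z) ^ 2 ≤ v') :
    HasSubgaussianMGF (fun ω => a * N ω + U ω * ζ ω) v' P := by
  have hN0 := hN.mono hm le_rfl
  have hU0 := hU.mono hm le_rfl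
  have hUζ : ∀ ω, |U ω * ζ ω| ≤ u * z := fun ω => by
    rw [abs_mul]; exact mul_le_mul (hUu ω) (hζz ω) (abs_nonneg _) hu.le
  have hC : ∀ b ω, b * N ω ≤ |b| * C := fun b ω => by
    refine (le_abs_self _).trans ?_
    rw [abs_mul]; exact mul_le_mul_of_nonneg_left (hNC ω) (abs_nonneg _)
  have hexp : ∀ (b : ℝ), Integrable (fun ω => Real.exp (b * N ω)) P := fun b =>
    Integrable.of_bound (by fun_prop) (Real.exp (|b| * C)) (ae_of_all _ fun ω => by
      rw [Real.norm_eq_abs, Real.abs_exp]; exact Real.exp_le_exp.2 (hC b ω))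
  have hInt : ∀ θ : ℝ, Integrable (fun ω => Real.exp (θ * (a * N ω + U ω * ζ ω))) P := fun θ =>
    Integrable.of_bound (by fun_prop) (Real.exp (|θ * a| * C + |θ| * (u * z)))
      (ae_of_all _ fun ω => by
        rw [Real.norm_eq_abs, Real.abs_exp]
        refine Real.exp_le_exp.2 ?_
        have h1 := hC (θ * a) ω
        have h2 : θ * (U ω * ζ ω) ≤ |θ| * (u * z) := (le_abs_self _).trans (by
          rw [abs_mul]; exact mul_le_mul_of_nonneg_left (hUζ ω) (abs_nonneg _))
        linarith)
  refine ⟨hInt, fun θ => ?_⟩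
  have huz : 0 < u * z := mul_pos hu hz
  set ch := Real.cosh (θ * (u * z))
  set sh := Real.sinh (θ * (u * z)) / (u * z)
  have hle : ∀ ω, Real.exp (θ * (a * N ω + U ω * ζ ω)) ≤
      ch * Real.exp (θ * a * N ω) + sh * (Real.exp (θ * a * N ω) * U ω * ζ ω) := fun ω => by
    have h1 := exp_mul_le_cosh_add huz (hUζ ω) θ
    rw [show θ * (a * N ω + U ω * ζ ω) = θ * a * N ω + θ * (U ω * ζ ω) by ring, Real.exp_add]
    have h2 := mul_le_mul_of_nonneg_left h1 (Real.exp_nonneg (θ * a * N ω))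
    refine h2.trans (le_of_eq ?_)
    simp only [ch, sh]
    ring
  have hWb : ∀ ω, |Real.exp (θ * a * N ω) * U ω| ≤ Real.exp (|θ * a| * C) * u := fun ω => by
    rw [abs_mul, Real.abs_exp]
    exact mul_le_mul (Real.exp_le_exp.2 (hC _ ω)) (hUu ω) (abs_nonneg _) (Real.exp_nonneg _)
  have hWm : Measurable[m] fun ω => Real.exp (θ * a * N ω) * U ω :=
    (Real.measurable_exp.comp (hN.const_mul (θ * a))).mul hU
  -- The weight multiplying `ζ` in the linear term depends on the past only, so this term has mean
  -- zero.
  have h0 := hmart (fun ω => Real.exp (θ * a * N ω) * U ω) hWm ⟨_, hWb⟩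
  have hint2 : Integrable (fun ω => Real.exp (θ * a * N ω) * U ω * ζ ω) P :=
    Integrable.of_bound (by fun_prop) (Real.exp (|θ * a| * C) * u * z) (ae_of_all _ fun ω => by
      rw [Real.norm_eq_abs, abs_mul]
      exact mul_le_mul (hWb ω) (hζz ω) (abs_nonneg _) (by positivity))
  calc mgf (fun ω => a * N ω + U ω * ζ ω) P θ
      ≤ ∫ ω, (ch * Real.exp (θ * a * N ω) + sh * (Real.exp (θ * a * N ω) * U ω * ζ ω)) ∂P :=
        integral_mono (hInt θ) (((hexp _).const_mul _).add (hint2.const_mul _)) hle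
    _ = ch * mgf N P (θ * a) := by
        rw [integral_add ((hexp _).const_mul _) (hint2.const_mul _), integral_const_mul,
          integral_const_mul, h0, mul_zero, add_zero]
        rfl
    _ ≤ Real.exp ((θ * (u * z)) ^ 2 / 2) * Real.exp (v * (θ * a) ^ 2 / 2) :=
        mul_le_mul (Real.cosh_le_exp_half_sq _) (hv.mgf_le _) mgf_nonneg (Real.exp_nonneg _)
    _ ≤ Real.exp (v' * θ ^ 2 / 2) := by
        rw [← Real.exp_add]
        refine Real.exp_le_exp.2 ?_
        have := mul_le_mul_of_nonneg_right hv' (sq_nonneg θ)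
        linarith

theorem HasSubgaussianMGF.measure_abs_gt_le {Ω : Type*} {m₀ : MeasurableSpace Ω} {P : Measure Ω}
    [IsProbabilityMeasure P] {N : Ω → ℝ} {v : NNReal} (h : HasSubgaussianMGF N v P) {ε : ℝ}
    (hε : 0 ≤ ε) : P.real {ω | ε < |N ω|} ≤ 2 * Real.exp (-ε ^ 2 / (2 * v)) := by
  have h1 := h.measure_ge_le hε
  have h2 := h.neg.measure_ge_le hε
  have hsub : {ω | ε < |N ω|} ⊆ {ω | ε ≤ N ω} ∪ {ω | ε ≤ (-N) ω} := by
    intro ω hω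
    rcases lt_abs.1 (show ε < |N ω| from hω) with h | h
    · exact Or.inl h.le
    · exact Or.inr h.le
  have := (measureReal_mono hsub).trans (measureReal_union_le (μ := P) _ _)
  linarith

/-! ### Perturbed Robbins–Monro recursions -/

/-- The recursion `D (k + 1) = D k + Γ k * Z k` in which the conditional mean of `Z k` is
`d k = r (-h D k + b k)`, with a slope `h` bounded above and below, and with a random step `Γ k` at
least of order `(k + 1) ^ (-β)`. -/
structure IsRobbinsMonro {Ω : Type*} [m₀ : MeasurableSpace Ω] (P : Measure Ω)
    (𝓕 : ℕ → MeasurableSpace Ω) (D Γ Z d b : ℕ → Ω → ℝ) (β B B' κ K r lo c : ℝ) : Prop where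
  le : ∀ k, 𝓕 k ≤ m₀
  mono : Monotone 𝓕
  measurable_D : ∀ k, Measurable[𝓕 k] (D k)
  measurable_step : ∀ k, Measurable[𝓕 k] (Γ k)
  measurable_drift : ∀ k, Measurable[𝓕 k] (d k)
  measurable_bias : ∀ k, Measurable[𝓕 k] (b k)
  measurable_Z : ∀ k, Measurable[𝓕 (k + 1)] (Z k)
  recursion : ∀ k ω, D (k + 1) ω = D k ω + Γ k ω * Z k ω
  abs_D_le : ∀ k ω, |D k ω| ≤ B
  abs_Z_le : ∀ k ω, |Z k ω| ≤ 1
  abs_drift_le : ∀ k ω, |d k ω| ≤ 1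
  abs_bias_le : ∀ k ω, |b k ω| ≤ B'
  le_step : ∀ (k : ℕ) ω, lo * ((k : ℝ) + 1) ^ (-β) ≤ Γ k ω
  step_le : ∀ k ω, Γ k ω ≤ c
  condMean : ∀ k (W : Ω → ℝ), Measurable[𝓕 k] W → (∃ C, ∀ ω, |W ω| ≤ C) →
    ∫ ω, W ω * Z k ω ∂P = ∫ ω, W ω * d k ω ∂P
  drift_eq : ∀ k ω, ∃ h ∈ Set.Icc κ K, d k ω = r * (-h * D k ω + b k ω)
  slope_pos : 0 < κ
  rate_pos : 0 < r
  lo_pos : 0 < lo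
  B_pos : 0 < B
  β_mem : β ∈ Set.Ioo (0 : ℝ) 1

/-- Pathwise comparison of a contracting recursion with the linear recursion driven by the same
noise. -/
theorem abs_sub_le_of_contraction {D N a y : ℕ → ℝ} {n : ℕ} {B ε δ : ℝ} (hB : 0 ≤ B)
    (hε : 0 ≤ ε) (hδ : 0 ≤ δ) (hN0 : N 0 = 0) (hD0 : |D 0| ≤ B)
    (ha0 : ∀ j < n, 0 ≤ a j) (ha1 : ∀ j < n, a j ≤ 1)
    (hN : ∀ j < n, N (j + 1) = (1 - a j) * N j + y j) (hNε : ∀ j < n, |N j| ≤ ε)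
    (hD : ∀ j < n, ∃ g e : ℝ, a j ≤ g ∧ g ≤ 1 ∧ |e| ≤ a j * δ ∧
      D (j + 1) = (1 - g) * D j + y j + e) (j : ℕ) (hj : j ≤ n) :
    |D j - N j| ≤ (∏ i ∈ Finset.range j, (1 - a i)) * B + ε + δ := by
  induction j with
  | zero => simp only [hN0, sub_zero, Finset.range_zero, Finset.prod_empty, one_mul]; linarith
  | succ j ih =>
    have ih := ih (by omega)
    have hjn : j < n := by omega
    obtain ⟨g, e, hg0, hg1, he, hDj⟩ := hD j hjn
    have hp : 0 ≤ ∏ i ∈ Finset.range j, (1 - a i) :=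
      Finset.prod_nonneg fun i hi => sub_nonneg.2 (ha1 i (by
        rw [Finset.mem_range] at hi; omega))
    rw [Finset.prod_range_succ]
    set p := ∏ i ∈ Finset.range j, (1 - a i)
    have h0 := ha0 j hjn
    have h1 := ha1 j hjn
    have hNj := abs_le.1 (hNε j hjn)
    rw [abs_le] at ih he
    have hpB : 0 ≤ p * (1 - a j) * B := mul_nonneg (mul_nonneg hp (by linarith)) hB
    have haε : 0 ≤ a j * ε := mul_nonneg h0 hε
    have hδa : a j * δ ≤ δ := by nlinarith
    have e1 : D (j + 1) - N (j + 1) = (1 - g) * D j - (1 - a j) * N j + e := by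
      rw [hDj, hN j hjn]; ring
    have hcon : (1 - a j) * |D j - N j| ≤ (1 - a j) * (p * B + ε + δ) :=
      mul_le_mul_of_nonneg_left (abs_le.2 ih) (by linarith)
    have hNl : |(1 - a j) * N j| ≤ ε := by
      rw [abs_mul, abs_of_nonneg (by linarith)]
      have := hNε j hjn
      nlinarith [abs_nonneg (N j)]
    rw [abs_le] at hNl
    have hc1 : (1 - a j) * (D j - N j) ≤ (1 - a j) * |D j - N j| :=
      mul_le_mul_of_nonneg_left (le_abs_self _) (by linarith)
    have hc2 : (1 - a j) * -(D j - N j) ≤ (1 - a j) * |D j - N j| :=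
      mul_le_mul_of_nonneg_left (neg_le_abs _) (by linarith)
    rw [e1, abs_le]
    -- As `a ≤ g ≤ 1`, the value `(1 - g) * D j` lies between 0 and `(1 - a) * D j`. On the side of
    -- the sign of `D j` the difference contracts by `1 - a`; on the other side it is bounded by
    -- `|(1 - a) * N j| ≤ ε` alone. The error `a * δ` fits into what contraction frees from `δ`.
    rcases le_total 0 (D j) with hDpos | hDneg
    · have hg : (1 - g) * D j ≤ (1 - a j) * D j :=
        mul_le_mul_of_nonneg_right (by linarith) hDpos
      have hg' : 0 ≤ (1 - g) * D j := mul_nonneg (by linarith) hDpos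
      constructor <;> nlinarith
    · have hg : (1 - a j) * D j ≤ (1 - g) * D j :=
        mul_le_mul_of_nonpos_right (by linarith) hDneg
      have hg' : (1 - g) * D j ≤ 0 := mul_nonpos_of_nonneg_of_nonpos (by linarith) hDneg
      constructor <;> nlinarith

/-- The linear recursion started from `0` at time `m`, driven by the martingale increments `Z - d`
with steps truncated at `hi * (k + 1) ^ (-β)`. -/
noncomputable def linearNoise {Ω : Type*} (Γ Z d : ℕ → Ω → ℝ) (β a₀ hi : ℝ) (m : ℕ) :
    ℕ → Ω → ℝ
  | 0 => fun _ => 0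
  | j + 1 => fun ω => (1 - a₀ * (((m + j : ℕ) : ℝ) + 1) ^ (-β)) * linearNoise Γ Z d β a₀ hi m j ω +
      min (Γ (m + j) ω) (hi * (((m + j : ℕ) : ℝ) + 1) ^ (-β)) * (Z (m + j) ω - d (m + j) ω)

/-! ### Pathwise and sub-Gaussian control through the linear recursion. -/

namespace IsRobbinsMonro

variable {Ω : Type*} [m₀ : MeasurableSpace Ω] {P : Measure Ω}
  {𝓕 : ℕ → MeasurableSpace Ω} {D Γ Z d b : ℕ → Ω → ℝ} {β B B' κ K r lo c hi : ℝ}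

theorem step_nonneg (h : IsRobbinsMonro P 𝓕 D Γ Z d b β B B' κ K r lo c) (k : ℕ) (ω : Ω) :
    0 ≤ Γ k ω :=
  le_trans (mul_nonneg h.lo_pos.le (by positivity)) (h.le_step k ω)

theorem gain_pos (h : IsRobbinsMonro P 𝓕 D Γ Z d b β B B' κ K r lo c) : 0 < κ * r * lo :=
  mul_pos (mul_pos h.slope_pos h.rate_pos) h.lo_pos

theorem rpow_step_pos (β : ℝ) (k : ℕ) : (0 : ℝ) < ((k : ℝ) + 1) ^ (-β) := by positivity

theorem measurable_linearNoise (h : IsRobbinsMonro P 𝓕 D Γ Z d b β B B' κ K r lo c)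
    (a₀ : ℝ) (m j : ℕ) : Measurable[𝓕 (m + j)] (linearNoise Γ Z d β a₀ hi m j) := by
  induction j with
  | zero => exact measurable_const
  | succ j ih =>
    have hle : 𝓕 (m + j) ≤ 𝓕 (m + (j + 1)) := h.mono (by omega)
    have h1 := ih.mono hle le_rfl
    have h2 := (h.measurable_step (m + j)).mono hle le_rfl
    have h3 := (h.measurable_drift (m + j)).mono hle le_rfl
    have h4 : Measurable[𝓕 (m + (j + 1))] (Z (m + j)) := h.measurable_Z (m + j)
    exact (h1.const_mul _).add ((h2.min measurable_const).mul (h4.sub h3))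

theorem abs_truncStep_le (h : IsRobbinsMonro P 𝓕 D Γ Z d b β B B' κ K r lo c) (hhi : 0 < hi)
    (k : ℕ) (ω : Ω) : |min (Γ k ω) (hi * ((k : ℝ) + 1) ^ (-β))| ≤ hi * ((k : ℝ) + 1) ^ (-β) := by
  rw [abs_of_nonneg (le_min (h.step_nonneg k ω) (mul_pos hhi (rpow_step_pos β k)).le)]
  exact min_le_right _ _

theorem abs_increment_le (h : IsRobbinsMonro P 𝓕 D Γ Z d b β B B' κ K r lo c)
    (k : ℕ) (ω : Ω) : |Z k ω - d k ω| ≤ 2 := by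
  have h1 := h.abs_Z_le k ω
  have h2 := h.abs_drift_le k ω
  exact (abs_sub _ _).trans (by linarith)

theorem exists_abs_linearNoise_le (h : IsRobbinsMonro P 𝓕 D Γ Z d b β B B' κ K r lo c)
    (hhi : 0 < hi) (a₀ : ℝ) (m j : ℕ) : ∃ C, ∀ ω, |linearNoise Γ Z d β a₀ hi m j ω| ≤ C := by
  induction j with
  | zero => exact ⟨0, fun ω => by simp [linearNoise]⟩
  | succ j ih =>
    obtain ⟨C, hC⟩ := ih
    refine ⟨|1 - a₀ * (((m + j : ℕ) : ℝ) + 1) ^ (-β)| * C +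
      hi * (((m + j : ℕ) : ℝ) + 1) ^ (-β) * 2, fun ω => ?_⟩
    rw [linearNoise]
    refine (abs_add_le _ _).trans (add_le_add ?_ ?_)
    · rw [abs_mul]; exact mul_le_mul_of_nonneg_left (hC ω) (abs_nonneg _)
    · rw [abs_mul]
      exact mul_le_mul (h.abs_truncStep_le hhi _ ω) (h.abs_increment_le _ ω) (abs_nonneg _)
        (mul_pos hhi (rpow_step_pos β _)).le

theorem measurable₀ (h : IsRobbinsMonro P 𝓕 D Γ Z d b β B B' κ K r lo c) (k : ℕ) :
    Measurable (D k) ∧ Measurable (Γ k) ∧ Measurable (Z k) ∧ Measurable (d k) ∧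
      Measurable (b k) :=
  ⟨(h.measurable_D k).mono (h.le k) le_rfl, (h.measurable_step k).mono (h.le k) le_rfl,
    (h.measurable_Z k).mono (h.le _) le_rfl, (h.measurable_drift k).mono (h.le k) le_rfl,
    (h.measurable_bias k).mono (h.le k) le_rfl⟩

/-- On the event where the steps, the bias and the linear noise are controlled on a time window, so
is the recursion at the end of the window. -/
theorem abs_D_le_of_window (h : IsRobbinsMonro P 𝓕 D Γ Z d b β B B' κ K r lo c) {m n : ℕ}
    (hhi : 0 < hi) {ε δ : ℝ} (hε : 0 ≤ ε) (hδ : 0 ≤ δ)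
    (ha1 : κ * r * lo * ((m : ℝ) + 1) ^ (-β) ≤ 1)
    (hg1 : hi * r * K * ((m : ℝ) + 1) ^ (-β) ≤ 1) {ω : Ω}
    (hΓ : ∀ j < n, Γ (m + j) ω ≤ hi * (((m + j : ℕ) : ℝ) + 1) ^ (-β))
    (hb : ∀ j < n, |b (m + j) ω| ≤ δ)
    (hN : ∀ j ≤ n, |linearNoise Γ Z d β (κ * r * lo) hi m j ω| ≤ ε) :
    |D (m + n) ω| ≤ (∏ i ∈ Finset.range n, (1 - κ * r * lo * (((m + i : ℕ) : ℝ) + 1) ^ (-β))) * B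
      + 2 * ε + hi / (κ * lo) * δ := by
  have hum : ∀ j : ℕ, (((m + j : ℕ) : ℝ) + 1) ^ (-β) ≤ ((m : ℝ) + 1) ^ (-β) := fun j => by
    refine Real.rpow_le_rpow_of_nonpos (by positivity) ?_ (by linarith [h.β_mem.1])
    push_cast
    linarith [(Nat.cast_nonneg j : (0 : ℝ) ≤ j)]
  have hκ := h.slope_pos
  have hr := h.rate_pos
  have hlo := h.lo_pos
  have hB := h.B_pos
  have ha₀ := h.gain_pos
  have key := abs_sub_le_of_contraction (D := fun j => D (m + j) ω)
    (N := fun j => linearNoise Γ Z d β (κ * r * lo) hi m j ω)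
    (a := fun j => κ * r * lo * (((m + j : ℕ) : ℝ) + 1) ^ (-β))
    (y := fun j => Γ (m + j) ω * (Z (m + j) ω - d (m + j) ω)) (n := n)
    (B := B) (ε := ε) (δ := hi / (κ * lo) * δ) hB.le hε (by positivity) rfl
    (h.abs_D_le _ ω) (fun j _ => (mul_pos ha₀ (rpow_step_pos β _)).le)
    (fun j _ => (mul_le_mul_of_nonneg_left (hum j) ha₀.le).trans ha1)
    (fun j hj => by simp only [linearNoise]; rw [min_eq_left (hΓ j hj)])
    (fun j hj => hN j hj.le) ?_ n le_rfl
  · have h1 := hN n le_rfl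
    have h2 := abs_sub_abs_le_abs_sub (D (m + n) ω) (linearNoise Γ Z d β (κ * r * lo) hi m n ω)
    linarith
  · intro j hj
    obtain ⟨s, hs, hds⟩ := h.drift_eq (m + j) ω
    have hu := rpow_step_pos β (m + j)
    have hloj := h.le_step (m + j) ω
    have hΓ0 := h.step_nonneg (m + j) ω
    have hΓj := hΓ j hj
    have hbj := hb j hj
    have humj := hum j
    set u := (((m + j : ℕ) : ℝ) + 1) ^ (-β)
    have hs0 : 0 < s := hκ.trans_le hs.1
    -- The true gain is `Γ r s`, at least the deterministic gain `κ r lo u`. The bias contributes at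
    -- most `hi u r δ`, which is that deterministic gain times `hi / (κ lo) * δ`.
    refine ⟨Γ (m + j) ω * r * s, Γ (m + j) ω * r * b (m + j) ω, ?_, ?_, ?_, ?_⟩
    · calc κ * r * lo * u = lo * u * r * κ := by ring
        _ ≤ Γ (m + j) ω * r * s := by
          have := hs.1
          gcongr
    · calc Γ (m + j) ω * r * s ≤ hi * ((m : ℝ) + 1) ^ (-β) * r * K := by
            have := hs.2
            have := hΓj.trans (mul_le_mul_of_nonneg_left humj hhi.le)
            gcongr
        _ = hi * r * K * ((m : ℝ) + 1) ^ (-β) := by ring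
        _ ≤ 1 := hg1
    · rw [abs_mul, abs_of_nonneg (by positivity)]
      calc Γ (m + j) ω * r * |b (m + j) ω| ≤ hi * u * r * δ := by gcongr
        _ = κ * r * lo * u * (hi / (κ * lo) * δ) := by field_simp
    · have h1 := h.recursion (m + j) ω
      change D (m + j + 1) ω = _
      rw [h1, hds]
      ring

variable [IsProbabilityMeasure P]

theorem integral_increment_eq_zero (h : IsRobbinsMonro P 𝓕 D Γ Z d b β B B' κ K r lo c)
    (k : ℕ) (W : Ω → ℝ) (hW : Measurable[𝓕 k] W) (hC : ∃ C, ∀ ω, |W ω| ≤ C) :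
    ∫ ω, W ω * (Z k ω - d k ω) ∂P = 0 := by
  obtain ⟨_, _, hZ, hd, _⟩ := h.measurable₀ k
  have hW0 := hW.mono (h.le k) le_rfl
  have hcm := h.condMean k W hW hC
  obtain ⟨C, hC⟩ := hC
  have h1 : Integrable (fun ω => W ω * Z k ω) P :=
    Integrable.of_bound (by fun_prop) (C * 1) (ae_of_all _ fun ω => by
      rw [Real.norm_eq_abs, abs_mul]
      exact mul_le_mul (hC ω) (h.abs_Z_le k ω) (abs_nonneg _) ((abs_nonneg _).trans (hC ω)))
  have h2 : Integrable (fun ω => W ω * d k ω) P :=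
    Integrable.of_bound (by fun_prop) (C * 1) (ae_of_all _ fun ω => by
      rw [Real.norm_eq_abs, abs_mul]
      exact mul_le_mul (hC ω) (h.abs_drift_le k ω) (abs_nonneg _) ((abs_nonneg _).trans (hC ω)))
  simp_rw [mul_sub]
  rw [integral_sub h1 h2, hcm, sub_self]

/-- One proxy `v` serves the whole window because it is preserved by a step: with `u` the current
`(k + 1) ^ (-β)`, increments are at most `2 hi u`, and `(1 - a₀ u) ^ 2 v + 4 hi ^ 2 u ^ 2 ≤ v` as
soon as `4 hi ^ 2 u ≤ a₀ v`. Truncating the steps makes this bound deterministic; the contraction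
factors are deterministic by construction. -/
theorem hasSubgaussianMGF_linearNoise (h : IsRobbinsMonro P 𝓕 D Γ Z d b β B B' κ K r lo c)
    (hhi : 0 < hi) {a₀ : ℝ} (ha₀ : 0 < a₀) {m : ℕ}
    (ha1 : a₀ * ((m : ℝ) + 1) ^ (-β) ≤ 1) {v : NNReal}
    (hv : 4 * hi ^ 2 * ((m : ℝ) + 1) ^ (-β) ≤ a₀ * v) (j : ℕ) :
    HasSubgaussianMGF (linearNoise Γ Z d β a₀ hi m j) v P := by
  induction j with
  | zero =>
    have : HasSubgaussianMGF (fun _ : Ω => (0 : ℝ)) 0 P := HasSubgaussianMGF.fun_zero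
    refine ⟨this.integrable_exp_mul, fun t => (this.mgf_le t).trans ?_⟩
    simp only [NNReal.coe_zero, zero_mul, zero_div, Real.exp_zero]
    exact Real.one_le_exp (by positivity)
  | succ j ih =>
    obtain ⟨C, hC⟩ := h.exists_abs_linearNoise_le hhi a₀ m j
    obtain ⟨_, _, hZ, hd, _⟩ := h.measurable₀ (m + j)
    have hu := rpow_step_pos β (m + j)
    have hum : (((m + j : ℕ) : ℝ) + 1) ^ (-β) ≤ ((m : ℝ) + 1) ^ (-β) := by
      refine Real.rpow_le_rpow_of_nonpos (by positivity) ?_ (by linarith [h.β_mem.1])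
      push_cast
      linarith [(Nat.cast_nonneg j : (0 : ℝ) ≤ j)]
    set u := (((m + j : ℕ) : ℝ) + 1) ^ (-β) with hudef
    refine hasSubgaussianMGF_step (h.le (m + j)) (h.measurable_linearNoise a₀ m j) hC ih
      ((h.measurable_step (m + j)).min measurable_const)
      (h.abs_truncStep_le hhi (m + j)) (hZ.sub hd) (h.abs_increment_le (m + j))
      (mul_pos hhi hu) two_pos (h.integral_increment_eq_zero (m + j)) (1 - a₀ * u) ?_
    have hx0 : 0 < a₀ * u := mul_pos ha₀ hu
    have hx1 : a₀ * u ≤ 1 := (mul_le_mul_of_nonneg_left hum ha₀.le).trans ha1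
    have h1 : (1 - a₀ * u) ^ 2 * v ≤ (1 - a₀ * u) * v :=
      mul_le_mul_of_nonneg_right (by nlinarith) v.2
    have h2 : 4 * hi ^ 2 * u ≤ a₀ * v :=
      (mul_le_mul_of_nonneg_left hum (by positivity)).trans hv
    have h3 := mul_le_mul_of_nonneg_right h2 hu.le
    nlinarith

end IsRobbinsMonro

/-! ### Elementary asymptotics -/

theorem tendsto_natCast_add_one : Tendsto (fun k : ℕ => (k : ℝ) + 1) atTop atTop :=
  tendsto_atTop_add_const_right _ _ tendsto_natCast_atTop_atTop

theorem eventually_mul_rpow_neg_le_one {β : ℝ} (hβ : 0 < β) (C : ℝ) :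
    ∀ᶠ k : ℕ in atTop, C * ((k : ℝ) + 1) ^ (-β) ≤ 1 := by
  have h := ((tendsto_rpow_neg_atTop hβ).comp tendsto_natCast_add_one).const_mul C
  rw [mul_zero] at h
  exact h.eventually_le_const zero_lt_one

theorem eventually_one_le_log : ∀ᶠ k : ℕ in atTop, 1 ≤ Real.log ((k : ℝ) + 1) :=
  (Real.tendsto_log_atTop.comp tendsto_natCast_add_one).eventually_ge_atTop 1

theorem eventually_exp_neg_rpow_le {p : ℝ} (hp : 0 < p) {a : ℝ} (ha : 0 < a) (s : ℝ) :
    ∀ᶠ k : ℕ in atTop, Real.exp (-a * ((k : ℝ) + 1) ^ p) ≤ ((k : ℝ) + 1) ^ (-s) := by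
  have h1 := (isLittleO_exp_neg_mul_rpow_atTop ha (-s / p)).comp_tendsto
    ((tendsto_rpow_atTop hp).comp tendsto_natCast_add_one)
  filter_upwards [h1.bound zero_lt_one] with k hk
  simp only [Function.comp_apply, Real.norm_eq_abs, Real.abs_exp, one_mul] at hk
  rw [← Real.rpow_mul (by positivity), mul_div_cancel₀ _ hp.ne',
    abs_of_nonneg (by positivity)] at hk
  exact hk

theorem half_window_rpow_le {β : ℝ} (hβ0 : 0 ≤ β) (hβ1 : β ≤ 1) {k j : ℕ} (hj : k / 2 ≤ j) :
    ((j : ℝ) + 1) ^ (-β) ≤ 2 * ((k : ℝ) + 1) ^ (-β) := by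
  have h1 : ((k : ℝ) + 1) / 2 ≤ (j : ℝ) + 1 := by
    have : k + 1 ≤ 2 * (j + 1) := by omega
    have : ((k + 1 : ℕ) : ℝ) ≤ ((2 * (j + 1) : ℕ) : ℝ) := by exact_mod_cast this
    push_cast at this
    linarith
  calc ((j : ℝ) + 1) ^ (-β) ≤ (((k : ℝ) + 1) / 2) ^ (-β) :=
        Real.rpow_le_rpow_of_nonpos (by positivity) h1 (by linarith)
    _ = 2 ^ β * ((k : ℝ) + 1) ^ (-β) := by
        rw [Real.div_rpow (by positivity) (by positivity), Real.rpow_neg (by norm_num : (0:ℝ) ≤ 2)]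
        field_simp
    _ ≤ 2 * ((k : ℝ) + 1) ^ (-β) := by
        gcongr
        calc (2 : ℝ) ^ β ≤ 2 ^ (1 : ℝ) := Real.rpow_le_rpow_of_exponent_le (by norm_num) hβ1
          _ = 2 := Real.rpow_one _

theorem half_window_inv_cube_le {C : ℝ} (hC : 0 ≤ C) {k j : ℕ} (hj : k / 2 ≤ j) :
    C / ((j : ℝ) + 1) ^ 3 ≤ 8 * C / ((k : ℝ) + 1) ^ 3 := by
  have h1 : (k : ℝ) + 1 ≤ 2 * ((j : ℝ) + 1) := by
    have : k + 1 ≤ 2 * (j + 1) := by omega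
    exact_mod_cast this
  rw [div_le_div_iff₀ (by positivity) (by positivity)]
  calc C * ((k : ℝ) + 1) ^ 3 ≤ C * (2 * ((j : ℝ) + 1)) ^ 3 := by gcongr
    _ = 8 * C * ((j : ℝ) + 1) ^ 3 := by ring

theorem eventually_of_half_window {p : ℕ → Prop} (h : ∀ᶠ k in atTop, p k) :
    ∀ᶠ k in atTop, ∀ j, k / 2 ≤ j → p j := by
  obtain ⟨K, hK⟩ := eventually_atTop.1 h
  filter_upwards [eventually_ge_atTop (2 * K)] with k hk j hj
  exact hK j (by omega)

/-- The window contains at least `(k + 1) / 4` factors, each at most `exp (-a₀ (k + 1) ^ (-β))`. -/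
theorem prod_one_sub_le_exp {a₀ β : ℝ} (ha₀ : 0 < a₀) (hβ : 0 ≤ β) {k : ℕ} (hk : 1 ≤ k)
    (ha1 : a₀ * (((k / 2 : ℕ) : ℝ) + 1) ^ (-β) ≤ 1) :
    ∏ i ∈ Finset.range (k - k / 2), (1 - a₀ * (((k / 2 + i : ℕ) : ℝ) + 1) ^ (-β)) ≤
      Real.exp (-(a₀ / 4) * ((k : ℝ) + 1) ^ (1 - β)) := by
  have hT : (0 : ℝ) < (k : ℝ) + 1 := by positivity
  calc ∏ i ∈ Finset.range (k - k / 2), (1 - a₀ * (((k / 2 + i : ℕ) : ℝ) + 1) ^ (-β))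
      ≤ ∏ _i ∈ Finset.range (k - k / 2), Real.exp (-(a₀ * ((k : ℝ) + 1) ^ (-β))) := by
        refine Finset.prod_le_prod (fun i _ => sub_nonneg.2 (le_trans ?_ ha1)) (fun i hi => ?_)
        · refine mul_le_mul_of_nonneg_left (Real.rpow_le_rpow_of_nonpos (by positivity) ?_
            (by linarith)) ha₀.le
          push_cast
          linarith [(Nat.cast_nonneg i : (0 : ℝ) ≤ i)]
        · refine (Real.one_sub_le_exp_neg _).trans (Real.exp_le_exp.2 (neg_le_neg ?_))
          refine mul_le_mul_of_nonneg_left (Real.rpow_le_rpow_of_nonpos (by positivity) ?_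
            (by linarith)) ha₀.le
          rw [Finset.mem_range] at hi
          have : k / 2 + i + 1 ≤ k + 1 := by omega
          exact_mod_cast this
    _ = Real.exp (-(((k - k / 2 : ℕ) : ℝ) * (a₀ * ((k : ℝ) + 1) ^ (-β)))) := by
        rw [Finset.prod_const, Finset.card_range, ← Real.exp_nat_mul]
        congr 1; ring
    _ ≤ Real.exp (-(a₀ / 4) * ((k : ℝ) + 1) ^ (1 - β)) := by
        refine Real.exp_le_exp.2 ?_
        have h1 : ((k : ℝ) + 1) / 4 ≤ ((k - k / 2 : ℕ) : ℝ) := by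
          have : k + 1 ≤ 4 * (k - k / 2) := by omega
          have : ((k + 1 : ℕ) : ℝ) ≤ ((4 * (k - k / 2) : ℕ) : ℝ) := by exact_mod_cast this
          push_cast at this ⊢
          linarith
        have h2 : ((k : ℝ) + 1) ^ (1 - β) = ((k : ℝ) + 1) * ((k : ℝ) + 1) ^ (-β) := by
          rw [sub_eq_add_neg, Real.rpow_add hT, Real.rpow_one]
        rw [h2]
        have h3 := mul_le_mul_of_nonneg_right h1
          (mul_nonneg ha₀.le (Real.rpow_nonneg hT.le (-β)))
        linarith

/-! ### High-probability rate and one-step mean-square bound. -/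

namespace IsRobbinsMonro

variable {Ω : Type*} [m₀ : MeasurableSpace Ω] {P : Measure Ω} [IsProbabilityMeasure P]
  {𝓕 : ℕ → MeasurableSpace Ω} {D Γ Z d b : ℕ → Ω → ℝ} {β B B' κ K r lo c hi : ℝ}

/-- At the start of the window the step is at most twice that at `k`, whence the proxy `8 hi ^ 2 /
a₀ * (k + 1) ^ (-β)`. The constant 48 makes the sub-Gaussian exponent exactly `3 log (k + 1)`, and
the cube leaves room for a union bound. -/
theorem measure_linearNoise_gt_le (h : IsRobbinsMonro P 𝓕 D Γ Z d b β B B' κ K r lo c)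
    (hhi : 0 < hi) {a₀ : ℝ} (ha₀ : 0 < a₀) {k : ℕ} (hlog : 1 ≤ Real.log ((k : ℝ) + 1))
    (ha1 : a₀ * (((k / 2 : ℕ) : ℝ) + 1) ^ (-β) ≤ 1) (j : ℕ) :
    P.real {ω | √(48 * hi ^ 2 / a₀) * (√(Real.log ((k : ℝ) + 1)) * ((k : ℝ) + 1) ^ (-β / 2)) <
      |linearNoise Γ Z d β a₀ hi (k / 2) j ω|} ≤ 2 / ((k : ℝ) + 1) ^ 3 := by
  have hT : (0 : ℝ) < (k : ℝ) + 1 := by positivity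
  have hβ := h.β_mem
  have hu := rpow_step_pos β k
  have hv0 : 0 < 8 * hi ^ 2 / a₀ * ((k : ℝ) + 1) ^ (-β) := by positivity
  have hsub := h.hasSubgaussianMGF_linearNoise hhi ha₀ ha1
    (v := ⟨8 * hi ^ 2 / a₀ * ((k : ℝ) + 1) ^ (-β), hv0.le⟩) (by
      have := half_window_rpow_le hβ.1.le hβ.2.le (le_refl (k / 2))
      change _ ≤ a₀ * (8 * hi ^ 2 / a₀ * ((k : ℝ) + 1) ^ (-β))
      rw [← mul_assoc, mul_div_cancel₀ _ ha₀.ne']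
      nlinarith [sq_nonneg hi]) j
  refine (HasSubgaussianMGF.measure_abs_gt_le hsub (by positivity)).trans (le_of_eq ?_)
  have e : -(√(48 * hi ^ 2 / a₀) * (√(Real.log ((k : ℝ) + 1)) * ((k : ℝ) + 1) ^ (-β / 2))) ^ 2 /
      (2 * (8 * hi ^ 2 / a₀ * ((k : ℝ) + 1) ^ (-β))) = -(3 * Real.log ((k : ℝ) + 1)) := by
    rw [mul_pow, mul_pow, Real.sq_sqrt (by positivity), Real.sq_sqrt (by linarith),
      ← Real.rpow_natCast (((k : ℝ) + 1) ^ (-β / 2)) 2, ← Real.rpow_mul hT.le]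
    have : -β / 2 * ((2 : ℕ) : ℝ) = -β := by push_cast; ring
    rw [this]
    field_simp
    norm_num
  change 2 * Real.exp (_ / (2 * (8 * hi ^ 2 / a₀ * ((k : ℝ) + 1) ^ (-β)))) = _
  rw [e, Real.exp_neg, show 3 * Real.log ((k : ℝ) + 1) = ((3 : ℕ) : ℝ) * Real.log ((k : ℝ) + 1) by
    norm_num, Real.exp_nat_mul, Real.exp_log hT]
  rfl

/-- High-probability rate of a perturbed Robbins–Monro recursion. -/
theorem exists_rate_in_probability (h : IsRobbinsMonro P 𝓕 D Γ Z d b β B B' κ K r lo c)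
    (hhi : 0 < hi) {C : ℝ} (hC : 0 ≤ C) {v : ℕ → ℝ} (hv0 : ∀ k, 0 ≤ v k)
    {Cv : ℝ} (hCv : 1 ≤ Cv)
    (hv : ∀ᶠ k in atTop, ∀ j, k / 2 ≤ j → j ≤ k → v j ≤ Cv * v k)
    (hΓ : ∀ᶠ k : ℕ in atTop,
      P.real {ω | hi * ((k : ℝ) + 1) ^ (-β) < Γ k ω} ≤ C / ((k : ℝ) + 1) ^ 3)
    (hb : ∀ᶠ k : ℕ in atTop, P.real {ω | v k < |b k ω|} ≤ C / ((k : ℝ) + 1) ^ 3) :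
    ∃ C' > 0, ∀ᶠ k : ℕ in atTop, 1 - 1 / ((k : ℝ) + 1) ≤
      P.real {ω | |D k ω| ≤
          C' * (√(Real.log ((k : ℝ) + 1)) * ((k : ℝ) + 1) ^ (-β / 2) + v k) ∧
        |b k ω| ≤ v k} := by
  have hβ := h.β_mem
  have ha₀ := h.gain_pos
  have hκ := h.slope_pos
  have hlo := h.lo_pos
  have hB := h.B_pos
  set a₀ := κ * r * lo with ha₀def
  set C₃ := √(48 * hi ^ 2 / a₀) with hC₃
  have hC₃0 : 0 ≤ C₃ := Real.sqrt_nonneg _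
  -- The terms pay, in order, for the forgotten initial value, the linear noise counted twice and
  -- the bias; the final 1 is slack.
  refine ⟨B + 2 * C₃ + hi / (κ * lo) * Cv + 1, by positivity, ?_⟩
  filter_upwards [eventually_of_half_window hΓ, eventually_of_half_window hb, hv,
    eventually_of_half_window (eventually_mul_rpow_neg_le_one hβ.1 a₀),
    eventually_of_half_window (eventually_mul_rpow_neg_le_one hβ.1 (hi * r * K)),
    eventually_one_le_log, eventually_exp_neg_rpow_le (sub_pos.2 hβ.2) (by positivity : 0 < a₀ / 4) 1,
    eventually_ge_atTop 1, tendsto_natCast_add_one.eventually_ge_atTop (16 * C + 2)]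
    with k hΓk hbk hvk ha1 hg1 hlog hexp hk1 hkC
  have hT : (0 : ℝ) < (k : ℝ) + 1 := by positivity
  set T : ℝ := (k : ℝ) + 1 with hTdef
  set ε := C₃ * (√(Real.log T) * T ^ (-β / 2)) with hε
  have hε0 : 0 ≤ ε := by positivity
  set m := k / 2 with hm
  -- the exceptional event
  set bad : ℕ → Set Ω := fun j =>
    ({ω | hi * ((j : ℝ) + 1) ^ (-β) < Γ j ω} ∪ {ω | v j < |b j ω|}) ∪
      {ω | ε < |linearNoise Γ Z d β a₀ hi m (j - m) ω|} with hbad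
  have hbadP : ∀ j ∈ Finset.Icc m k, P.real (bad j) ≤ (16 * C + 2) / T ^ 3 := by
    intro j hj
    rw [Finset.mem_Icc] at hj
    have h1 := (hΓk j hj.1).trans (half_window_inv_cube_le hC hj.1)
    have h2 := (hbk j hj.1).trans (half_window_inv_cube_le hC hj.1)
    have h3 := h.measure_linearNoise_gt_le hhi ha₀ hlog (ha1 m le_rfl) (j - m)
    have h4 : (16 * C + 2) / T ^ 3 = 8 * C / T ^ 3 + 8 * C / T ^ 3 + 2 / T ^ 3 := by ring
    rw [h4]
    exact (measureReal_union_le _ _).trans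
      (add_le_add ((measureReal_union_le _ _).trans (add_le_add h1 h2)) h3)
  have hU : P.real (⋃ j ∈ Finset.Icc m k, bad j) ≤ 1 / T := by
    calc P.real (⋃ j ∈ Finset.Icc m k, bad j) ≤ ∑ j ∈ Finset.Icc m k, P.real (bad j) :=
          measureReal_biUnion_finset_le _ _
      _ ≤ ∑ _j ∈ Finset.Icc m k, (16 * C + 2) / T ^ 3 := Finset.sum_le_sum hbadP
      _ = ((Finset.Icc m k).card : ℝ) * ((16 * C + 2) / T ^ 3) := by
          rw [Finset.sum_const, nsmul_eq_mul]
      -- At most `T` indices occur, and `16 C + 2 ≤ T` eventually. The 16 is 8 for the steps plus 8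
      -- for the bias, from replacing `j ^ (-3)` by `k ^ (-3)` on the window.
      _ ≤ T * (T / T ^ 3) := by
          gcongr
          rw [Nat.card_Icc]
          have : k + 1 - m ≤ k + 1 := by omega
          rw [hTdef]
          exact_mod_cast this
      _ = 1 / T := by field_simp
  have hmeas : MeasurableSet (⋃ j ∈ Finset.Icc m k, bad j) := by
    refine Finset.measurableSet_biUnion _ fun j _ => ?_
    obtain ⟨_, hΓm, _, _, hbm⟩ := h.measurable₀ j
    have hN : Measurable (linearNoise Γ Z d β a₀ hi m (j - m)) :=
      (h.measurable_linearNoise a₀ m (j - m)).mono (h.le _) le_rfl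
    exact ((measurableSet_lt measurable_const hΓm).union
      (measurableSet_lt measurable_const hbm.abs)).union
        (measurableSet_lt measurable_const hN.abs)
  have hcompl := probReal_compl_eq_one_sub (μ := P) hmeas
  have hsub : (⋃ j ∈ Finset.Icc m k, bad j)ᶜ ⊆ {ω | |D k ω| ≤
      (B + 2 * C₃ + hi / (κ * lo) * Cv + 1) * (√(Real.log T) * T ^ (-β / 2) + v k) ∧
        |b k ω| ≤ v k} := by
    intro ω hω
    have hgood : ∀ j, m ≤ j → j ≤ k → Γ j ω ≤ hi * ((j : ℝ) + 1) ^ (-β) ∧ |b j ω| ≤ v j ∧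
        |linearNoise Γ Z d β a₀ hi m (j - m) ω| ≤ ε := by
      intro j h1 h2
      have hnot : ω ∉ bad j := fun hmem => hω (Set.mem_biUnion (Finset.mem_Icc.2 ⟨h1, h2⟩) hmem)
      simp only [hbad, Set.mem_union, Set.mem_ofPred_eq, not_or, not_lt] at hnot
      exact ⟨hnot.1.1, hnot.1.2, hnot.2⟩
    have hmk : m + (k - m) = k := by omega
    refine ⟨?_, (hgood k (by omega) le_rfl).2.1⟩
    have hwin := h.abs_D_le_of_window (m := m) (n := k - m) (ω := ω) hhi hε0
      (mul_nonneg (by linarith) (hv0 k) : 0 ≤ Cv * v k) (ha1 m le_rfl) (hg1 m le_rfl)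
      (fun j hj => (hgood (m + j) (by omega) (by omega)).1)
      (fun j hj => (hgood (m + j) (by omega) (by omega)).2.1.trans
        (hvk _ (by omega) (by omega)))
      (fun j hj => by
        have := (hgood (m + j) (by omega) (by omega)).2.2
        rwa [Nat.add_sub_cancel_left] at this)
    rw [hmk] at hwin
    have hprod := (prod_one_sub_le_exp ha₀ hβ.1.le hk1 (ha1 m le_rfl)).trans hexp
    have h1T : (1 : ℝ) ≤ T := by
      rw [hTdef]; linarith [(Nat.cast_nonneg k : (0 : ℝ) ≤ k)]
    have h3 : T ^ (-(1 : ℝ)) ≤ √(Real.log T) * T ^ (-β / 2) := by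
      calc T ^ (-(1 : ℝ)) ≤ T ^ (-β / 2) :=
            Real.rpow_le_rpow_of_exponent_le h1T (by linarith [hβ.2])
        _ ≤ √(Real.log T) * T ^ (-β / 2) :=
            le_mul_of_one_le_left (by positivity) (Real.one_le_sqrt.2 hlog)
    have h4 := mul_le_mul_of_nonneg_right (hprod.trans h3) hB.le
    have hv0k := hv0 k
    set R := √(Real.log T) * T ^ (-β / 2) with hR
    have hR0 : 0 ≤ R := by positivity
    have hq : 0 ≤ hi / (κ * lo) := by positivity
    have h5 : 0 ≤ hi / (κ * lo) * Cv * R := by positivity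
    have h6 : 0 ≤ C₃ * v k := by positivity
    have h7 : 0 ≤ B * v k := by positivity
    calc |D k ω| ≤ R * B + 2 * ε + hi / (κ * lo) * (Cv * v k) := by linarith
      _ ≤ (B + 2 * C₃ + hi / (κ * lo) * Cv + 1) * (R + v k) := by
          rw [hε]; linarith
  have := measureReal_mono (μ := P) hsub
  linarith

/-- One step of the mean-square recursion. -/
theorem integral_sq_succ_le (h : IsRobbinsMonro P 𝓕 D Γ Z d b β B B' κ K r lo c) (hhi : 0 < hi)
    (k : ℕ) :
    ∫ ω, D (k + 1) ω ^ 2 ∂P ≤ (1 - 2 * (κ * r * lo * ((k : ℝ) + 1) ^ (-β))) * ∫ ω, D k ω ^ 2 ∂P +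
      2 * B * r * (hi * ((k : ℝ) + 1) ^ (-β)) * ∫ ω, |b k ω| ∂P +
      (hi * ((k : ℝ) + 1) ^ (-β)) ^ 2 +
      (2 * B * r * c * B' + c ^ 2) * P.real {ω | hi * ((k : ℝ) + 1) ^ (-β) < Γ k ω} := by
  obtain ⟨hDm, hΓm, hZm, hdm, hbm⟩ := h.measurable₀ k
  have hu := rpow_step_pos β k
  have hκ := h.slope_pos
  have hr := h.rate_pos
  have hB := h.B_pos
  have hlo := h.lo_pos
  set u := ((k : ℝ) + 1) ^ (-β)
  have hΓ0 := h.step_nonneg k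
  have hΓc := h.step_le k
  have hΓabs : ∀ ω, |Γ k ω| ≤ c := fun ω => by rw [abs_of_nonneg (hΓ0 ω)]; exact hΓc ω
  have hWb : ∀ ω, |Γ k ω * D k ω| ≤ c * B := fun ω => by
    rw [abs_mul]
    exact mul_le_mul (hΓabs ω) (h.abs_D_le k ω) (abs_nonneg _) ((abs_nonneg _).trans (hΓabs ω))
  -- The weight `Γ D` is past-measurable and bounded, so `Z` may be replaced by its conditional mean
  -- in the cross term of the square.
  have hcm := h.condMean k (fun ω => Γ k ω * D k ω)
    ((h.measurable_step k).mul (h.measurable_D k)) ⟨_, hWb⟩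
  set bad := {ω | hi * u < Γ k ω} with hbad
  have hbadm : MeasurableSet bad := measurableSet_lt measurable_const hΓm
  have hD2 : ∀ ω, |D k ω ^ 2| ≤ B ^ 2 := fun ω => by
    rw [abs_pow]; exact pow_le_pow_left₀ (abs_nonneg _) (h.abs_D_le k ω) 2
  have iD2 : Integrable (fun ω => D k ω ^ 2) P :=
    Integrable.of_bound (by fun_prop) (B ^ 2) (ae_of_all _ hD2)
  have ib : Integrable (fun ω => |b k ω|) P :=
    Integrable.of_bound (by fun_prop) B' (ae_of_all _ fun ω => by
      rw [Real.norm_eq_abs, abs_abs]; exact h.abs_bias_le k ω)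
  have iWZ : Integrable (fun ω => Γ k ω * D k ω * Z k ω) P :=
    Integrable.of_bound (by fun_prop) (c * B * 1) (ae_of_all _ fun ω => by
      rw [Real.norm_eq_abs, abs_mul]
      exact mul_le_mul (hWb ω) (h.abs_Z_le k ω) (abs_nonneg _) ((abs_nonneg _).trans (hWb ω)))
  have iWd : Integrable (fun ω => Γ k ω * D k ω * d k ω) P :=
    Integrable.of_bound (by fun_prop) (c * B * 1) (ae_of_all _ fun ω => by
      rw [Real.norm_eq_abs, abs_mul]
      exact mul_le_mul (hWb ω) (h.abs_drift_le k ω) (abs_nonneg _)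
        ((abs_nonneg _).trans (hWb ω)))
  have iΓZ : Integrable (fun ω => (Γ k ω * Z k ω) ^ 2) P :=
    Integrable.of_bound (by fun_prop) ((c * 1) ^ 2) (ae_of_all _ fun ω => by
      rw [Real.norm_eq_abs, abs_pow, abs_mul]
      exact pow_le_pow_left₀ (by positivity) (mul_le_mul (hΓabs ω) (h.abs_Z_le k ω)
        (abs_nonneg _) ((abs_nonneg _).trans (hΓabs ω))) 2)
  have ibad : Integrable (bad.indicator (1 : Ω → ℝ)) P :=
    (integrable_const (1 : ℝ)).indicator hbadm
  have hexp : ∫ ω, D (k + 1) ω ^ 2 ∂P =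
      ∫ ω, (D k ω ^ 2 + 2 * (Γ k ω * D k ω * d k ω) + (Γ k ω * Z k ω) ^ 2) ∂P := by
    have e : ∀ ω, D (k + 1) ω ^ 2 =
        D k ω ^ 2 + 2 * (Γ k ω * D k ω * Z k ω) + (Γ k ω * Z k ω) ^ 2 := fun ω => by
      rw [h.recursion]; ring
    simp_rw [e]
    have j1 : Integrable (fun ω => D k ω ^ 2 + 2 * (Γ k ω * D k ω * Z k ω)) P :=
      iD2.add (iWZ.const_mul 2)
    have j2 : Integrable (fun ω => D k ω ^ 2 + 2 * (Γ k ω * D k ω * d k ω)) P :=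
      iD2.add (iWd.const_mul 2)
    rw [integral_add j1 iΓZ, integral_add iD2 (iWZ.const_mul 2),
      integral_add j2 iΓZ, integral_add iD2 (iWd.const_mul 2),
      integral_const_mul, integral_const_mul, hcm]
  -- The negative quadratic term uses the lower bound on the step everywhere. The bias and noise
  -- terms need the upper bound `hi * u`; where it fails, the crude constants `c` and `B'` are paid
  -- on the exceptional event.
  have hpt : ∀ ω, D k ω ^ 2 + 2 * (Γ k ω * D k ω * d k ω) + (Γ k ω * Z k ω) ^ 2 ≤
      (1 - 2 * (κ * r * lo * u)) * D k ω ^ 2 + 2 * B * r * (hi * u) * |b k ω| + (hi * u) ^ 2 +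
        (2 * B * r * c * B' + c ^ 2) * bad.indicator 1 ω := by
    intro ω
    obtain ⟨s, hs, hds⟩ := h.drift_eq k ω
    have hD := h.abs_D_le k ω
    have hbB := h.abs_bias_le k ω
    have hloω := h.le_step k ω
    have hc0 : 0 ≤ c := (hΓ0 ω).trans (hΓc ω)
    have hB'0 : 0 ≤ B' := (abs_nonneg _).trans hbB
    have h1 : κ * r * lo * u * D k ω ^ 2 ≤ Γ k ω * r * s * D k ω ^ 2 := by
      refine mul_le_mul_of_nonneg_right ?_ (sq_nonneg _)
      calc κ * r * lo * u = lo * u * r * κ := by ring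
        _ ≤ Γ k ω * r * s := by
          have := hs.1
          have := hΓ0 ω
          gcongr
    have h2 : D k ω * b k ω ≤ B * |b k ω| := by
      refine (le_abs_self _).trans ?_
      rw [abs_mul]; exact mul_le_mul_of_nonneg_right hD (abs_nonneg _)
    have h3 : Γ k ω * r * (D k ω * b k ω) ≤ Γ k ω * r * (B * |b k ω|) :=
      mul_le_mul_of_nonneg_left h2 (mul_nonneg (hΓ0 ω) hr.le)
    have h4 : (Γ k ω * Z k ω) ^ 2 ≤ Γ k ω ^ 2 := by
      rw [mul_pow]
      have : Z k ω ^ 2 ≤ 1 := by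
        rw [← sq_abs]; exact pow_le_one₀ (abs_nonneg _) (h.abs_Z_le k ω)
      exact mul_le_of_le_one_right (sq_nonneg _) this
    have e : Γ k ω * D k ω * d k ω =
        -(Γ k ω * r * s * D k ω ^ 2) + Γ k ω * r * (D k ω * b k ω) := by rw [hds]; ring
    have h5 : 2 * (Γ k ω * r * (B * |b k ω|)) + Γ k ω ^ 2 ≤
        2 * B * r * (hi * u) * |b k ω| + (hi * u) ^ 2 +
        (2 * B * r * c * B' + c ^ 2) * bad.indicator 1 ω := by
      by_cases hω : ω ∈ bad
      · rw [Set.indicator_of_mem hω, Pi.one_apply, mul_one]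
        have h6 : Γ k ω * r * (B * |b k ω|) ≤ c * r * (B * B') := by
          have := hΓc ω
          gcongr
        have h7 : Γ k ω ^ 2 ≤ c ^ 2 := pow_le_pow_left₀ (hΓ0 ω) (hΓc ω) 2
        have h8 : 0 ≤ 2 * B * r * (hi * u) * |b k ω| + (hi * u) ^ 2 := by positivity
        linarith
      · rw [Set.indicator_of_notMem hω, mul_zero, add_zero]
        have hle : Γ k ω ≤ hi * u := not_lt.1 hω
        have h6 : Γ k ω * r * (B * |b k ω|) ≤ hi * u * r * (B * |b k ω|) := by gcongr
        have h7 : Γ k ω ^ 2 ≤ (hi * u) ^ 2 := pow_le_pow_left₀ (hΓ0 ω) hle 2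
        linarith
    rw [e]
    linarith
  rw [hexp]
  have j1 : Integrable (fun ω => (1 - 2 * (κ * r * lo * u)) * D k ω ^ 2 +
      2 * B * r * (hi * u) * |b k ω|) P := (iD2.const_mul _).add (ib.const_mul _)
  have j2 : Integrable (fun ω => (1 - 2 * (κ * r * lo * u)) * D k ω ^ 2 +
      2 * B * r * (hi * u) * |b k ω| + (hi * u) ^ 2) P := j1.add (integrable_const _)
  have j3 : Integrable (fun ω => (1 - 2 * (κ * r * lo * u)) * D k ω ^ 2 +
      2 * B * r * (hi * u) * |b k ω| + (hi * u) ^ 2 +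
        (2 * B * r * c * B' + c ^ 2) * bad.indicator 1 ω) P := j2.add (ibad.const_mul _)
  refine (integral_mono ((iD2.add (iWd.const_mul 2)).add iΓZ) j3 hpt).trans (le_of_eq ?_)
  rw [integral_add j2 (ibad.const_mul _), integral_add j1 (integrable_const _),
    integral_add (iD2.const_mul _) (ib.const_mul _), integral_const_mul, integral_const_mul,
    integral_const_mul, integral_indicator_one hbadm, integral_const, probReal_univ, one_smul]

end IsRobbinsMonro

/-- Induction on `e ≤ C' v`: of the contraction `2 w`, one half absorbs the forcing `C w v` and the
other half the decrease of `v`, since `(1 - 2 w) C' v + C' w v = C' (1 - w) v ≤ C' v (k + 1)`. -/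
theorem exists_le_mul_of_recursion {e v w : ℕ → ℝ} {C : ℝ}
    (hv : ∀ᶠ k in atTop, 0 < v k) (hw0 : ∀ᶠ k in atTop, 0 ≤ w k)
    (hw1 : ∀ᶠ k in atTop, 2 * w k ≤ 1)
    (hvw : ∀ᶠ k in atTop, (1 - w k) * v k ≤ v (k + 1))
    (he : ∀ᶠ k in atTop, e (k + 1) ≤ (1 - 2 * w k) * e k + C * (w k * v k)) :
    ∃ C' > 0, ∀ᶠ k in atTop, e k ≤ C' * v k := by
  obtain ⟨k₀, hk₀⟩ := eventually_atTop.1 (hv.and (hw0.and (hw1.and (hvw.and he))))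
  have hv0 := (hk₀ k₀ le_rfl).1
  refine ⟨max (max C 1) (e k₀ / v k₀), lt_max_of_lt_left (lt_max_of_lt_right one_pos),
    eventually_atTop.2 ⟨k₀, fun k hk => ?_⟩⟩
  set C' := max (max C 1) (e k₀ / v k₀)
  have hC : C ≤ C' := (le_max_left _ _).trans (le_max_left _ _)
  have hC0 : 0 ≤ C' := zero_le_one.trans ((le_max_right _ _).trans (le_max_left _ _))
  induction k, hk using Nat.le_induction with
  | base => rw [← div_le_iff₀ hv0]; exact le_max_right _ _
  | succ k hk ih =>
    obtain ⟨h1, h2, h3, h4, h5⟩ := hk₀ k hk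
    have h6 := mul_le_mul_of_nonneg_left ih (by linarith : 0 ≤ 1 - 2 * w k)
    have h7 := mul_le_mul_of_nonneg_right hC (mul_nonneg h2 h1.le)
    have h8 := mul_le_mul_of_nonneg_left h4 hC0
    linarith

/-! ### Mean-square rate. -/

namespace IsRobbinsMonro

variable {Ω : Type*} [m₀ : MeasurableSpace Ω] {P : Measure Ω} [IsProbabilityMeasure P]
  {𝓕 : ℕ → MeasurableSpace Ω} {D Γ Z d b : ℕ → Ω → ℝ} {β B B' κ K r lo c hi : ℝ}

/-- Mean-square rate of a perturbed Robbins–Monro recursion. -/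
theorem exists_rate_in_mean (h : IsRobbinsMonro P 𝓕 D Γ Z d b β B B' κ K r lo c)
    (hhi : 0 < hi) {C : ℝ} (hC : 0 ≤ C) {v : ℕ → ℝ} (hv0 : ∀ᶠ k in atTop, 0 < v k)
    (hv : ∀ a > 0, ∀ᶠ k : ℕ in atTop, (1 - a * ((k : ℝ) + 1) ^ (-β)) * v k ≤ v (k + 1))
    (huv : ∀ᶠ k : ℕ in atTop, ((k : ℝ) + 1) ^ (-β) ≤ v k)
    (huv' : ∀ᶠ k : ℕ in atTop, 1 / ((k : ℝ) + 1) ^ 3 ≤ ((k : ℝ) + 1) ^ (-β) * v k)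
    (hΓ : ∀ᶠ k : ℕ in atTop,
      P.real {ω | hi * ((k : ℝ) + 1) ^ (-β) < Γ k ω} ≤ C / ((k : ℝ) + 1) ^ 3)
    (hb : ∀ᶠ k : ℕ in atTop, ∫ ω, |b k ω| ∂P ≤ C * v k) :
    ∃ C' > 0, ∀ᶠ k : ℕ in atTop, ∫ ω, D k ω ^ 2 ∂P ≤ C' * v k := by
  have ha₀ := h.gain_pos
  have hβ := h.β_mem
  have hr := h.rate_pos
  have hB := h.B_pos
  have hB' : ∀ ω, 0 ≤ B' := fun ω => (abs_nonneg _).trans (h.abs_bias_le 0 ω)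
  have hc : ∀ ω, 0 ≤ c := fun ω => (h.step_nonneg 0 ω).trans (h.step_le 0 ω)
  obtain ⟨ω₀⟩ : Nonempty Ω := P.nonempty_of_neZero
  have hB' := hB' ω₀
  have hc := hc ω₀
  set a₀ := κ * r * lo
  -- `A` collects the three forcing terms, each of order `u * v`: the mean bias, the squared step
  -- (through `u ≤ v`) and the probability of a large step.
  set A := 2 * B * r * hi * C + hi ^ 2 + (2 * B * r * c * B' + c ^ 2) * C with hA
  refine exists_le_mul_of_recursion (w := fun k : ℕ => a₀ * ((k : ℝ) + 1) ^ (-β))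
    (C := A / a₀) hv0 (Eventually.of_forall fun k => (mul_pos ha₀ (rpow_step_pos β k)).le) ?_
    (hv a₀ ha₀) ?_
  · filter_upwards [eventually_mul_rpow_neg_le_one hβ.1 (2 * a₀)] with k hk
    linarith
  · filter_upwards [huv, huv', hΓ, hb, hv0] with k h1 h2 h3 h4 h5
    refine (h.integral_sq_succ_le hhi k).trans ?_
    have hu := rpow_step_pos β k
    set u := ((k : ℝ) + 1) ^ (-β)
    have e : A / a₀ * (a₀ * u * v k) = A * (u * v k) := by field_simp
    rw [e]
    have g1 : 2 * B * r * (hi * u) * ∫ ω, |b k ω| ∂P ≤ 2 * B * r * (hi * u) * (C * v k) := by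
      gcongr
    have g2 : (hi * u) ^ 2 ≤ hi ^ 2 * (u * v k) := by
      rw [mul_pow, sq u]; gcongr
    have g3 : P.real {ω | hi * u < Γ k ω} ≤ C * (u * v k) := by
      refine h3.trans ?_
      rw [div_eq_mul_one_div]
      gcongr
    have g4 : (2 * B * r * c * B' + c ^ 2) * P.real {ω | hi * u < Γ k ω} ≤
        (2 * B * r * c * B' + c ^ 2) * (C * (u * v k)) := by gcongr
    have : A * (u * v k) = 2 * B * r * (hi * u) * (C * v k) + hi ^ 2 * (u * v k) +
        (2 * B * r * c * B' + c ^ 2) * (C * (u * v k)) := by rw [hA]; ring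
    linarith

end IsRobbinsMonro

/-! ### Reaction function -/

theorem covErr_mem_Icc (y : ℝ) (C : Set ℝ) : covErr y C ∈ Set.Icc (0 : ℝ) 1 := by
  unfold covErr; split_ifs <;> simp

theorem react_mem_Icc (y : ℝ) (C : Set ℝ) (q : ℝ) : react y C q ∈ Set.Icc (0 : ℝ) 1 := by
  unfold react
  split_ifs
  · exact covErr_mem_Icc y C
  · simp

theorem covErr_predInterval (y m s q : ℝ) : covErr y (predInterval m s q) =
    if q ≤ 0 then (if y = m then 0 else 1) else if 1 ≤ q then 0 else
      if m - s * halfWidth q ≤ y ∧ y ≤ m + s * halfWidth q then 0 else 1 := by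
  unfold covErr predInterval
  by_cases h0 : q ≤ 0
  · simp [h0]
  by_cases h1 : 1 ≤ q
  · simp [h0, h1]
  · have hw : halfWidth q = normalQuantile ((q + 1) / 2) :=
      if_pos ⟨not_le.1 h0, not_le.1 h1⟩
    simp only [if_neg h0, if_neg h1, hw, Set.mem_Icc]

theorem Measurable.covErr_predInterval {Ω : Type*} {m₀ : MeasurableSpace Ω} {y m s q : Ω → ℝ}
    (hy : Measurable y) (hm : Measurable m) (hs : Measurable s) (hq : Measurable q) :
    Measurable fun ω => covErr (y ω) (predInterval (m ω) (s ω) (q ω)) := by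
  simp_rw [OnlineSCI.covErr_predInterval]
  have hw : Measurable fun ω => halfWidth (q ω) := measurable_halfWidth.comp hq
  refine Measurable.ite (measurableSet_le hq measurable_const)
    (Measurable.ite (measurableSet_eq_fun hy hm) measurable_const measurable_const)
    (Measurable.ite (measurableSet_le measurable_const hq) measurable_const
      (Measurable.ite ?_ measurable_const measurable_const))
  exact (measurableSet_le (hm.sub (hs.mul hw)) hy).inter
    (measurableSet_le hy (hm.add (hs.mul hw)))

theorem Measurable.react_predInterval {Ω : Type*} {m₀ : MeasurableSpace Ω} {y m s q : Ω → ℝ}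
    (hy : Measurable y) (hm : Measurable m) (hs : Measurable s) (hq : Measurable q) :
    Measurable fun ω => react (y ω) (predInterval (m ω) (s ω) (q ω)) (q ω) := by
  unfold react
  exact Measurable.ite (measurableSet_le measurable_const hq)
    (Measurable.covErr_predInterval hy hm hs hq) measurable_const

/-- The two differ only for `q < 0`, where the prediction set is one point and is missed almost
surely. Hence the recursion and the instantaneous error rate have the same conditional error. -/
theorem ae_covErr_eq_react {ν : Measure ℝ} {f : ℝ → ℝ}
    (hν : ν = volume.withDensity fun x => ENNReal.ofReal (f x)) (m₀ m s q : ℝ) {s₀ : ℝ}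
    (hs₀ : 0 < s₀) :
    (fun e => covErr (m₀ + s₀ * e) (predInterval m s q)) =ᵐ[ν]
      fun e => react (m₀ + s₀ * e) (predInterval m s q) q := by
  have hat : ∀ x, ν {x} = 0 := fun x => by
    rw [hν]; exact (withDensity_absolutelyContinuous _ _) (by simp)
  have h1 : ∀ᵐ e ∂ν, e ≠ (m - m₀) / s₀ := by
    rw [ae_iff]; simp [hat]
  filter_upwards [h1] with e he
  rw [react]
  split_ifs with h
  · rfl
  · push Not at h
    rw [covErr, predInterval, if_pos h.le, if_neg]
    rw [Set.mem_singleton_iff]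
    intro h'
    apply he
    rw [eq_div_iff hs₀.ne']; linarith

/-! ### The state of the recursion -/

section State

variable {Ω 𝒳 : Type*} (α β c q₁ : ℝ) (S : 𝒳 → Bool) (X : ℕ → Ω → 𝒳) (Y : ℕ → Ω → ℝ)
  (μhat σhat : ℕ → Ω → 𝒳 → ℝ)

/-- Threshold and counter used for the prediction at time `k + 1`. -/
noncomputable def nextState (k : ℕ) (ω : Ω) : ℝ × ℕ :=
  sciState α (fun j => c * (j : ℝ) ^ (-β)) q₁ (fun _ x _ => S x)
    (fun k x z => predInterval (μhat k ω x) (σhat k ω x) z) (fun k => X k ω) (fun k => Y k ω) (k + 1)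

/-- The step size at time `k + 1`. -/
noncomputable def stepSize (k : ℕ) (ω : Ω) : ℝ :=
  c * ((nextState α β c q₁ S X Y μhat σhat k ω).2 : ℝ) ^ (-β)

/-- The increment at time `k + 1`, before scaling by the step size. -/
noncomputable def increment (k : ℕ) (ω : Ω) : ℝ :=
  (react (Y (k + 1) ω) (predInterval (μhat (k + 1) ω (X (k + 1) ω)) (σhat (k + 1) ω (X (k + 1) ω))
    (nextState α β c q₁ S X Y μhat σhat k ω).1) (nextState α β c q₁ S X Y μhat σhat k ω).1 - α) *
      ((S (X (k + 1) ω)).toNat : ℝ)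

theorem nextState_succ_fst (k : ℕ) (ω : Ω) :
    (nextState α β c q₁ S X Y μhat σhat (k + 1) ω).1 =
      (nextState α β c q₁ S X Y μhat σhat k ω).1 +
        stepSize α β c q₁ S X Y μhat σhat k ω * increment α β c q₁ S X Y μhat σhat k ω := by
  rw [increment, ← mul_assoc]
  rfl

theorem nextState_succ_snd (k : ℕ) (ω : Ω) :
    (nextState α β c q₁ S X Y μhat σhat (k + 1) ω).2 =
      (nextState α β c q₁ S X Y μhat σhat k ω).2 + (S (X (k + 1) ω)).toNat := rfl

theorem nextState_snd_eq (k : ℕ) (ω : Ω) :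
    (nextState α β c q₁ S X Y μhat σhat k ω).2 =
      1 + ∑ i ∈ Finset.range k, (S (X (i + 1) ω)).toNat := by
  induction k with
  | zero => rfl
  | succ k ih => rw [nextState_succ_snd, ih, Finset.sum_range_succ]; ring

theorem one_le_nextState_snd (k : ℕ) (ω : Ω) :
    1 ≤ (nextState α β c q₁ S X Y μhat σhat k ω).2 := by
  rw [nextState_snd_eq]; omega

theorem nextState_snd_le (k : ℕ) (ω : Ω) :
    (nextState α β c q₁ S X Y μhat σhat k ω).2 ≤ k + 1 := by
  induction k with
  | zero => exact le_rfl
  | succ k ih => rw [nextState_succ_snd]; have := Bool.toNat_le (S (X (k + 1) ω)); omega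

variable {α β c q₁}

theorem toNat_mem_Icc (b : Bool) : (b.toNat : ℝ) ∈ Set.Icc (0 : ℝ) 1 := by
  cases b <;> simp

theorem abs_increment_le_one (hα : α ∈ Set.Ioo (0 : ℝ) 1) (k : ℕ) (ω : Ω) :
    |increment α β c q₁ S X Y μhat σhat k ω| ≤ 1 := by
  rw [increment, abs_mul]
  have h1 := react_mem_Icc (Y (k + 1) ω) (predInterval (μhat (k + 1) ω (X (k + 1) ω))
    (σhat (k + 1) ω (X (k + 1) ω)) (nextState α β c q₁ S X Y μhat σhat k ω).1)
    (nextState α β c q₁ S X Y μhat σhat k ω).1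
  have h2 := toNat_mem_Icc (S (X (k + 1) ω))
  rw [abs_of_nonneg h2.1]
  exact mul_le_one₀ (abs_le.2 ⟨by linarith [h1.1, hα.2], by linarith [h1.2, hα.1]⟩) h2.1 h2.2

theorem stepSize_le (hβ : 0 < β) (hc : 0 < c) (k : ℕ) (ω : Ω) :
    stepSize α β c q₁ S X Y μhat σhat k ω ≤ c := by
  refine mul_le_of_le_one_right hc.le (Real.rpow_le_one_of_one_le_of_nonpos ?_ (by linarith))
  exact_mod_cast one_le_nextState_snd α β c q₁ S X Y μhat σhat k ω

/-- The lower bound is deterministic, as at most one selection occurs per time; the matching upper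
bound needs concentration of the counter. -/
theorem le_stepSize (hβ : 0 < β) (hc : 0 < c) (k : ℕ) (ω : Ω) :
    c * ((k : ℝ) + 1) ^ (-β) ≤ stepSize α β c q₁ S X Y μhat σhat k ω := by
  refine mul_le_mul_of_nonneg_left (Real.rpow_le_rpow_of_nonpos ?_ ?_ (by linarith)) hc.le
  · have := one_le_nextState_snd α β c q₁ S X Y μhat σhat k ω
    positivity
  · exact_mod_cast nextState_snd_le α β c q₁ S X Y μhat σhat k ω

/-- Below 0 the reaction is 1 and the threshold cannot decrease; from 1 on, the prediction set is
the whole line and the threshold cannot increase. A single step of size at most `c` therefore bounds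
the overshoot on either side. -/
theorem nextState_fst_mem_Icc (hα : α ∈ Set.Ioo (0 : ℝ) 1) (hβ : 0 < β) (hc : 0 < c)
    (hq₁ : q₁ ∈ Set.Icc (0 : ℝ) 1) (k : ℕ) (ω : Ω) :
    (nextState α β c q₁ S X Y μhat σhat k ω).1 ∈ Set.Icc (-c) (1 + c) := by
  induction k with
  | zero => exact ⟨by change -c ≤ q₁; linarith [hq₁.1], by change q₁ ≤ 1 + c; linarith [hq₁.2]⟩
  | succ k ih =>
    rw [nextState_succ_fst]
    have hZ := abs_le.1 (abs_increment_le_one S X Y μhat σhat (β := β) (c := c) (q₁ := q₁) hα k ω)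
    have hΓ := stepSize_le S X Y μhat σhat (α := α) (q₁ := q₁) hβ hc k ω
    have hΓ0 : 0 ≤ stepSize α β c q₁ S X Y μhat σhat k ω :=
      le_trans (by positivity) (le_stepSize S X Y μhat σhat (α := α) (q₁ := q₁) hβ hc k ω)
    have hs := toNat_mem_Icc (S (X (k + 1) ω))
    have hinc : (nextState α β c q₁ S X Y μhat σhat k ω).1 < 0 →
        0 ≤ increment α β c q₁ S X Y μhat σhat k ω := fun h => by
      rw [increment, react, if_neg (not_le.2 h)]
      exact mul_nonneg (by linarith [hα.2]) hs.1
    have hdec : 1 ≤ (nextState α β c q₁ S X Y μhat σhat k ω).1 →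
        increment α β c q₁ S X Y μhat σhat k ω ≤ 0 := fun h => by
      rw [increment, react, if_pos (zero_le_one.trans h), covErr, predInterval,
        if_neg (not_le.2 (zero_lt_one.trans_le h)), if_pos h, if_pos (Set.mem_univ _)]
      exact mul_nonpos_of_nonpos_of_nonneg (by linarith [hα.1]) hs.1
    set Z := increment α β c q₁ S X Y μhat σhat k ω
    set Γ := stepSize α β c q₁ S X Y μhat σhat k ω
    set Q := (nextState α β c q₁ S X Y μhat σhat k ω).1
    have hlow : -c ≤ Γ * Z := by nlinarith
    have hupp : Γ * Z ≤ c := by nlinarith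
    by_cases h0 : Q < 0
    · have := mul_nonneg hΓ0 (hinc h0)
      exact ⟨by linarith [ih.1], by linarith⟩
    · by_cases h1 : 1 ≤ Q
      · have := mul_nonpos_of_nonneg_of_nonpos hΓ0 (hdec h1)
        exact ⟨by linarith, by linarith [ih.2]⟩
      · push Not at h0 h1
        exact ⟨by linarith, by linarith⟩

end State

/-! ### Measurability and independence in the regression model -/

/-- The hypotheses factorize the joint law as a product of three laws; reassociating the product
gives the claim. -/
theorem indepFun_prodMk_left {Ω A B C : Type*} [MeasurableSpace Ω] [MeasurableSpace A]
    [MeasurableSpace B] [MeasurableSpace C] {P : Measure Ω} [IsProbabilityMeasure P]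
    {f : Ω → A} {g : Ω → B} {h : Ω → C} (hf : Measurable f) (hg : Measurable g)
    (hh : Measurable h) (h1 : IndepFun f (fun ω => (g ω, h ω)) P) (h2 : IndepFun g h P) :
    IndepFun (fun ω => (f ω, g ω)) h P := by
  have := Measure.isProbabilityMeasure_map hf.aemeasurable (μ := P)
  have := Measure.isProbabilityMeasure_map hg.aemeasurable (μ := P)
  have := Measure.isProbabilityMeasure_map hh.aemeasurable (μ := P)
  have h3 : IndepFun f g P := h1.comp measurable_id measurable_fst
  rw [indepFun_iff_map_prod_eq_prod_map_map (by fun_prop) (by fun_prop)] at h1 h2 h3 ⊢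
  rw [h2] at h1
  rw [h3, ← (measurePreserving_prodAssoc (P.map f) (P.map g) (P.map h)).symm.map_eq, ← h1,
    Measure.map_map (by fun_prop) (by fun_prop)]
  rfl

section Model

variable {Ω 𝒳 : Type*} [MeasurableSpace 𝒳]
  {n : ℕ} {D₀ : Fin n → Ω → 𝒳 × ℝ} {X : ℕ → Ω → 𝒳} {ξ Y : ℕ → Ω → ℝ} {μ σ : 𝒳 → ℝ}

theorem past_mono : Monotone (past D₀ X Y) := fun _ _ hst =>
  sup_le_sup le_rfl (biSup_mono fun _ hk => ⟨hk.1, hk.2.trans hst⟩)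

theorem measurable_past_pair (k : ℕ) :
    Measurable[past D₀ X Y (k + 1)] fun ω => (X (k + 1) ω, Y (k + 1) ω) := by
  rw [measurable_iff_comap_le]
  refine le_trans ?_ le_sup_right
  exact le_iSup₂_of_le (k + 1) ⟨by omega, le_rfl⟩ le_rfl

variable {α β c q₁ : ℝ} {S : 𝒳 → Bool} {μhat σhat : ℕ → Ω → 𝒳 → ℝ}

theorem measurable_toNat (hS : Measurable S) : Measurable fun x => ((S x).toNat : ℝ) :=
  (measurable_from_top (f := fun b : Bool => (b.toNat : ℝ))).comp hS

theorem measurable_nextState (hS : Measurable S)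
    (hμ : IsPastMeasurable (past D₀ X Y) μhat) (hσ : IsPastMeasurable (past D₀ X Y) σhat) (k : ℕ) :
    Measurable[past D₀ X Y k] (fun ω => (nextState α β c q₁ S X Y μhat σhat k ω).1) ∧
      Measurable[past D₀ X Y k]
        (fun ω => ((nextState α β c q₁ S X Y μhat σhat k ω).2 : ℝ)) ∧
      Measurable[past D₀ X Y (k + 1)] (increment α β c q₁ S X Y μhat σhat k) := by
  have hinc : ∀ k, Measurable[past D₀ X Y k]
      (fun ω => (nextState α β c q₁ S X Y μhat σhat k ω).1) →
      Measurable[past D₀ X Y (k + 1)] (increment α β c q₁ S X Y μhat σhat k) := by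
    intro k hk
    have hle : past D₀ X Y k ≤ past D₀ X Y (k + 1) := past_mono (by omega)
    have hX : Measurable[past D₀ X Y (k + 1)] (X (k + 1)) :=
      measurable_fst.comp (measurable_past_pair k)
    have hY : Measurable[past D₀ X Y (k + 1)] (Y (k + 1)) :=
      measurable_snd.comp (measurable_past_pair k)
    have hm := measurable_comp_frozen hle hX (hμ (k + 1) (by omega))
    have hs := measurable_comp_frozen hle hX (hσ (k + 1) (by omega))
    exact ((Measurable.react_predInterval hY hm hs (hk.mono hle le_rfl)).sub_const α).mul
      ((measurable_toNat hS).comp hX)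
  suffices h : Measurable[past D₀ X Y k] (fun ω => (nextState α β c q₁ S X Y μhat σhat k ω).1) ∧
      Measurable[past D₀ X Y k]
        (fun ω => ((nextState α β c q₁ S X Y μhat σhat k ω).2 : ℝ)) from
    ⟨h.1, h.2, hinc k h.1⟩
  induction k with
  | zero => exact ⟨measurable_const (a := q₁), measurable_const (a := ((1 : ℕ) : ℝ))⟩
  | succ k ih =>
    have hle : past D₀ X Y k ≤ past D₀ X Y (k + 1) := past_mono (by omega)
    have h1 := ih.1.mono hle le_rfl
    have h2 := ih.2.mono hle le_rfl
    have h3 := hinc k ih.1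
    have hX : Measurable[past D₀ X Y (k + 1)] (X (k + 1)) :=
      measurable_fst.comp (measurable_past_pair k)
    constructor
    · simp_rw [nextState_succ_fst]
      exact h1.add (((h2.pow_const (-β)).const_mul c).mul h3)
    · simp_rw [nextState_succ_snd, Nat.cast_add]
      exact h2.add ((measurable_toNat hS).comp hX)

variable [m₀ : MeasurableSpace Ω] {P : Measure Ω}

theorem IsIIDRegression.measurable_Y (h : IsIIDRegression P D₀ X ξ Y μ σ) {t : ℕ} (ht : 1 ≤ t) :
    Measurable (Y t) := by
  have : Y t = fun ω => μ (X t ω) + σ (X t ω) * ξ t ω := funext (h.model t ht)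
  rw [this]
  exact (h.measurable_mean.comp (h.measurable_X t ht)).add
    ((h.measurable_scale.comp (h.measurable_X t ht)).mul (h.measurable_noise t ht))

theorem IsIIDRegression.past_le (h : IsIIDRegression P D₀ X ξ Y μ σ) (t : ℕ) :
    past D₀ X Y t ≤ m₀ := by
  refine sup_le (iSup_le fun i => (h.measurable_holdout i).comap_le) (iSup₂_le fun k hk => ?_)
  exact ((h.measurable_X k hk.1).prodMk (h.measurable_Y hk.1)).comap_le

theorem IsIIDRegression.measurable_pair (h : IsIIDRegression P D₀ X ξ Y μ σ) (k : ℕ) :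
    Measurable fun ω => (X (k + 1) ω, ξ (k + 1) ω) :=
  (h.measurable_X _ (by omega)).prodMk (h.measurable_noise _ (by omega))

/-- The past up to time `k` is generated by the holdout sample and the first `k` covariate–noise
pairs, because each response is a measurable function of its pair. -/
theorem IsIIDRegression.indep_past [IsProbabilityMeasure P]
    (h : IsIIDRegression P D₀ X ξ Y μ σ) (k : ℕ) :
    Indep (past D₀ X Y k)
      (MeasurableSpace.comap (fun ω => (X (k + 1) ω, ξ (k + 1) ω)) inferInstance) P := by
  set W : ℕ → Ω → 𝒳 × ℝ := fun i ω => (X (i + 1) ω, ξ (i + 1) ω) with hW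
  have hWm : ∀ i, Measurable (W i) := h.measurable_pair
  have hD : Measurable fun ω i => D₀ i ω := measurable_pi_lambda _ h.measurable_holdout
  set T : Ω → (Finset.range k → 𝒳 × ℝ) := fun ω i => W i ω with hT
  have hTm : Measurable T := measurable_pi_lambda _ fun i => hWm i
  have h1 : IndepFun T (W k) P := by
    have := h.indep.indepFun_finset (Finset.range k) {k} (by simp) hWm
    have hev : Measurable fun g : ({k} : Finset ℕ) → 𝒳 × ℝ =>
        g ⟨k, Finset.mem_singleton_self k⟩ := measurable_pi_apply _
    exact this.comp measurable_id hev
  have h2 : IndepFun (fun ω i => D₀ i ω) (fun ω => (T ω, W k ω)) P :=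
    h.indep_holdout.comp (φ := id)
      (ψ := fun g : ℕ → 𝒳 × ℝ => ((fun i : Finset.range k => g i), g k)) measurable_id
      (by fun_prop)
  have h3 := indepFun_prodMk_left hD hTm (hWm k) h2 h1
  rw [IndepFun_iff_Indep] at h3
  refine indep_of_indep_of_le_left h3 ?_
  set A : Ω → (Fin n → 𝒳 × ℝ) × (Finset.range k → 𝒳 × ℝ) := fun ω => (fun i => D₀ i ω, T ω)
  have hA : Measurable[MeasurableSpace.comap A inferInstance] A := comap_measurable A
  refine sup_le (iSup_le fun i => ?_) (iSup₂_le fun j hj => ?_)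
  · rw [← measurable_iff_comap_le]
    exact ((measurable_pi_apply i).comp measurable_fst).comp hA
  · rw [← measurable_iff_comap_le]
    obtain ⟨j, rfl⟩ : ∃ i, j = i + 1 := ⟨j - 1, by have := hj.1; omega⟩
    have hjk : j ∈ Finset.range k := Finset.mem_range.2 (by have := hj.2; omega)
    have hWj : Measurable[MeasurableSpace.comap A inferInstance] (W j) :=
      ((measurable_pi_apply (⟨j, hjk⟩ : Finset.range k)).comp measurable_snd).comp hA
    have e : (fun ω => (X (j + 1) ω, Y (j + 1) ω)) =
        (fun z : 𝒳 × ℝ => (z.1, μ z.1 + σ z.1 * z.2)) ∘ W j := by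
      funext ω
      simp only [Function.comp, hW]
      rw [h.model (j + 1) (by omega)]
    rw [e]
    have hμ := h.measurable_mean
    have hσ := h.measurable_scale
    exact Measurable.comp (by fun_prop) hWj

end Model

/-! ### Conditional drift of the threshold recursion -/

theorem measurable_section {Ω E β : Type*} {m : MeasurableSpace Ω} [mE : MeasurableSpace E]
    [MeasurableSpace β] {ψ : Ω → E → β}
    (hψ : @Measurable (Ω × E) β (@Prod.instMeasurableSpace Ω E m mE) inferInstance
      (fun p => ψ p.1 p.2)) (ω : Ω) : Measurable (ψ ω) :=
  hψ.comp measurable_prodMk_left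

section Drift

variable {Ω 𝒳 : Type*} (α : ℝ) (S : 𝒳 → Bool) (μ σ : 𝒳 → ℝ)
  (μhat σhat : ℕ → Ω → 𝒳 → ℝ) (Q : ℕ → Ω → ℝ)

/-- Selected reaction at time `k + 1`, minus its target, as a function of the past and of the new
covariate and noise. -/
noncomputable def frozenIncrement (k : ℕ) (ω : Ω) (z : 𝒳 × ℝ) : ℝ :=
  (react (μ z.1 + σ z.1 * z.2) (predInterval (μhat (k + 1) ω z.1) (σhat (k + 1) ω z.1) (Q k ω))
    (Q k ω) - α) * ((S z.1).toNat : ℝ)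

/-- Selected coverage error at time `k + 1`, as a function of the past and of the new covariate
and noise. -/
noncomputable def frozenError (k : ℕ) (ω : Ω) (z : 𝒳 × ℝ) : ℝ :=
  covErr (μ z.1 + σ z.1 * z.2)
    (predInterval (μhat (k + 1) ω z.1) (σhat (k + 1) ω z.1) (Q k ω)) * ((S z.1).toNat : ℝ)

/-- Estimation error at time `k + 1`, as a function of the past and of the new covariate. -/
noncomputable def estError (k : ℕ) (ω : Ω) (z : 𝒳 × ℝ) : ENNReal :=
  ENNReal.ofReal (|μhat (k + 1) ω z.1 - μ z.1| + |σhat (k + 1) ω z.1 - σ z.1|)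

theorem abs_frozenIncrement_le (hα : α ∈ Set.Ioo (0 : ℝ) 1) (k : ℕ) (ω : Ω) (z : 𝒳 × ℝ) :
    |frozenIncrement α S μ σ μhat σhat Q k ω z| ≤ 1 := by
  rw [frozenIncrement, abs_mul]
  have h1 := react_mem_Icc (μ z.1 + σ z.1 * z.2)
    (predInterval (μhat (k + 1) ω z.1) (σhat (k + 1) ω z.1) (Q k ω)) (Q k ω)
  have h2 := toNat_mem_Icc (S z.1)
  rw [abs_of_nonneg h2.1]
  exact mul_le_one₀ (abs_le.2 ⟨by linarith [h1.1, hα.2], by linarith [h1.2, hα.1]⟩) h2.1 h2.2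

theorem abs_frozenError_le (k : ℕ) (ω : Ω) (z : 𝒳 × ℝ) :
    |frozenError S μ σ μhat σhat Q k ω z| ≤ 1 := by
  have h1 := covErr_mem_Icc (μ z.1 + σ z.1 * z.2)
    (predInterval (μhat (k + 1) ω z.1) (σhat (k + 1) ω z.1) (Q k ω))
  have h2 := toNat_mem_Icc (S z.1)
  rw [frozenError, abs_mul, abs_of_nonneg h1.1, abs_of_nonneg h2.1]
  exact mul_le_one₀ h1.2 h2.1 h2.2

variable {α S μ σ μhat σhat Q} [MeasurableSpace 𝒳]

theorem measurable_frozen {m : MeasurableSpace Ω} {k : ℕ} (hS : Measurable S) (hμ : Measurable μ)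
    (hσ : Measurable σ)
    (hμhat : @Measurable (Ω × 𝒳) ℝ (@Prod.instMeasurableSpace Ω 𝒳 m inferInstance) inferInstance
      (fun p => μhat (k + 1) p.1 p.2))
    (hσhat : @Measurable (Ω × 𝒳) ℝ (@Prod.instMeasurableSpace Ω 𝒳 m inferInstance) inferInstance
      (fun p => σhat (k + 1) p.1 p.2))
    (hQ : Measurable (Q k)) :
    Measurable (fun p : Ω × (𝒳 × ℝ) => frozenIncrement α S μ σ μhat σhat Q k p.1 p.2) ∧
    Measurable (fun p : Ω × (𝒳 × ℝ) => frozenError S μ σ μhat σhat Q k p.1 p.2) ∧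
    Measurable (fun p : Ω × (𝒳 × ℝ) => estError μ σ μhat σhat k p.1 p.2) := by
  have h1 : Measurable fun p : Ω × (𝒳 × ℝ) => μhat (k + 1) p.1 p.2.1 :=
    hμhat.comp (measurable_fst.prodMk (measurable_fst.comp measurable_snd))
  have h2 : Measurable fun p : Ω × (𝒳 × ℝ) => σhat (k + 1) p.1 p.2.1 :=
    hσhat.comp (measurable_fst.prodMk (measurable_fst.comp measurable_snd))
  have h3 : Measurable fun p : Ω × (𝒳 × ℝ) => ((S p.2.1).toNat : ℝ) :=
    (measurable_toNat hS).comp (measurable_fst.comp measurable_snd)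
  have h4 : Measurable fun p : Ω × (𝒳 × ℝ) => Q k p.1 := hQ.comp measurable_fst
  have h5 : Measurable fun p : Ω × (𝒳 × ℝ) => μ p.2.1 + σ p.2.1 * p.2.2 := by fun_prop
  exact ⟨((Measurable.react_predInterval h5 h1 h2 h4).sub_const α).mul h3,
    (Measurable.covErr_predInterval h5 h1 h2 h4).mul h3, by unfold estError; fun_prop⟩

variable {lX : Measure 𝒳} [IsProbabilityMeasure lX] {ν : Measure ℝ} [IsProbabilityMeasure ν]
  {f : ℝ → ℝ}

theorem abs_integral_react_sub_idealError_le {M M' L : ℝ} (hM : 0 ≤ M) (hM' : 0 ≤ M')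
    (hν : ν = volume.withDensity fun x => ENNReal.ofReal (f x)) (hb : ∀ x, f x ≤ M)
    (hb' : ∀ x, |x| * f x ≤ M') (hsymm : ∀ x, f (-x) = f x)
    (m₀ s₀ m s q : ℝ) (hs₀ : 0 < s₀) (hL : 1 / s₀ ≤ L) :
    |∫ e, react (m₀ + s₀ * e) (predInterval m s q) q ∂ν - idealError ν q| ≤
      L * (2 * M + 4 * M' + 4) * (|m - m₀| + |s - s₀|) := by
  rw [← integral_congr_ae (ae_covErr_eq_react hν m₀ m s q hs₀)]
  exact abs_integral_covErr_sub_idealError_le hM hM' hν hb hb' hsymm m₀ s₀ m s q hs₀ hL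

theorem integral_frozenIncrement_section {k : ℕ} {ω : Ω}
    (hm : Measurable (frozenIncrement α S μ σ μhat σhat Q k ω)) (x : 𝒳) :
    ∫ e, frozenIncrement α S μ σ μhat σhat Q k ω (x, e) ∂ν =
      (∫ e, react (μ x + σ x * e) (predInterval (μhat (k + 1) ω x) (σhat (k + 1) ω x) (Q k ω))
        (Q k ω) ∂ν - α) * ((S x).toNat : ℝ) := by
  by_cases hSx : S x = true
  · have hi : Integrable (fun e => react (μ x + σ x * e)
        (predInterval (μhat (k + 1) ω x) (σhat (k + 1) ω x) (Q k ω)) (Q k ω)) ν := by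
      have h1 : Measurable fun e => frozenIncrement α S μ σ μhat σhat Q k ω (x, e) :=
        hm.comp measurable_prodMk_left
      have h2 : (fun e => react (μ x + σ x * e)
          (predInterval (μhat (k + 1) ω x) (σhat (k + 1) ω x) (Q k ω)) (Q k ω)) =
          fun e => frozenIncrement α S μ σ μhat σhat Q k ω (x, e) + α := by
        funext e; simp [frozenIncrement, hSx]
      refine Integrable.of_bound (by rw [h2]; exact (h1.add_const α).aestronglyMeasurable) 1
        (ae_of_all _ fun e => ?_)
      have := react_mem_Icc (μ x + σ x * e)
        (predInterval (μhat (k + 1) ω x) (σhat (k + 1) ω x) (Q k ω)) (Q k ω)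
      rw [Real.norm_eq_abs, abs_of_nonneg this.1]
      exact this.2
    simp only [frozenIncrement]
    rw [integral_mul_const, integral_sub hi (integrable_const _)]
    simp
  · simp [frozenIncrement, hSx]

/-- Passing from the reaction minus `α` to the coverage error adds `α` times the selection
probability. Dividing by that probability gives the relation between the instantaneous error rate
and the drift. -/
theorem integral_frozenError_eq {k : ℕ} {ω : Ω} (hα : α ∈ Set.Ioo (0 : ℝ) 1)
    (hν : ν = volume.withDensity fun x => ENNReal.ofReal (f x)) (hσ : ∀ x, 0 < σ x)
    (hS : Measurable S) (hm : Measurable (frozenIncrement α S μ σ μhat σhat Q k ω))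
    (hm' : Measurable (frozenError S μ σ μhat σhat Q k ω)) :
    ∫ z, frozenError S μ σ μhat σhat Q k ω z ∂(lX.prod ν) =
      ∫ z, frozenIncrement α S μ σ μhat σhat Q k ω z ∂(lX.prod ν) +
        α * ∫ z : 𝒳 × ℝ, ((S z.1).toNat : ℝ) ∂(lX.prod ν) := by
  have hSm : Measurable fun z : 𝒳 × ℝ => ((S z.1).toNat : ℝ) :=
    (measurable_toNat hS).comp measurable_fst
  have i1 : Integrable (frozenIncrement α S μ σ μhat σhat Q k ω) (lX.prod ν) :=
    Integrable.of_bound hm.aestronglyMeasurable 1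
      (ae_of_all _ (abs_frozenIncrement_le α S μ σ μhat σhat Q hα k ω))
  have i2 : Integrable (fun z : 𝒳 × ℝ => ((S z.1).toNat : ℝ)) (lX.prod ν) :=
    Integrable.of_bound hSm.aestronglyMeasurable 1 (ae_of_all _ fun z => by
      have := toNat_mem_Icc (S z.1)
      rw [Real.norm_eq_abs, abs_of_nonneg this.1]; exact this.2)
  have i3 : Integrable (frozenError S μ σ μhat σhat Q k ω) (lX.prod ν) :=
    Integrable.of_bound hm'.aestronglyMeasurable 1
      (ae_of_all _ (abs_frozenError_le S μ σ μhat σhat Q k ω))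
  have i4 : Integrable (fun z : 𝒳 × ℝ => frozenIncrement α S μ σ μhat σhat Q k ω z +
      α * ((S z.1).toNat : ℝ)) (lX.prod ν) := i1.add (i2.const_mul α)
  rw [← integral_const_mul, ← integral_add i1 (i2.const_mul α), integral_prod _ i3,
    integral_prod _ i4]
  refine integral_congr_ae (ae_of_all _ fun x => ?_)
  refine integral_congr_ae ?_
  filter_upwards [ae_covErr_eq_react hν (μ x) (μhat (k + 1) ω x) (σhat (k + 1) ω x) (Q k ω)
    (hσ x)] with e he
  simp only [frozenError, frozenIncrement]
  rw [he]
  ring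

/-- Since the noise is independent of the covariate, integrating it first reduces the claim to the
pointwise comparison for each covariate; the ideal error is the same for all of them, so it factors
out of the selection. The bound is `[0, ∞]`-valued because its right-hand side may be infinite. -/
theorem enorm_drift_sub_le {M M' L : ℝ} (hM : 0 ≤ M) (hM' : 0 ≤ M') {k : ℕ} {ω : Ω}
    (hα : α ∈ Set.Ioo (0 : ℝ) 1)
    (hν : ν = volume.withDensity fun x => ENNReal.ofReal (f x)) (hb : ∀ x, f x ≤ M)
    (hb' : ∀ x, |x| * f x ≤ M') (hsymm : ∀ x, f (-x) = f x)
    (hσ : ∀ x, 0 < σ x) (hL : ∀ x, 1 / σ x ≤ L) (hL0 : 0 ≤ L) (hS : Measurable S)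
    (hm : Measurable (frozenIncrement α S μ σ μhat σhat Q k ω))
    (hme : Measurable (estError μ σ μhat σhat k ω)) :
    ‖∫ z, frozenIncrement α S μ σ μhat σhat Q k ω z ∂(lX.prod ν) -
        (∫ z : 𝒳 × ℝ, ((S z.1).toNat : ℝ) ∂(lX.prod ν)) * (idealError ν (Q k ω) - α)‖ₑ ≤
      ENNReal.ofReal (L * (2 * M + 4 * M' + 4)) *
        ∫⁻ z, estError μ σ μhat σhat k ω z ∂(lX.prod ν) := by
  have hSm : Measurable fun z : 𝒳 × ℝ => ((S z.1).toNat : ℝ) :=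
    (measurable_toNat hS).comp measurable_fst
  have i1 : Integrable (frozenIncrement α S μ σ μhat σhat Q k ω) (lX.prod ν) :=
    Integrable.of_bound hm.aestronglyMeasurable 1
      (ae_of_all _ (abs_frozenIncrement_le α S μ σ μhat σhat Q hα k ω))
  have i2 : Integrable (fun x : 𝒳 => ((S x).toNat : ℝ)) lX :=
    Integrable.of_bound (measurable_toNat hS).aestronglyMeasurable 1 (ae_of_all _ fun x => by
      have := toNat_mem_Icc (S x)
      rw [Real.norm_eq_abs, abs_of_nonneg this.1]; exact this.2)
  have hSint : ∫ z : 𝒳 × ℝ, ((S z.1).toNat : ℝ) ∂(lX.prod ν) = ∫ x, ((S x).toNat : ℝ) ∂lX := by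
    have := integral_prod (μ := lX) (ν := ν) (fun z : 𝒳 × ℝ => ((S z.1).toNat : ℝ))
      (i2.comp_fst ν)
    simpa using this
  have i3 := i1.integral_prod_left
  set I : 𝒳 → ℝ := fun x => ∫ e, react (μ x + σ x * e)
    (predInterval (μhat (k + 1) ω x) (σhat (k + 1) ω x) (Q k ω)) (Q k ω) ∂ν with hI
  simp_rw [integral_frozenIncrement_section hm] at i3
  rw [hSint, integral_prod _ i1]
  simp_rw [integral_frozenIncrement_section hm]
  rw [← integral_mul_const, ← integral_sub i3 (i2.mul_const _), lintegral_prod _ hme.aemeasurable,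
    ← lintegral_const_mul _ hme.lintegral_prod_right']
  refine (enorm_integral_le_lintegral_enorm _).trans (lintegral_mono fun x => ?_)
  have h1 := abs_integral_react_sub_idealError_le hM hM' hν hb hb' hsymm (μ x) (σ x)
    (μhat (k + 1) ω x) (σhat (k + 1) ω x) (Q k ω) (hσ x) (hL x)
  have h2 := toNat_mem_Icc (S x)
  simp only [estError, lintegral_const, measure_univ, mul_one]
  rw [← ENNReal.ofReal_mul (by positivity), Real.enorm_eq_ofReal_abs]
  refine ENNReal.ofReal_le_ofReal ?_
  have e : (I x - α) * ((S x).toNat : ℝ) - ((S x).toNat : ℝ) * (idealError ν (Q k ω) - α) =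
      (I x - idealError ν (Q k ω)) * ((S x).toNat : ℝ) := by ring
  change |(I x - α) * ((S x).toNat : ℝ) - ((S x).toNat : ℝ) * (idealError ν (Q k ω) - α)| ≤ _
  rw [e, abs_mul, abs_of_nonneg h2.1]
  exact (mul_le_of_le_one_right (abs_nonneg _) h2.2).trans h1

end Drift

/-! ### The threshold recursion as a Robbins–Monro recursion. -/

section Assembly

variable {Ω 𝒳 : Type*} [m₀ : MeasurableSpace Ω] [MeasurableSpace 𝒳] {P : Measure Ω}
  {n : ℕ} {D₀ : Fin n → Ω → 𝒳 × ℝ} {X : ℕ → Ω → 𝒳} {ξ Y : ℕ → Ω → ℝ}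
  {μ σ : 𝒳 → ℝ} {α β c q₁ : ℝ} {S : 𝒳 → Bool} {μhat σhat : ℕ → Ω → 𝒳 → ℝ}

theorem integral_toNat_selection (hS : Measurable S) (hX : Measurable (X 1))
    (hξ : Measurable (ξ 1)) :
    ∫ z : 𝒳 × ℝ, ((S z.1).toNat : ℝ) ∂(P.map fun ω => (X 1 ω, ξ 1 ω)) =
      P.real {ω | S (X 1 ω) = true} := by
  have hm : Measurable fun z : 𝒳 × ℝ => ((S z.1).toNat : ℝ) :=
    (measurable_toNat hS).comp measurable_fst
  have hset : MeasurableSet {ω | S (X 1 ω) = true} := (hS.comp hX) (measurableSet_singleton true)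
  rw [integral_map (hX.prodMk hξ).aemeasurable hm.aestronglyMeasurable,
    ← integral_indicator_one hset]
  refine integral_congr_ae (ae_of_all _ fun ω => ?_)
  by_cases h : S (X 1 ω) = true <;> simp [h]

theorem IsIIDRegression.map_pair_eq (h : IsIIDRegression P D₀ X ξ Y μ σ) (k : ℕ) :
    P.map (fun ω => (X (k + 1) ω, ξ (k + 1) ω)) = P.map fun ω => (X 1 ω, ξ 1 ω) :=
  (h.identDistrib k).map_eq

variable [IsProbabilityMeasure P]

/-- Concentration of the number of selections. -/
theorem IsIIDRegression.hasSubgaussianMGF_selections (h : IsIIDRegression P D₀ X ξ Y μ σ)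
    (hS : Measurable S) (k : ℕ) :
    HasSubgaussianMGF (fun ω => ∑ i ∈ Finset.range k,
      (((S (X (i + 1) ω)).toNat : ℝ) - P.real {ω | S (X 1 ω) = true})) k P := by
  set r := P.real {ω | S (X 1 ω) = true} with hr
  have hr0 : 0 ≤ r := measureReal_nonneg
  have hr1 : r ≤ 1 := measureReal_le_one
  have hζ : ∀ i ω, |((S (X (i + 1) ω)).toNat : ℝ) - r| ≤ 1 := fun i ω => by
    have := toNat_mem_Icc (S (X (i + 1) ω))
    exact abs_le.2 ⟨by linarith [this.1], by linarith [this.2]⟩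
  have hmeas : ∀ k, Measurable[past D₀ X Y k] fun ω => ∑ i ∈ Finset.range k,
      (((S (X (i + 1) ω)).toNat : ℝ) - r) := fun k => by
    refine Finset.measurable_fun_sum _ fun i hi => ?_
    have hX : Measurable[past D₀ X Y (i + 1)] (X (i + 1)) :=
      measurable_fst.comp (measurable_past_pair i)
    have hle : past D₀ X Y (i + 1) ≤ past D₀ X Y k := past_mono (by
      rw [Finset.mem_range] at hi; omega)
    exact ((measurable_toNat hS).comp (hX.mono hle le_rfl)).sub_const r
  induction k with
  | zero => simp only [Finset.range_zero, Finset.sum_empty, Nat.cast_zero]; exact .fun_zero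
  | succ k ih =>
    have hm : ∀ W : Ω → ℝ, Measurable[past D₀ X Y k] W → (∃ C', ∀ ω, |W ω| ≤ C') →
        ∫ ω, W ω * (((S (X (k + 1) ω)).toNat : ℝ) - r) ∂P = 0 := by
      rintro W hW ⟨B, hB⟩
      have hψ : Measurable fun z : 𝒳 × ℝ => ((S z.1).toNat : ℝ) - r :=
        ((measurable_toNat hS).comp measurable_fst).sub_const r
      have key := integral_mul_frozen (h.past_le k) (h.measurable_pair k) (h.indep_past k)
        (ψ := fun _ z => ((S z.1).toNat : ℝ) - r)
        (hψ.comp (@measurable_snd Ω (𝒳 × ℝ) (past D₀ X Y k) _)) (C := 1) (fun ω z => by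
          have := toNat_mem_Icc (S z.1)
          exact abs_le.2 ⟨by linarith [this.1], by linarith [this.2]⟩) hW hB
      have := Measure.isProbabilityMeasure_map (h.measurable_pair 0).aemeasurable (μ := P)
      have h0 : ∫ z : 𝒳 × ℝ, (((S z.1).toNat : ℝ) - r) ∂(P.map fun ω => (X 1 ω, ξ 1 ω)) = 0 := by
        rw [integral_sub _ (integrable_const _), integral_toNat_selection hS
          (h.measurable_X 1 le_rfl) (h.measurable_noise 1 le_rfl), integral_const, probReal_univ,
          one_smul, sub_self]
        refine Integrable.of_bound
          ((measurable_toNat hS).comp measurable_fst).aestronglyMeasurable 1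
          (ae_of_all _ fun z => ?_)
        have := toNat_mem_Icc (S z.1)
        rw [Real.norm_eq_abs, abs_of_nonneg this.1]
        exact this.2
      rw [key, h.map_pair_eq k, h0]
      simp
    -- With no contraction and centred increments bounded by 1, each time step adds 1 to the proxy.
    have := hasSubgaussianMGF_step (h.past_le k) (hmeas k) (C := k) (fun ω => by
        refine (Finset.abs_sum_le_sum_abs _ _).trans
          ((Finset.sum_le_sum fun i _ => hζ i ω).trans ?_)
        simp) ih (U := fun _ => 1) measurable_const (u := 1) (by simp)
      (((measurable_toNat hS).comp (h.measurable_X (k + 1) (by omega))).sub_const r) (hζ k)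
      one_pos one_pos hm 1 (v' := ((k + 1 : ℕ) : NNReal)) (by push_cast; simp)
    refine this.congr (ae_of_all _ fun ω => ?_)
    simp only [Finset.sum_range_succ, one_mul, Function.comp]

/-- A large step forces the counter below `r (k + 1) / 2`, half its typical size. Centred, this is a
deviation of at least `r (k + 1) / 2` of a sum with proxy `k`, so its probability is at most `exp
(-r ^ 2 (k + 1) / 8)`. -/
theorem IsIIDRegression.eventually_stepSize_tail (h : IsIIDRegression P D₀ X ξ Y μ σ)
    (hS : Measurable S) (hβ : 0 < β) (hc : 0 < c) (hr : 0 < P.real {ω | S (X 1 ω) = true}) :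
    ∀ᶠ k : ℕ in atTop, P.real {ω | c * (P.real {ω | S (X 1 ω) = true} / 2) ^ (-β) *
        ((k : ℝ) + 1) ^ (-β) < stepSize α β c q₁ S X Y μhat σhat k ω} ≤
      1 / ((k : ℝ) + 1) ^ 3 := by
  have hsub := fun k => h.hasSubgaussianMGF_selections hS k
  have hr1 : P.real {ω | S (X 1 ω) = true} ≤ 1 := measureReal_le_one
  set r := P.real {ω | S (X 1 ω) = true} with hrdef
  filter_upwards [eventually_ge_atTop 1,
    eventually_exp_neg_rpow_le one_pos (by positivity : 0 < r ^ 2 / 8) 3] with k hk hexp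
  have hT : (0 : ℝ) < (k : ℝ) + 1 := by positivity
  have hk0 : (0 : ℝ) < k := by exact_mod_cast hk
  set T := (k : ℝ) + 1 with hTdef
  set M : Ω → ℝ := fun ω => ∑ i ∈ Finset.range k, (((S (X (i + 1) ω)).toNat : ℝ) - r) with hM
  have hincl : {ω | c * (r / 2) ^ (-β) * T ^ (-β) < stepSize α β c q₁ S X Y μhat σhat k ω} ⊆
      {ω | r * T / 2 ≤ (-M) ω} := by
    intro ω hω
    rw [Set.mem_ofPred_eq] at hω ⊢
    by_contra! hcon
    rw [Pi.neg_apply] at hcon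
    have hJ : ((nextState α β c q₁ S X Y μhat σhat k ω).2 : ℝ) = 1 + (M ω + k * r) := by
      rw [nextState_snd_eq, hM]
      simp only [Finset.sum_sub_distrib, Finset.sum_const, Finset.card_range, nsmul_eq_mul]
      push_cast
      ring
    -- The initial 1 in the counter dominates the extra `r` in `r * T = r * k + r`.
    have hJ' : r / 2 * T ≤ ((nextState α β c q₁ S X Y μhat σhat k ω).2 : ℝ) := by
      rw [hJ]
      have : r * T = r * k + r := by rw [hTdef]; ring
      linarith
    have h1 := Real.rpow_le_rpow_of_nonpos (by positivity) hJ' (by linarith : -β ≤ 0)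
    rw [Real.mul_rpow (by positivity) hT.le] at h1
    have h2 := mul_le_mul_of_nonneg_left h1 hc.le
    rw [stepSize] at hω
    linarith
  refine (measureReal_mono hincl).trans (((hsub k).neg.measure_ge_le (by positivity)).trans ?_)
  refine le_trans (Real.exp_le_exp.2 ?_) (hexp.trans (le_of_eq ?_))
  · rw [Real.rpow_one, neg_div, neg_mul, neg_le_neg_iff, NNReal.coe_natCast,
      le_div_iff₀ (by positivity)]
    have : (k : ℝ) ≤ T := by linarith
    have h3 : 0 ≤ r ^ 2 * T := by positivity
    nlinarith
  · rw [Real.rpow_neg hT.le, one_div]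
    congr 1
    exact_mod_cast Real.rpow_natCast T 3

/-- Index `k` stands for time `k + 1`, so the threshold used then is measurable with respect to the
past at `k`. Beyond the recursion itself, the statement records what both rates require: the tail of
the step, the bias in terms of the estimation error, and the error rate as normalized drift. -/
theorem exists_isRobbinsMonro {f : ℝ → ℝ} (h : IsIIDRegression P D₀ X ξ Y μ σ)
    (hnoise : IsRegularNoise P (ξ 1) f σ)
    (hμhat : IsPastMeasurable (past D₀ X Y) μhat) (hσhat : IsPastMeasurable (past D₀ X Y) σhat)
    (hS : Measurable S) (hr : 0 < P {ω | S (X 1 ω) = true})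
    (hα : α ∈ Set.Ioo (0 : ℝ) 1) (hβ : β ∈ Set.Ioo (0 : ℝ) 1) (hc : 0 < c)
    (hq₁ : q₁ ∈ Set.Icc (0 : ℝ) 1) :
    ∃ (Γ Z d b : ℕ → Ω → ℝ) (B B' κ K r hi Kb : ℝ), 0 < hi ∧ 0 < Kb ∧
      IsRobbinsMonro P (past D₀ X Y)
        (fun k ω => (nextState α β c q₁ S X Y μhat σhat k ω).1 - targetThreshold (P.map (ξ 1)) α)
        Γ Z d b β B B' κ K r c c ∧
      (∀ᶠ k : ℕ in atTop,
        P.real {ω | hi * ((k : ℝ) + 1) ^ (-β) < Γ k ω} ≤ 1 / ((k : ℝ) + 1) ^ 3) ∧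
      (∀ k ω, ‖b k ω‖ₑ ≤ ENNReal.ofReal Kb *
        ∫⁻ z, estError μ σ μhat σhat k ω z ∂(P.map fun ω => (X 1 ω, ξ 1 ω))) ∧
      (∀ k, ∀ᵐ ω ∂P, instErrorRate P (past D₀ X Y k) (fun ω => S (X (k + 1) ω))
        (fun ω => covErr (Y (k + 1) ω) (predInterval (μhat (k + 1) ω (X (k + 1) ω))
          (σhat (k + 1) ω (X (k + 1) ω)) (nextState α β c q₁ S X Y μhat σhat k ω).1)) ω - α =
            d k ω / r) := by
  have hX1 := h.measurable_X 1 le_rfl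
  have hξ1 := h.measurable_noise 1 le_rfl
  have hr' : 0 < P.real {ω | S (X 1 ω) = true} :=
    ENNReal.toReal_pos hr.ne' (measure_ne_top _ _)
  have htail := h.eventually_stepSize_tail (α := α) (q₁ := q₁) (μhat := μhat) (σhat := σhat)
    hS hβ.1 hc hr'
  have hrint := integral_toNat_selection (P := P) hS hX1 hξ1
  set r := P.real {ω | S (X 1 ω) = true} with hrdef
  have hr1 : r ≤ 1 := measureReal_le_one
  have hlX : IsProbabilityMeasure (P.map (X 1)) :=
    Measure.isProbabilityMeasure_map hX1.aemeasurable
  have hνp : IsProbabilityMeasure (P.map (ξ 1)) :=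
    Measure.isProbabilityMeasure_map hξ1.aemeasurable
  have hlaw : P.map (fun ω => (X 1 ω, ξ 1 ω)) = (P.map (X 1)).prod (P.map (ξ 1)) :=
    (indepFun_iff_map_prod_eq_prod_map_map hX1.aemeasurable hξ1.aemeasurable).1 h.indep_noise
  obtain ⟨M, hM⟩ := hnoise.bounded
  obtain ⟨M', hM'⟩ := hnoise.bounded_mul
  obtain ⟨L, hL⟩ := hnoise.bounded_inv_scale
  have hb : ∀ x, f x ≤ M := fun x => hM ⟨x, rfl⟩
  have hb' : ∀ x, |x| * f x ≤ M' := fun x => hM' ⟨x, rfl⟩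
  have hL' : ∀ x, 1 / σ x ≤ L := fun x => hL ⟨x, rfl⟩
  have hM0 : 0 ≤ M := (hnoise.density_nonneg 0).trans (hb 0)
  have hM'0 : 0 ≤ M' := (mul_nonneg (abs_nonneg 0) (hnoise.density_nonneg 0)).trans (hb' 0)
  obtain ⟨ω₀⟩ : Nonempty Ω := P.nonempty_of_neZero
  have hL0 : 0 < L := lt_of_lt_of_le (one_div_pos.2 (h.scale_pos (X 1 ω₀))) (hL' _)
  set ν := P.map (ξ 1) with hνdef
  set q₀ := targetThreshold ν α with hq₀
  set Q : ℕ → Ω → ℝ := fun k ω => (nextState α β c q₁ S X Y μhat σhat k ω).1 with hQ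
  have hB0 : 0 < 1 + c + |q₀| := by positivity
  have hDB : ∀ k ω, |Q k ω - q₀| ≤ 1 + c + |q₀| := fun k ω => by
    have h1 := nextState_fst_mem_Icc S X Y μhat σhat hα hβ.1 hc hq₁ k ω
    refine (abs_sub _ _).trans (add_le_add_left (abs_le.2 ?_) _)
    exact ⟨by linarith [h1.1], h1.2⟩
  obtain ⟨κ, K, hκ, hκK, hslope⟩ := exists_slope_idealError hM0 hnoise.density hb
    hnoise.continuous hnoise.symmetric hnoise.support_interval hα hB0
  have hmS := fun k => measurable_nextState (D₀ := D₀) (α := α) (β := β) (c := c) (q₁ := q₁)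
    hS hμhat hσhat k
  have hfro : ∀ k, _ := fun k => measurable_frozen (α := α) (Q := Q) (m := past D₀ X Y k) (k := k)
    hS h.measurable_mean h.measurable_scale (hμhat (k + 1) (by omega)) (hσhat (k + 1) (by omega))
    (hmS k).1
  set l := P.map (fun ω => (X 1 ω, ξ 1 ω)) with hl
  have hlp : IsProbabilityMeasure l :=
    Measure.isProbabilityMeasure_map (hX1.prodMk hξ1).aemeasurable
  set d : ℕ → Ω → ℝ := fun k ω => ∫ z, frozenIncrement α S μ σ μhat σhat Q k ω z ∂l with hd
  -- The bias is defined as the gap between the normalized drift and that of the ideal predictor, so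
  -- `d = r (-h D + b)` holds by the slope identity.
  set b : ℕ → Ω → ℝ := fun k ω => d k ω / r - (idealError ν (Q k ω) - α) with hbdef
  have hinc : ∀ k ω, increment α β c q₁ S X Y μhat σhat k ω =
      frozenIncrement α S μ σ μhat σhat Q k ω (X (k + 1) ω, ξ (k + 1) ω) := fun k ω => by
    rw [increment, frozenIncrement, h.model (k + 1) (by omega)]
  have hdm : ∀ k, Measurable[past D₀ X Y k] (d k) := fun k => measurable_integral_frozen (hfro k).1
  have hd1 : ∀ k ω, |d k ω| ≤ 1 := fun k ω => by
    have := norm_integral_le_of_norm_le_const (μ := l)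
      (f := frozenIncrement α S μ σ μhat σhat Q k ω) (C := 1)
      (ae_of_all _ (abs_frozenIncrement_le α S μ σ μhat σhat Q hα k ω))
    simpa using this
  have hGm : Measurable (idealError ν) :=
    (antitone_idealError hnoise.density hnoise.symmetric).measurable
  -- `1 / r + 1` bounds the bias, from `|d| ≤ 1` and an ideal error within 1 of `α`. The factor `(r
  -- / 2) ^ (-β)` turns a counter of at least `r (k + 1) / 2` into a bound on the step.
  refine ⟨stepSize α β c q₁ S X Y μhat σhat, increment α β c q₁ S X Y μhat σhat, d, b,
    1 + c + |q₀|, 1 / r + 1, κ, K, r, c * (r / 2) ^ (-β),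
    L * (2 * M + 4 * M' + 4) / r, by positivity, by positivity, ?_, htail, ?_, ?_⟩
  · exact
    { le := h.past_le
      mono := past_mono
      measurable_D := fun k => (hmS k).1.sub_const q₀
      measurable_step := fun k => ((hmS k).2.1.pow_const (-β)).const_mul c
      measurable_drift := hdm
      measurable_bias := fun k =>
        ((hdm k).div_const r).sub ((hGm.comp (hmS k).1).sub_const α)
      measurable_Z := fun k => (hmS k).2.2
      recursion := fun k ω => by rw [nextState_succ_fst]; ring
      abs_D_le := hDB
      abs_Z_le := abs_increment_le_one S X Y μhat σhat hα
      abs_drift_le := hd1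
      abs_bias_le := fun k ω => by
        have h1 := idealError_mem_Icc hnoise.density hnoise.symmetric (Q k ω)
        refine (abs_sub _ _).trans (add_le_add ?_ ?_)
        · rw [abs_div, abs_of_pos hr']; exact div_le_div_of_nonneg_right (hd1 k ω) hr'.le
        · exact abs_le.2 ⟨by linarith [h1.1, hα.2], by linarith [h1.2, hα.1]⟩
      le_step := le_stepSize S X Y μhat σhat hβ.1 hc
      step_le := stepSize_le S X Y μhat σhat hβ.1 hc
      condMean := fun k W hW hC => by
        obtain ⟨C, hC⟩ := hC
        have := integral_mul_frozen (h.past_le k) (h.measurable_pair k) (h.indep_past k)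
          (hfro k).1 (abs_frozenIncrement_le α S μ σ μhat σhat Q hα k) hW hC
        rw [h.map_pair_eq k] at this
        simp_rw [hinc]
        exact this
      drift_eq := fun k ω => by
        obtain ⟨s, hs, hsq⟩ := hslope (Q k ω) (hDB k ω)
        refine ⟨s, hs, ?_⟩
        simp only [hbdef]
        rw [hsq]
        field_simp
        ring
      slope_pos := hκ
      rate_pos := hr'
      lo_pos := hc
      B_pos := hB0
      β_mem := hβ }
  · intro k ω
    have h1 := enorm_drift_sub_le (lX := P.map (X 1)) (ν := ν) (k := k) (ω := ω) hM0 hM'0 hα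
      hnoise.density hb hb' hnoise.symmetric h.scale_pos hL' hL0.le hS
      (measurable_section (hfro k).1 ω) (measurable_section (hfro k).2.2 ω)
    rw [← hlaw, hrint] at h1
    have e : b k ω = (1 / r) * (d k ω - r * (idealError ν (Q k ω) - α)) := by
      simp only [hbdef]; field_simp
    rw [e, enorm_mul, div_eq_mul_one_div (L * (2 * M + 4 * M' + 4)),
      mul_comm (L * (2 * M + 4 * M' + 4)), ENNReal.ofReal_mul (by positivity), mul_assoc,
      Real.enorm_eq_ofReal (by positivity)]
    exact mul_le_mul_right h1 _
  · intro k
    have hSm : Measurable fun z : 𝒳 × ℝ => ((S z.1).toNat : ℝ) :=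
      (measurable_toNat hS).comp measurable_fst
    have c1 := condExp_frozen (h.past_le k) (h.measurable_pair k) (h.indep_past k)
      (hfro k).2.1 (abs_frozenError_le S μ σ μhat σhat Q k)
    have c2 := condExp_frozen (h.past_le k) (h.measurable_pair k) (h.indep_past k)
      (ψ := fun _ z => ((S z.1).toNat : ℝ))
      (hSm.comp (@measurable_snd Ω (𝒳 × ℝ) (past D₀ X Y k) _)) (C := 1) (fun ω z => by
        have := toNat_mem_Icc (S z.1)
        rw [abs_of_nonneg this.1]; exact this.2)
    rw [h.map_pair_eq k] at c1 c2
    filter_upwards [c1, c2] with ω h1 h2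
    have e1 : (fun ω => covErr (Y (k + 1) ω) (predInterval (μhat (k + 1) ω (X (k + 1) ω))
        (σhat (k + 1) ω (X (k + 1) ω)) (nextState α β c q₁ S X Y μhat σhat k ω).1) *
          ((S (X (k + 1) ω)).toNat : ℝ)) = fun ω =>
        frozenError S μ σ μhat σhat Q k ω (X (k + 1) ω, ξ (k + 1) ω) := by
      funext ω'
      rw [frozenError, h.model (k + 1) (by omega)]
    have e2 := integral_frozenError_eq (lX := P.map (X 1)) (ν := ν) (k := k) (ω := ω) hα
      hnoise.density h.scale_pos hS (measurable_section (hfro k).1 ω)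
      (measurable_section (hfro k).2.1 ω)
    rw [← hlaw, hrint] at e2
    rw [instErrorRate, e1, h1, h2, e2]
    change (d k ω + α * r) / (∫ z : 𝒳 × ℝ, ((S z.1).toNat : ℝ) ∂l) - α = d k ω / r
    rw [hrint]
    field_simp
    ring

end Assembly

/-! ### Rates -/

/-- Both branches compare exponents: `-β / 2 ≤ -β / 3`, and `-β / 2 ≤ 1 / 2 - β` because `β ≤ 1`. -/
theorem sqrt_log_mul_rpow_le_rho {β : ℝ} (hβ : β ∈ Set.Ioo (0 : ℝ) 1) (k : ℕ) :
    √(Real.log ((k : ℝ) + 1)) * ((k : ℝ) + 1) ^ (-β / 2) ≤ rho β (k + 1) := by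
  have h1 : (1 : ℝ) ≤ (k : ℝ) + 1 := by linarith [(Nat.cast_nonneg k : (0 : ℝ) ≤ k)]
  rw [rho, Nat.cast_add, Nat.cast_one, ← Real.sqrt_eq_rpow]
  split_ifs with h
  · exact mul_le_mul_of_nonneg_left (Real.rpow_le_rpow_of_exponent_le h1 (by linarith [hβ.1]))
      (Real.sqrt_nonneg _)
  · have h2 := mul_le_mul_of_nonneg_left
      (Real.rpow_le_rpow_of_exponent_le h1 (by linarith [hβ.2] : -β / 2 ≤ 1 / 2 - β))
      (Real.sqrt_nonneg (Real.log ((k : ℝ) + 1)))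
    have h3 : 0 ≤ ((k : ℝ) + 1) ^ (β - 1) := by positivity
    linarith

theorem log_natCast_add_one_nonneg (k : ℕ) : 0 ≤ Real.log ((k : ℝ) + 1) :=
  Real.log_nonneg (by linarith [(Nat.cast_nonneg k : (0 : ℝ) ≤ k)])

theorem logRate_half_window {a s : ℝ} (ha : 0 ≤ a) (hs0 : 0 ≤ s) (hs1 : s ≤ 1) {k j : ℕ}
    (hj : k / 2 ≤ j) (hjk : j ≤ k) :
    Real.log ((j : ℝ) + 1) ^ a * ((j : ℝ) + 1) ^ (-s) ≤
      2 * (Real.log ((k : ℝ) + 1) ^ a * ((k : ℝ) + 1) ^ (-s)) := by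
  have h1 : Real.log ((j : ℝ) + 1) ^ a ≤ Real.log ((k : ℝ) + 1) ^ a := by
    refine Real.rpow_le_rpow (log_natCast_add_one_nonneg j) (Real.log_le_log (by positivity) ?_) ha
    have : (j : ℝ) ≤ k := by exact_mod_cast hjk
    linarith
  have h2 := half_window_rpow_le hs0 hs1 hj
  have h3 : 0 ≤ Real.log ((k : ℝ) + 1) ^ a := Real.rpow_nonneg (log_natCast_add_one_nonneg k) _
  calc _ ≤ Real.log ((k : ℝ) + 1) ^ a * (2 * ((k : ℝ) + 1) ^ (-s)) :=
        mul_le_mul h1 h2 (by positivity) h3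
    _ = _ := by ring

/-- The rate loses at most a relative `1 / (k + 1)` per step when `s ≤ 1`, which is negligible
against `(k + 1) ^ (-β)` for `β < 1`; the logarithmic factor only increases. -/
theorem eventually_logRate_succ {β a s : ℝ} (hβ : β < 1) (ha : 0 ≤ a) (hs1 : s ≤ 1)
    (a₀ : ℝ) (ha₀ : 0 < a₀) :
    ∀ᶠ k : ℕ in atTop, (1 - a₀ * ((k : ℝ) + 1) ^ (-β)) *
        (Real.log ((k : ℝ) + 1) ^ a * ((k : ℝ) + 1) ^ (-s)) ≤
      Real.log (((k + 1 : ℕ) : ℝ) + 1) ^ a * (((k + 1 : ℕ) : ℝ) + 1) ^ (-s) := by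
  filter_upwards [eventually_mul_rpow_neg_le_one (sub_pos.2 hβ) (1 / a₀)] with k hk
  have hT : (0 : ℝ) < (k : ℝ) + 1 := by positivity
  push_cast
  set T := (k : ℝ) + 1 with hTdef
  have hlog0 : 0 ≤ Real.log T := log_natCast_add_one_nonneg k
  have h1 : Real.log T ^ a ≤ Real.log (T + 1) ^ a :=
    Real.rpow_le_rpow hlog0 (Real.log_le_log hT (by linarith)) ha
  have h2 : 1 / T ≤ a₀ * T ^ (-β) := by
    have e : T ^ (-(1 - β)) = T ^ (-(1 : ℝ)) / T ^ (-β) := by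
      rw [← Real.rpow_sub hT]; congr 1; ring
    rw [e, Real.rpow_neg_one, one_div_mul_eq_div, div_div, div_le_one (by positivity)] at hk
    rw [one_div]; linarith
  have h3 : (1 - 1 / T) * T ^ (-s) ≤ (T + 1) ^ (-s) := by
    have h4 : T / (T + 1) ≤ (T / (T + 1)) ^ s := by
      have hle : T / (T + 1) ≤ 1 := (div_le_one (by positivity)).2 (by linarith)
      calc T / (T + 1) = (T / (T + 1)) ^ (1 : ℝ) := (Real.rpow_one _).symm
        _ ≤ _ := Real.rpow_le_rpow_of_exponent_ge (by positivity) hle hs1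
    have h5 : 1 - 1 / T ≤ T / (T + 1) := by
      rw [one_sub_div hT.ne', div_le_div_iff₀ hT (by positivity)]; nlinarith
    have h6 : (T + 1) ^ (-s) = (T / (T + 1)) ^ s * T ^ (-s) := by
      rw [Real.div_rpow hT.le (by positivity), Real.rpow_neg hT.le, Real.rpow_neg (by positivity)]
      field_simp
    rw [h6]
    exact mul_le_mul_of_nonneg_right (h5.trans h4) (by positivity)
  have hpos : 0 ≤ T ^ (-s) := by positivity
  have hlogp : 0 ≤ Real.log T ^ a := Real.rpow_nonneg hlog0 _
  calc (1 - a₀ * T ^ (-β)) * (Real.log T ^ a * T ^ (-s))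
      ≤ (1 - 1 / T) * (Real.log T ^ a * T ^ (-s)) :=
        mul_le_mul_of_nonneg_right (by linarith) (by positivity)
    _ = Real.log T ^ a * ((1 - 1 / T) * T ^ (-s)) := by ring
    _ ≤ Real.log T ^ a * (T + 1) ^ (-s) := mul_le_mul_of_nonneg_left h3 hlogp
    _ ≤ Real.log (T + 1) ^ a * (T + 1) ^ (-s) :=
        mul_le_mul_of_nonneg_right h1 (by positivity)

theorem sq_integral_le_integral_sq {Ω : Type*} [MeasurableSpace Ω] {P : Measure Ω}
    [IsProbabilityMeasure P] {g : Ω → ℝ} (hg : MemLp g 2 P) :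
    (∫ ω, g ω ∂P) ^ 2 ≤ ∫ ω, g ω ^ 2 ∂P := by
  have h1 := variance_eq_sub hg
  have h2 := variance_nonneg g P
  rw [h1] at h2
  simp only [Pi.pow_apply] at h2
  linarith

/-! ### From the estimation rates to the bias. -/

section Main

variable {Ω 𝒳 : Type*} [m₀ : MeasurableSpace Ω] [MeasurableSpace 𝒳] {P : Measure Ω}
  {n : ℕ} {D₀ : Fin n → Ω → 𝒳 × ℝ} {X : ℕ → Ω → 𝒳} {ξ Y : ℕ → Ω → ℝ}
  {μ σ : 𝒳 → ℝ} {μhat σhat : ℕ → Ω → 𝒳 → ℝ}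

theorem measurable_estError (h : IsIIDRegression P D₀ X ξ Y μ σ)
    (hμhat : IsPastMeasurable (past D₀ X Y) μhat) (hσhat : IsPastMeasurable (past D₀ X Y) σhat)
    (k : ℕ) :
    @Measurable (Ω × (𝒳 × ℝ)) ENNReal (@Prod.instMeasurableSpace Ω (𝒳 × ℝ) (past D₀ X Y k) _) _
      (fun p => estError μ σ μhat σhat k p.1 p.2) :=
  -- The estimation error involves neither level, selection nor threshold, so arbitrary constants
  -- fill these places.
  (measurable_frozen (α := 0) (S := fun _ => true) (Q := fun _ _ => 0) measurable_const
    h.measurable_mean h.measurable_scale (hμhat (k + 1) (by omega)) (hσhat (k + 1) (by omega))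
    measurable_const).2.2

variable [IsProbabilityMeasure P]

/-- The frozen integral of the estimation error is its conditional expectation, so the hypothesis
transfers to the bias up to the factor `Kb`; the probability bound follows from `3 ≤ π ^ 2`. -/
theorem RateInProbability.eventually_bias_tail (h : IsIIDRegression P D₀ X ξ Y μ σ)
    (hμhat : IsPastMeasurable (past D₀ X Y) μhat) (hσhat : IsPastMeasurable (past D₀ X Y) σhat)
    {ν₀ ν : ℝ} (hrate : RateInProbability P (past D₀ X Y) X μ σ μhat σhat ν₀ ν)
    {b : ℕ → Ω → ℝ} {Kb : ℝ} (hKb : 0 < Kb)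
    (hb : ∀ k ω, ‖b k ω‖ₑ ≤ ENNReal.ofReal Kb *
        ∫⁻ z, estError μ σ μhat σhat k ω z ∂(P.map fun ω => (X 1 ω, ξ 1 ω))) :
    ∃ C > 0, ∀ᶠ k : ℕ in atTop, P.real {ω | C * (Real.log ((k : ℝ) + 1) ^ ν₀ *
      ((k : ℝ) + 1) ^ (-ν)) < |b k ω|} ≤ 1 / ((k : ℝ) + 1) ^ 3 := by
  obtain ⟨C₁, hC₁, hev⟩ := hrate
  refine ⟨Kb * C₁, by positivity, ?_⟩
  filter_upwards [(tendsto_add_atTop_nat 1).eventually hev] with k hk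
  rw [Nat.add_sub_cancel] at hk
  push_cast at hk
  have hcl := condLExp_frozen (h.past_le k) (h.measurable_pair k) (h.indep_past k)
    (measurable_estError h hμhat hσhat k)
  rw [h.map_pair_eq k] at hcl
  have hw : 0 ≤ Real.log ((k : ℝ) + 1) ^ ν₀ * ((k : ℝ) + 1) ^ (-ν) :=
    mul_nonneg (Real.rpow_nonneg (log_natCast_add_one_nonneg k) _) (by positivity)
  have hle : P {ω | Kb * C₁ * (Real.log ((k : ℝ) + 1) ^ ν₀ * ((k : ℝ) + 1) ^ (-ν)) < |b k ω|} ≤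
      ENNReal.ofReal (3 / (Real.pi ^ 2 * ((k : ℝ) + 1) ^ 3)) := by
    refine le_trans (measure_mono_ae ?_) hk
    filter_upwards [hcl] with ω hω hmem
    change _ < _ at hmem
    change _ ≤ condLExp _ _ _ ω
    refine le_of_le_of_eq ?_ hω.symm
    by_contra! hlt
    have h1 := (hb k ω).trans (mul_le_mul_right hlt.le _)
    rw [← ENNReal.ofReal_mul hKb.le, Real.enorm_eq_ofReal_abs,
      ENNReal.ofReal_le_ofReal_iff (by rw [mul_assoc C₁]; positivity)] at h1
    linarith
  refine ENNReal.toReal_le_of_le_ofReal (by positivity) (hle.trans (ENNReal.ofReal_le_ofReal ?_))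
  have hpi := Real.pi_gt_three
  rw [div_le_div_iff₀ (by positivity) (by positivity)]
  rw [one_mul]
  exact mul_le_mul_of_nonneg_right (by nlinarith) (by positivity)

/-- Weighted Young inequality with weight equal to the rate `v`: `|a₁| + |a₂| ≤ (a₁ ^ 2 + a₂ ^ 2) /
(2 v) + v`. With second moments bounded by `C₁ v ^ 2` this gives `(C₁ / 2 + 1) v`, with no
integrability assumption on the estimators. -/
theorem RateInMean.eventually_integral_bias_le (h : IsIIDRegression P D₀ X ξ Y μ σ)
    (hμhat : IsPastMeasurable (past D₀ X Y) μhat) (hσhat : IsPastMeasurable (past D₀ X Y) σhat)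
    {τ₀ τ : ℝ} (hrate : RateInMean P X μ σ μhat σhat τ₀ τ)
    {b : ℕ → Ω → ℝ} {Kb : ℝ} (hKb : 0 < Kb) (hbm : ∀ k, Measurable (b k))
    (hb : ∀ k ω, ‖b k ω‖ₑ ≤ ENNReal.ofReal Kb *
        ∫⁻ z, estError μ σ μhat σhat k ω z ∂(P.map fun ω => (X 1 ω, ξ 1 ω))) :
    ∃ C > 0, ∀ᶠ k : ℕ in atTop, ∫ ω, |b k ω| ∂P ≤
      C * (Real.log ((k : ℝ) + 1) ^ τ₀ * ((k : ℝ) + 1) ^ (-τ)) := by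
  obtain ⟨C₁, hC₁, hev⟩ := hrate
  refine ⟨Kb * (C₁ / 2 + 1), by positivity, ?_⟩
  filter_upwards [(tendsto_add_atTop_nat 1).eventually hev, eventually_one_le_log] with k hk hlog
  push_cast at hk
  have hT : (0 : ℝ) < (k : ℝ) + 1 := by positivity
  set T := (k : ℝ) + 1
  have hlog0 : 0 < Real.log T := by linarith
  set v := Real.log T ^ τ₀ * T ^ (-τ) with hv
  have hv0 : 0 < v := by positivity
  have hv2 : C₁ * Real.log T ^ (2 * τ₀) * T ^ (-(2 * τ)) = C₁ * v ^ 2 := by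
    rw [hv, mul_pow, ← Real.rpow_natCast (Real.log T ^ τ₀), ← Real.rpow_natCast (T ^ (-τ)),
      ← Real.rpow_mul hlog0.le, ← Real.rpow_mul hT.le, mul_assoc]
    congr 3 <;> push_cast <;> ring
  rw [hv2] at hk
  have hX : Measurable (X (k + 1)) := h.measurable_X _ (by omega)
  have hμ := h.measurable_mean
  have hσ := h.measurable_scale
  have hm1 : Measurable fun ω => μhat (k + 1) ω (X (k + 1) ω) :=
    measurable_comp_frozen (h.past_le k) hX (hμhat (k + 1) (by omega))
  set a₁ : Ω → ℝ := fun ω => μhat (k + 1) ω (X (k + 1) ω) - μ (X (k + 1) ω)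
  set a₂ : Ω → ℝ := fun ω => σhat (k + 1) ω (X (k + 1) ω) - σ (X (k + 1) ω)
  have ha₁ : Measurable a₁ := hm1.sub (hμ.comp hX)
  have hest : ∫⁻ ω, estError μ σ μhat σhat k ω (X (k + 1) ω, ξ (k + 1) ω) ∂P ≤
      ENNReal.ofReal ((C₁ / 2 + 1) * v) := by
    calc ∫⁻ ω, estError μ σ μhat σhat k ω (X (k + 1) ω, ξ (k + 1) ω) ∂P
        ≤ ∫⁻ ω, (ENNReal.ofReal (1 / (2 * v)) *
            (ENNReal.ofReal (a₁ ω ^ 2) + ENNReal.ofReal (a₂ ω ^ 2)) + ENNReal.ofReal v) ∂P := by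
          refine lintegral_mono fun ω => ?_
          rw [← ENNReal.ofReal_add (sq_nonneg _) (sq_nonneg _),
            ← ENNReal.ofReal_mul (by positivity), ← ENNReal.ofReal_add (by positivity) hv0.le]
          refine ENNReal.ofReal_le_ofReal ?_
          change |a₁ ω| + |a₂ ω| ≤ _
          rw [one_div_mul_eq_div, div_add' _ _ _ (by positivity), le_div_iff₀ (by positivity),
            ← sq_abs (a₁ ω), ← sq_abs (a₂ ω)]
          nlinarith [sq_nonneg (|a₁ ω| - v), sq_nonneg (|a₂ ω| - v)]
      _ = ENNReal.ofReal (1 / (2 * v)) * (∫⁻ ω, ENNReal.ofReal (a₁ ω ^ 2) ∂P +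
            ∫⁻ ω, ENNReal.ofReal (a₂ ω ^ 2) ∂P) + ENNReal.ofReal v := by
          rw [lintegral_add_right _ measurable_const, lintegral_const_mul' _ _ ENNReal.ofReal_ne_top,
            lintegral_add_left (by fun_prop), lintegral_const, measure_univ, mul_one]
      _ ≤ ENNReal.ofReal (1 / (2 * v)) * ENNReal.ofReal (C₁ * v ^ 2) + ENNReal.ofReal v := by
          gcongr
      _ = ENNReal.ofReal ((C₁ / 2 + 1) * v) := by
          rw [← ENNReal.ofReal_mul (by positivity),
            ← ENNReal.ofReal_add (by positivity) hv0.le]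
          congr 1
          field_simp
  have hfro := lintegral_frozen (h.past_le k) (h.measurable_pair k) (h.indep_past k)
    (measurable_estError h hμhat hσhat k)
  rw [h.map_pair_eq k] at hfro
  rw [integral_eq_lintegral_of_nonneg_ae (ae_of_all _ fun ω => abs_nonneg _)
    (hbm k).abs.aestronglyMeasurable, mul_assoc]
  refine ENNReal.toReal_le_of_le_ofReal (by positivity) ?_
  calc ∫⁻ ω, ENNReal.ofReal |b k ω| ∂P
      ≤ ∫⁻ ω, ENNReal.ofReal Kb *
          ∫⁻ z, estError μ σ μhat σhat k ω z ∂(P.map fun ω => (X 1 ω, ξ 1 ω)) ∂P := by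
        refine lintegral_mono fun ω => ?_
        rw [← Real.enorm_eq_ofReal_abs]
        exact hb k ω
    _ = ENNReal.ofReal Kb * ∫⁻ ω, estError μ σ μhat σhat k ω (X (k + 1) ω, ξ (k + 1) ω) ∂P := by
        rw [lintegral_const_mul' _ _ ENNReal.ofReal_ne_top, hfro]
    _ ≤ ENNReal.ofReal Kb * ENNReal.ofReal ((C₁ / 2 + 1) * v) := by gcongr
    _ = ENNReal.ofReal (Kb * ((C₁ / 2 + 1) * v)) := by rw [ENNReal.ofReal_mul hKb.le]

end Main

/-! ### Rates of the threshold and of the instantaneous error rate -/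

namespace IsRobbinsMonro

variable {Ω : Type*} [m₀ : MeasurableSpace Ω] {P : Measure Ω}
  {𝓕 : ℕ → MeasurableSpace Ω} {D Γ Z d b err : ℕ → Ω → ℝ} {β B B' κ K r lo c hi : ℝ}

theorem abs_drift_div_le (h : IsRobbinsMonro P 𝓕 D Γ Z d b β B B' κ K r lo c) (k : ℕ) (ω : Ω) :
    |d k ω / r| ≤ K * |D k ω| + |b k ω| := by
  obtain ⟨s, hs, hds⟩ := h.drift_eq k ω
  rw [hds, mul_div_cancel_left₀ _ h.rate_pos.ne']
  refine (abs_add_le _ _).trans (add_le_add_left ?_ _)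
  rw [abs_mul, abs_neg, abs_of_pos (h.slope_pos.trans_le hs.1)]
  exact mul_le_mul_of_nonneg_right hs.2 (abs_nonneg _)

variable [IsProbabilityMeasure P]

theorem slope_upper_pos (h : IsRobbinsMonro P 𝓕 D Γ Z d b β B B' κ K r lo c) : 0 < K := by
  obtain ⟨ω⟩ : Nonempty Ω := P.nonempty_of_neZero
  obtain ⟨s, hs, _⟩ := h.drift_eq 0 ω
  exact h.slope_pos.trans_le (hs.1.trans hs.2)

/-- On the event controlling both `D` and `b`, the error rate follows from `|d / r| ≤ K |D| + |b|`,
so no further probability is lost. -/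
theorem error_rate_in_probability (h : IsRobbinsMonro P 𝓕 D Γ Z d b β B B' κ K r lo c)
    (hhi : 0 < hi)
    (hΓ : ∀ᶠ k : ℕ in atTop,
      P.real {ω | hi * ((k : ℝ) + 1) ^ (-β) < Γ k ω} ≤ 1 / ((k : ℝ) + 1) ^ 3)
    (herr : ∀ k, ∀ᵐ ω ∂P, err k ω = d k ω / r) {ν₀ ν Cb : ℝ} (hν₀ : 0 < ν₀)
    (hν : ν ∈ Set.Ioc (0 : ℝ) (1 / 2)) (hCb : 0 < Cb)
    (hb : ∀ᶠ k : ℕ in atTop, P.real {ω | Cb * (Real.log ((k : ℝ) + 1) ^ ν₀ *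
      ((k : ℝ) + 1) ^ (-ν)) < |b k ω|} ≤ 1 / ((k : ℝ) + 1) ^ 3) :
    ∃ C > 0, ∀ᶠ k : ℕ in atTop, 1 - 1 / ((k : ℝ) + 1) ≤ P.real {ω | |err k ω| + |D k ω| ≤
      C * (rho β (k + 1) + Real.log ((k : ℝ) + 1) ^ ν₀ * ((k : ℝ) + 1) ^ (-ν))} := by
  have hw0 : ∀ k : ℕ, 0 ≤ Real.log ((k : ℝ) + 1) ^ ν₀ * ((k : ℝ) + 1) ^ (-ν) := fun k =>
    mul_nonneg (Real.rpow_nonneg (log_natCast_add_one_nonneg k) _) (by positivity)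
  obtain ⟨C', hC', hev⟩ := h.exists_rate_in_probability hhi zero_le_one
    (v := fun k : ℕ => Cb * (Real.log ((k : ℝ) + 1) ^ ν₀ * ((k : ℝ) + 1) ^ (-ν)))
    (fun k => mul_nonneg hCb.le (hw0 k)) (Cv := 2) one_le_two
    (Eventually.of_forall fun k j hj hjk => by
      have := logRate_half_window hν₀.le hν.1.le (by linarith [hν.2]) hj hjk
      have := mul_le_mul_of_nonneg_left this hCb.le
      linarith) hΓ hb
  have hK := h.slope_upper_pos
  refine ⟨(K + 1) * C' * (1 + Cb) + Cb, by positivity, ?_⟩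
  filter_upwards [hev] with k hk
  refine hk.trans (ENNReal.toReal_mono (measure_ne_top _ _) (measure_mono_ae ?_))
  filter_upwards [herr k] with ω hω hmem
  obtain ⟨h1, h2⟩ := hmem
  have h3 := h.abs_drift_div_le k ω
  have h4 := sqrt_log_mul_rpow_le_rho h.β_mem k
  have h5 := hw0 k
  set w := Real.log ((k : ℝ) + 1) ^ ν₀ * ((k : ℝ) + 1) ^ (-ν)
  set R := √(Real.log ((k : ℝ) + 1)) * ((k : ℝ) + 1) ^ (-β / 2)
  have hR0 : 0 ≤ R := by positivity
  change |err k ω| + |D k ω| ≤ _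
  rw [hω]
  calc |d k ω / r| + |D k ω| ≤ (K + 1) * |D k ω| + |b k ω| := by linarith
    _ ≤ (K + 1) * (C' * (R + Cb * w)) + Cb * w := by gcongr
    _ ≤ (K + 1) * (C' * ((1 + Cb) * (rho β (k + 1) + w))) + Cb * (rho β (k + 1) + w) := by
        have hCR : 0 ≤ Cb * rho β (k + 1) := mul_nonneg hCb.le (hR0.trans h4)
        gcongr
        · linarith
        · linarith
    _ = ((K + 1) * C' * (1 + Cb) + Cb) * (rho β (k + 1) + w) := by ring

/-- By Jensen the squared mean error is at most `2 K ^ 2 E[D ^ 2] + 2 E[b ^ 2]`, and boundedness of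
the bias reduces `E[b ^ 2]` to `B' E|b|`. Restricting to the event `A k` can only decrease the
error. -/
theorem error_rate_in_mean (h : IsRobbinsMonro P 𝓕 D Γ Z d b β B B' κ K r lo c)
    (hhi : 0 < hi)
    (hΓ : ∀ᶠ k : ℕ in atTop,
      P.real {ω | hi * ((k : ℝ) + 1) ^ (-β) < Γ k ω} ≤ 1 / ((k : ℝ) + 1) ^ 3)
    (herr : ∀ k, ∀ᵐ ω ∂P, err k ω = d k ω / r) {τ₀ τ Cb : ℝ} (hτ₀ : 0 < τ₀)
    (hτ : τ ∈ Set.Ioc (0 : ℝ) (1 / 2)) (hβτ : 1 - τ < β) (hCb : 0 < Cb)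
    (hb : ∀ᶠ k : ℕ in atTop, ∫ ω, |b k ω| ∂P ≤
      Cb * (Real.log ((k : ℝ) + 1) ^ τ₀ * ((k : ℝ) + 1) ^ (-τ)))
    {A : ℕ → Set Ω} (hA : ∀ k, MeasurableSet (A k)) :
    ∃ C > 0, ∀ᶠ k : ℕ in atTop,
      Integrable (fun ω => |err k ω| * (A k).indicator 1 ω) P ∧
      Integrable (fun ω => D k ω ^ 2) P ∧
      (∫ ω, |err k ω| * (A k).indicator 1 ω ∂P) ^ 2 + ∫ ω, D k ω ^ 2 ∂P ≤
        C * Real.log ((k : ℝ) + 1) ^ τ₀ * ((k : ℝ) + 1) ^ (1 - τ - β) := by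
  have hβ := h.β_mem
  have hT1 : ∀ k : ℕ, (1 : ℝ) ≤ (k : ℝ) + 1 := fun k => by
    linarith [(Nat.cast_nonneg k : (0 : ℝ) ≤ k)]
  have hlogp : ∀ᶠ k : ℕ in atTop, 1 ≤ Real.log ((k : ℝ) + 1) ^ τ₀ :=
    eventually_one_le_log.mono fun k hk => Real.one_le_rpow hk hτ₀.le
  obtain ⟨C', hC', hev⟩ := h.exists_rate_in_mean hhi (C := max 1 Cb)
    (zero_le_one.trans (le_max_left _ _))
    (v := fun k : ℕ => Real.log ((k : ℝ) + 1) ^ τ₀ * ((k : ℝ) + 1) ^ (-τ))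
    (hlogp.mono fun k hk => mul_pos (by linarith) (by positivity))
    (eventually_logRate_succ hβ.2 hτ₀.le (by linarith [hτ.2]))
    -- The squared step is dominated because `τ ≤ 1 / 2 ≤ 1 - τ < β`.
    (hlogp.mono fun k hk => le_trans
      (Real.rpow_le_rpow_of_exponent_le (hT1 k) (by linarith [hτ.2]))
      (le_mul_of_one_le_left (by positivity) hk))
    (hlogp.mono fun k hk => by
      have hT : (0 : ℝ) < (k : ℝ) + 1 := by positivity
      have e : 1 / ((k : ℝ) + 1) ^ 3 = ((k : ℝ) + 1) ^ (-(3 : ℝ)) := by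
        rw [Real.rpow_neg hT.le, one_div]
        congr 1
        exact_mod_cast (Real.rpow_natCast ((k : ℝ) + 1) 3).symm
      calc 1 / ((k : ℝ) + 1) ^ 3 ≤ ((k : ℝ) + 1) ^ (-β + -τ) := by
            rw [e]
            exact Real.rpow_le_rpow_of_exponent_le (hT1 k) (by linarith [hτ.2, hβ.2])
        _ = ((k : ℝ) + 1) ^ (-β) * ((k : ℝ) + 1) ^ (-τ) := Real.rpow_add hT _ _
        _ ≤ _ := mul_le_mul_of_nonneg_left (le_mul_of_one_le_left (by positivity) hk)
            (by positivity))
    (hΓ.mono fun k hk => hk.trans (by gcongr; exact le_max_left _ _))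
    ((hb.and hlogp).mono fun k hk => hk.1.trans (mul_le_mul_of_nonneg_right (le_max_right _ _)
      (mul_nonneg (zero_le_one.trans hk.2) (by positivity))))
  have hK := h.slope_upper_pos
  obtain ⟨ω₀⟩ : Nonempty Ω := P.nonempty_of_neZero
  have hB' : 0 ≤ B' := (abs_nonneg _).trans (h.abs_bias_le 0 ω₀)
  refine ⟨(2 * K ^ 2 + 1) * C' + 2 * B' * Cb, by positivity, ?_⟩
  filter_upwards [hev, hb, hlogp] with k hk hbk hlog
  obtain ⟨hDm, _, _, hdm, hbm⟩ := h.measurable₀ k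
  have iD2 : Integrable (fun ω => D k ω ^ 2) P :=
    Integrable.of_bound (by fun_prop) (B ^ 2) (ae_of_all _ fun ω => by
      rw [Real.norm_eq_abs, abs_pow]
      exact pow_le_pow_left₀ (abs_nonneg _) (h.abs_D_le k ω) 2)
  have ib : Integrable (fun ω => |b k ω|) P :=
    Integrable.of_bound (by fun_prop) B' (ae_of_all _ fun ω => by
      rw [Real.norm_eq_abs, abs_abs]; exact h.abs_bias_le k ω)
  set g : Ω → ℝ := fun ω => |d k ω / r| * (A k).indicator 1 ω with hg
  have hae : (fun ω => |err k ω| * (A k).indicator 1 ω) =ᵐ[P] g := by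
    filter_upwards [herr k] with ω hω
    rw [hω]
  have hgm : Measurable g :=
    (hdm.div_const r).abs.mul ((measurable_indicator_const_iff (1 : ℝ)).2 (hA k))
  have hgd : ∀ ω, |g ω| ≤ |d k ω / r| := fun ω => by
    simp only [hg, abs_mul, abs_abs]
    refine mul_le_of_le_one_right (abs_nonneg _) ?_
    by_cases hω : ω ∈ A k <;> simp [hω]
  have hgb : ∀ ω, ‖g ω‖ ≤ K * B + B' := fun ω => by
    refine (hgd ω).trans ((h.abs_drift_div_le k ω).trans ?_)
    have := h.abs_D_le k ω
    have := h.abs_bias_le k ω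
    gcongr
  have hgLp : MemLp g 2 P := MemLp.of_bound hgm.aestronglyMeasurable _ (ae_of_all _ hgb)
  refine ⟨(Integrable.of_bound hgm.aestronglyMeasurable _ (ae_of_all _ hgb)).congr hae.symm,
    iD2, ?_⟩
  rw [integral_congr_ae hae]
  have hpt : ∀ ω, g ω ^ 2 ≤ 2 * K ^ 2 * D k ω ^ 2 + 2 * B' * |b k ω| := fun ω => by
    have h1 := (hgd ω).trans (h.abs_drift_div_le k ω)
    have h2 := pow_le_pow_left₀ (abs_nonneg _) h1 2
    have h3 := mul_le_mul_of_nonneg_right (h.abs_bias_le k ω) (abs_nonneg (b k ω))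
    rw [sq_abs] at h2
    have h4 := sq_abs (D k ω)
    nlinarith [sq_nonneg (K * |D k ω| - |b k ω|)]
  have hInt : ∫ ω, g ω ^ 2 ∂P ≤ 2 * K ^ 2 * ∫ ω, D k ω ^ 2 ∂P + 2 * B' * ∫ ω, |b k ω| ∂P := by
    rw [← integral_const_mul, ← integral_const_mul,
      ← integral_add (iD2.const_mul _) (ib.const_mul _)]
    exact integral_mono hgLp.integrable_sq ((iD2.const_mul _).add (ib.const_mul _)) hpt
  have hsq := sq_integral_le_integral_sq hgLp
  set v := Real.log ((k : ℝ) + 1) ^ τ₀ * ((k : ℝ) + 1) ^ (-τ) with hv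
  -- The exponent obtained is `-τ`; it is relaxed to `1 - τ - β` using `β < 1`.
  have hvle : v ≤ Real.log ((k : ℝ) + 1) ^ τ₀ * ((k : ℝ) + 1) ^ (1 - τ - β) :=
    mul_le_mul_of_nonneg_left
      (Real.rpow_le_rpow_of_exponent_le (hT1 k) (by linarith [hβ.2])) (by linarith)
  calc (∫ ω, g ω ∂P) ^ 2 + ∫ ω, D k ω ^ 2 ∂P
      ≤ (2 * K ^ 2 + 1) * ∫ ω, D k ω ^ 2 ∂P + 2 * B' * ∫ ω, |b k ω| ∂P := by linarith
    _ ≤ (2 * K ^ 2 + 1) * (C' * v) + 2 * B' * (Cb * v) := by gcongr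
    _ = ((2 * K ^ 2 + 1) * C' + 2 * B' * Cb) * v := by ring
    _ ≤ ((2 * K ^ 2 + 1) * C' + 2 * B' * Cb) *
        (Real.log ((k : ℝ) + 1) ^ τ₀ * ((k : ℝ) + 1) ^ (1 - τ - β)) := by gcongr
    _ = _ := by ring

end IsRobbinsMonro

/-- The constants are quantified before the rate hypothesis `H`, so it is decided first whether `H`
holds; if not, any constants do. Validity for all larger `C'` lets the two rates share one constant.
-/
theorem exists_threshold_const {p : ℕ → ℝ → Prop} {H : Prop}
    (h : H → ∃ C > 0, ∀ᶠ k : ℕ in atTop, p (k + 1) C)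
    (hmono : ∀ t C C', C ≤ C' → p t C → p t C') :
    ∃ (T : ℕ) (C : ℝ), 0 < C ∧ ∀ t, T ≤ t → ∀ C', C ≤ C' → H → p t C' := by
  by_cases hH : H
  · obtain ⟨C, hC, hev⟩ := h hH
    obtain ⟨T₁, hT₁⟩ := eventually_atTop.1 hev
    refine ⟨T₁ + 1, C, hC, fun t ht C' hC' _ => ?_⟩
    have h2 := hT₁ (t - 1) (by omega)
    rw [Nat.sub_add_cancel (by omega)] at h2
    exact hmono t C C' hC' h2
  · exact ⟨0, 1, one_pos, fun _ _ _ _ h' => absurd h' hH⟩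

end OnlineSCI

/-! ### Both rates for OnlineSCI. -/

theorem mainTheorem5 {Ω 𝒳 : Type*} [MeasurableSpace Ω] [MeasurableSpace 𝒳]
    (P : Measure Ω) [IsProbabilityMeasure P]
    -- data: holdout sample, covariates, noise, responses; the regression model
    {n : ℕ} (D₀ : Fin n → Ω → 𝒳 × ℝ) (X : ℕ → Ω → 𝒳) (ξ Y : ℕ → Ω → ℝ)
    (μ σ : 𝒳 → ℝ) (f : ℝ → ℝ)
    (hmodel : OnlineSCI.IsIIDRegression P D₀ X ξ Y μ σ)
    (hnoise : OnlineSCI.IsRegularNoise P (ξ 1) f σ)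
    -- past information and estimators
    (ℱ : ℕ → MeasurableSpace Ω) (hℱ : ℱ = OnlineSCI.past D₀ X Y)
    (μhat σhat : ℕ → Ω → 𝒳 → ℝ)
    (hμhat : OnlineSCI.IsPastMeasurable ℱ μhat) (hσhat : OnlineSCI.IsPastMeasurable ℱ σhat)
    -- time-constant selection rule depending on the covariate only
    (S : 𝒳 → Bool) (hS : Measurable S) (hr : 0 < P {ω | S (X 1 ω) = true})
    -- parameters
    (α β c q₁ ν₀ ν τ₀ τ : ℝ) (hα : α ∈ Set.Ioo (0 : ℝ) 1) (hβ : β ∈ Set.Ioo (0 : ℝ) 1)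
    (hc : 0 < c) (hq₁ : q₁ ∈ Set.Icc (0 : ℝ) 1)
    (hν₀ : 0 < ν₀) (hν : ν ∈ Set.Ioc (0 : ℝ) (1 / 2))
    (hτ₀ : 0 < τ₀) (hτ : τ ∈ Set.Ioc (0 : ℝ) (1 / 2))
    -- the OnlineSCI threshold sequence, its instantaneous error rate and the target threshold
    (q : ℕ → Ω → ℝ)
    (hq : q = fun t ω => OnlineSCI.sciThreshold α (fun j => c * (j : ℝ) ^ (-β)) q₁
      (fun _ x _ => S x) (fun k x z => OnlineSCI.predInterval (μhat k ω x) (σhat k ω x) z)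
      (fun k => X k ω) (fun k => Y k ω) t)
    (IER : ℕ → Ω → ℝ)
    (hIER : IER = fun t => OnlineSCI.instErrorRate P (ℱ (t - 1)) (fun ω => S (X t ω))
      (fun ω => OnlineSCI.covErr (Y t ω)
        (OnlineSCI.predInterval (μhat t ω (X t ω)) (σhat t ω (X t ω)) (q t ω))))
    (q₀ : ℝ) (hq₀ : q₀ = OnlineSCI.targetThreshold (P.map (ξ 1)) α) :
    ∃ (T₀ : ℕ) (C₀ : ℝ), 1 ≤ T₀ ∧ 0 < C₀ ∧ ∀ t : ℕ, T₀ ≤ t →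
      (1 / 2 < β → OnlineSCI.RateInProbability P ℱ X μ σ μhat σhat ν₀ ν →
        1 - 1 / (t : ℝ) ≤ P.real {ω | |IER t ω - α| + |q t ω - q₀| ≤
          C₀ * (OnlineSCI.rho β t + Real.log t ^ ν₀ * (t : ℝ) ^ (-ν))}) ∧
      (1 - τ < β → OnlineSCI.RateInMean P X μ σ μhat σhat τ₀ τ →
        Integrable (fun ω => |IER t ω - α| * {ω | q t ω ∈ Set.Icc (0 : ℝ) 1}.indicator 1 ω) P ∧
        Integrable (fun ω => (q t ω - q₀) ^ 2) P ∧
        (∫ ω, |IER t ω - α| * {ω | q t ω ∈ Set.Icc (0 : ℝ) 1}.indicator 1 ω ∂P) ^ 2 +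
            ∫ ω, (q t ω - q₀) ^ 2 ∂P
          ≤ C₀ * Real.log t ^ τ₀ * (t : ℝ) ^ (1 - τ - β)) := by
  subst hq hIER hq₀ hℱ
  obtain ⟨Γ, Z, d, b, B, B', κ, K, r, hi, Kb, hhi, hKb, hRM, htail, hbias, hier⟩ :=
    OnlineSCI.exists_isRobbinsMonro hmodel hnoise hμhat hσhat hS hr hα hβ hc hq₁
  set q₀ := OnlineSCI.targetThreshold (P.map (ξ 1)) α
  set q : ℕ → Ω → ℝ := fun t ω => OnlineSCI.sciThreshold α (fun j => c * (j : ℝ) ^ (-β)) q₁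
      (fun _ x _ => S x) (fun k x z => OnlineSCI.predInterval (μhat k ω x) (σhat k ω x) z)
      (fun k => X k ω) (fun k => Y k ω) t with hq
  set IER : ℕ → Ω → ℝ := fun t => OnlineSCI.instErrorRate P (OnlineSCI.past D₀ X Y (t - 1))
      (fun ω => S (X t ω)) (fun ω => OnlineSCI.covErr (Y t ω)
        (OnlineSCI.predInterval (μhat t ω (X t ω)) (σhat t ω (X t ω)) (q t ω))) with hIER
  have herr : ∀ k, ∀ᵐ ω ∂P, IER (k + 1) ω - α = d k ω / r := hier
  obtain ⟨T₁, C₁, hC₁, h₁⟩ := OnlineSCI.exists_threshold_const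
    (H := 1 / 2 < β ∧
      OnlineSCI.RateInProbability P (OnlineSCI.past D₀ X Y) X μ σ μhat σhat ν₀ ν)
    (p := fun t C => 1 - 1 / (t : ℝ) ≤ P.real {ω | |IER t ω - α| + |q t ω - q₀| ≤
      C * (OnlineSCI.rho β t + Real.log t ^ ν₀ * (t : ℝ) ^ (-ν))})
    (fun hH => by
      obtain ⟨Cb, hCb, hb⟩ := hH.2.eventually_bias_tail hmodel hμhat hσhat hKb hbias
      obtain ⟨C, hC, hev⟩ := hRM.error_rate_in_probability hhi htail herr hν₀ hν hCb hb
      exact ⟨C, hC, hev.mono fun k hk => by push_cast; exact hk⟩)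
    (fun t C C' hCC' hp => hp.trans (measureReal_mono fun ω hω =>
      le_trans hω (mul_le_mul_of_nonneg_right hCC' (by
        have := Real.log_natCast_nonneg t
        unfold OnlineSCI.rho
        split_ifs <;> positivity))))
  obtain ⟨T₂, C₂, hC₂, h₂⟩ := OnlineSCI.exists_threshold_const
    (H := 1 - τ < β ∧ OnlineSCI.RateInMean P X μ σ μhat σhat τ₀ τ)
    (p := fun t C =>
      Integrable (fun ω => |IER t ω - α| * {ω | q t ω ∈ Set.Icc (0 : ℝ) 1}.indicator 1 ω) P ∧
        Integrable (fun ω => (q t ω - q₀) ^ 2) P ∧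
        (∫ ω, |IER t ω - α| * {ω | q t ω ∈ Set.Icc (0 : ℝ) 1}.indicator 1 ω ∂P) ^ 2 +
            ∫ ω, (q t ω - q₀) ^ 2 ∂P
          ≤ C * Real.log t ^ τ₀ * (t : ℝ) ^ (1 - τ - β))
    (fun hH => by
      obtain ⟨Cb, hCb, hb⟩ := hH.2.eventually_integral_bias_le hmodel hμhat hσhat hKb
        (fun k => (hRM.measurable₀ k).2.2.2.2) hbias
      have hqm : ∀ k, Measurable (q (k + 1)) := fun k =>
        (OnlineSCI.measurable_nextState hS hμhat hσhat k).1.mono (hmodel.past_le k) le_rfl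
      obtain ⟨C, hC, hev⟩ := hRM.error_rate_in_mean hhi htail herr hτ₀ hτ hH.1 hCb hb
        (A := fun k => {ω | q (k + 1) ω ∈ Set.Icc (0 : ℝ) 1})
        (fun k => hqm k measurableSet_Icc)
      exact ⟨C, hC, hev.mono fun k hk => by push_cast; exact hk⟩)
    (fun t C C' hCC' hp => ⟨hp.1, hp.2.1, hp.2.2.trans (by
      have := Real.log_natCast_nonneg t
      gcongr)⟩)
  refine ⟨max 1 (max T₁ T₂), max C₁ C₂, le_max_left _ _, lt_max_of_lt_left hC₁, fun t ht => ?_⟩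
  have ht' := le_of_max_le_right ht
  exact ⟨fun hβ' hrate => h₁ t (le_of_max_le_left ht') _ (le_max_left _ _) ⟨hβ', hrate⟩,
    fun hβ' hrate => h₂ t (le_of_max_le_right ht') _ (le_max_right _ _) ⟨hβ', hrate⟩⟩
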